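/- Conventions. All relational structures are at most countable and have a finite relational signature whose symbols have arity at least $1$. For structures $\mathbb A,\mathbb B$ of the same signature with a homomorphism $\mathbb A\to\mathbb B$, $\mathrm{PCSP}(\mathbb A,\mathbb B)$ is the promise problem of deciding whether a finite input structure $\mathbb X$ has a homomorphism to $\mathbb A$ (yes-instances) or no homomorphism to $\mathbb B$ (no-instances); $\mathrm{CSP}(\mathbb A)=\mathrm{PCSP}(\mathbb A,\mathbb A)$. Promise problems are compared by many-one reductions: a reduction maps yes-instances to yes-instances and no-instances to no-instances, and two problems are polynomial-time equivalent if each has a reduction to the other computable in polynomial time. A structure is homogeneous if every embedding of a finite substructure into it extends to an automorphism. It is finitely bounded, with bounds of size at most $k$, if every finite structure of its signature that does not embed into it has a substructure with at most $k$ elements that does not embed into it. $\mathbb B$ is a first-order reduct of $\mathbb B^+$ if they have the same domain and every relation of $\mathbb B$ is first-order definable without parameters in $\mathbb B^+$. A structure is in the scope of the Bodirsky–Pinsker conjecture if it is a first-order reduct of a finitely bounded homogeneous structure. For a structure $\mathbb X$ and $m\ge 1$, $\mathbb X^{[m]}$ is the structure with domain $X^m$, with a unary relation $R_i=\{a : (a_{i(1)},\dots,a_{i(\ell)})\in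 R^{\mathbb X}\}$ for each $\ell$-ary relation symbol $R$ and each $i\colon[\ell]\to[m]$, and a binary relation $eq_{i,j}=\{(a,b) : (a_{i(1)},\dots,a_{i(\ell)})=(b_{j(1)},\dots,b_{j(\ell)})\}$ for all $1\le\ell\le m$ and $i,j\colon[\ell]\to[m]$. The structure $\mathbb B^{[m]}/\mathrm{Aut}(\mathbb B^+)$ has as elements the orbits of $m$-tuples under $\mathrm{Aut}(\mathbb B^+)$, and its relations are the images of those of $\mathbb B^{[m]}$. A structure $\mathbb D$ is a homomorphic image of $\mathbb C$ if there is a surjective homomorphism $\mathbb C\to\mathbb D$ such that every tuple in a relation of $\mathbb D$ is the image of a tuple in the corresponding relation of $\mathbb C$. Theorem. (1) Let $m\ge 3$, let $\mathbb A,\mathbb B$ be structures with a homomorphism $\mathbb A\to\mathbb B$ whose relations have arity at most $m$, and let $\mathbb B$ be a first-order reduct of a finitely bounded homogeneous structure $\mathbb B^+$ with bounds of size at most $m$ and relations of arity at most $m-1$. Then $\mathbb B^{[m]}/\mathrm{Aut}(\mathbb B^+)$ is a finite homomorphic image of $\mathbb B^{[m]}$, $\mathbb A^{[m]}$ has a homomorphism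 to it, and $\mathbb X\mapsto\mathbb X^{[m]}$ is a full reduction from $\mathrm{PCSP}(\mathbb A,\mathbb B)$ to $\mathrm{PCSP}(\mathbb A^{[m]},\mathbb B^{[m]}/\mathrm{Aut}(\mathbb B^+))$. That is: it is (up to isomorphism of the output) a polynomial-time reduction, and for every finite or countably infinite $\mathbb X$ the map $\pi$ that sends a homomorphism $g\colon\mathbb X\to\mathbb B$ to the homomorphism $\mathbb X^{[m]}\to\mathbb B^{[m]}/\mathrm{Aut}(\mathbb B^+)$, $(a_1,\dots,a_m)\mapsto(g(a_1),\dots,g(a_m))/\mathrm{Aut}(\mathbb B^+)$, is onto the set of all such homomorphisms. Moreover, $\mathrm{PCSP}(\mathbb A,\mathbb B)$ and $\mathrm{PCSP}(\mathbb A^{[m]},\mathbb B^{[m]}/\mathrm{Aut}(\mathbb B^+))$ are polynomial-time equivalent. (2) For every $\mathbb C$ in the scope of the Bodirsky–Pinsker conjecture, $\mathrm{CSP}(\mathbb C)$ is polynomial-time equivalent to a problem $\mathrm{PCSP}(\mathbb A,\mathbb B)$ where $\mathbb A$ is in the scope of the Bodirsky–Pinsker conjecture and $\mathbb B$ is a finite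 homomorphic image of $\mathbb A$. -/

import Mathlib

universe u v w

open scoped FirstOrder

noncomputable section

namespace PromiseCSP

open FirstOrder FirstOrder.Language

/-! ### Relational structures -/

/-- The standing convention on signatures: only relation symbols, finitely many of them,
each of arity at least one. -/
class FiniteSignature (L : FirstOrder.Language.{0, 0}) : Prop where
  isRelational : L.IsRelational
  finite_relations : Finite (Σ ℓ, L.Relations ℓ)
  no_nullary : IsEmpty (L.Relations 0)

/-- All relation symbols of `L` have arity at most `k`. -/
def ArityAtMost (L : FirstOrder.Language.{0, 0}) (k : ℕ) : Prop :=
  ∀ ℓ, Nonempty (L.Relations ℓ) → ℓ ≤ k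

/-- Every finite structure that does not embed into `M` has a substructure with at most `k`
elements that does not embed into `M` either. -/
def HasBoundsOfSizeAtMost (L : FirstOrder.Language.{0, 0}) (M : Type u) [L.Structure M] (k : ℕ) : Prop :=
  ∀ (N : Type) [Finite N] [L.Structure N], IsEmpty (N ↪[L] M) →
    ∃ S : L.Substructure N, Nat.card S ≤ k ∧ IsEmpty (S ↪[L] M)

/-- The `L`-structure on `B` is a first-order reduct of the `L'`-structure on the same set:
each of its relations has a first-order definition (without parameters) in the latter. -/
def IsFirstOrderReduct (L L' : FirstOrder.Language.{0, 0}) (B : Type u) [L.Structure B] [L'.Structure B] :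
    Prop :=
  ∀ (ℓ : ℕ) (R : L.Relations ℓ), ∃ φ : L'.Formula (Fin ℓ), ∀ x : Fin ℓ → B,
    Structure.RelMap R x ↔ φ.Realize x

/-- The templates in the scope of the Bodirsky–Pinsker conjecture: (at most countable)
first-order reducts of finitely bounded homogeneous structures, in finite signatures. -/
def InBodirskyPinskerScope (L : FirstOrder.Language.{0, 0}) (C : Type u) [L.Structure C] : Prop :=
  FiniteSignature L ∧ Countable C ∧
    ∃ (L' : FirstOrder.Language.{0, 0}) (_ : L'.Structure C), FiniteSignature L' ∧
      L'.IsUltrahomogeneous C ∧ (∃ k, HasBoundsOfSizeAtMost L' C k) ∧ IsFirstOrderReduct L L' C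

/-- `B` is a homomorphic image of `A`: there is a surjective map from `A` to `B` such that the
relations of `B` are exactly the images of the relations of `A`. -/
def IsHomomorphicImage (L : FirstOrder.Language.{0, 0}) (A : Type u) (B : Type v)
    [L.Structure A] [L.Structure B] : Prop :=
  ∃ q : A →[L] B, Function.Surjective q ∧
    ∀ (ℓ : ℕ) (R : L.Relations ℓ) (y : Fin ℓ → B),
      Structure.RelMap R y → ∃ x : Fin ℓ → A, Structure.RelMap R x ∧ ∀ k, q (x k) = y k

/-! ### Quotients -/

/-- The set of equivalence classes of `θ`, to be equipped with the images of relations. -/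
def RelQuot {M : Type u} (θ : Setoid M) : Type u := Quotient θ

def RelQuot.mk {M : Type u} (θ : Setoid M) (x : M) : RelQuot θ := Quotient.mk θ x

/-- The relations of a quotient are the images of the relations under the projection
(function symbols do not occur in relational languages). -/
instance {L : FirstOrder.Language.{0, 0}} [hL : FiniteSignature L] {M : Type u} [L.Structure M]
    (θ : Setoid M) : L.Structure (RelQuot θ) where
  funMap f := ((hL.isRelational _).false f).elim
  RelMap R y := ∃ x, Structure.RelMap R x ∧ ∀ k, RelQuot.mk θ (x k) = y k

/-! ### The structure `X^{[m]}` -/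

/-- The relation symbols of `L^{[m]}`. -/
inductive MPowRel (L : FirstOrder.Language.{0, 0}) (m : ℕ) : ℕ → Type
  | unary {ℓ : ℕ} (R : L.Relations ℓ) (i : Fin ℓ → Fin m) : MPowRel L m 1
  | eq (ℓ : ℕ) (one_le : 1 ≤ ℓ) (le_m : ℓ ≤ m) (i j : Fin ℓ → Fin m) : MPowRel L m 2

/-- The signature of the structures `X^{[m]}`, for `L`-structures `X`. -/
def mpowLang (L : FirstOrder.Language.{0, 0}) (m : ℕ) : FirstOrder.Language.{0, 0} := ⟨fun _ => Empty, MPowRel L m⟩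

instance (L : FirstOrder.Language.{0, 0}) [hL : FiniteSignature L] (m : ℕ) :
    FiniteSignature (mpowLang L m) where
  isRelational _ := inferInstanceAs (IsEmpty Empty)
  no_nullary := ⟨fun R => by cases R⟩
  finite_relations := by
    have := hL.finite_relations
    let α := Σ s : (Σ ℓ, L.Relations ℓ), (Fin s.1 → Fin m)
    let β := Σ ℓ : Fin (m + 1), (Fin ℓ → Fin m) × (Fin ℓ → Fin m)
    let g : (Σ ℓ, (mpowLang L m).Relations ℓ) → α ⊕ β := fun s =>
      match s with
      | ⟨_, MPowRel.unary R i⟩ => Sum.inl ⟨⟨_, R⟩, i⟩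
      | ⟨_, MPowRel.eq ℓ _ h i j⟩ => Sum.inr ⟨⟨ℓ, Nat.lt_succ_of_le h⟩, i, j⟩
    refine Finite.of_injective g ?_
    rintro ⟨_, s⟩ ⟨_, t⟩ h
    cases s <;> cases t <;> simp only [g, Sum.inl.injEq, Sum.inr.injEq, reduceCtorEq] at h
    · cases h
      rfl
    · cases h
      rfl

/-- The domain of `X^{[m]}`. -/
def MPow (m : ℕ) (X : Type u) : Type u := Fin m → X

instance (L : FirstOrder.Language.{0, 0}) (m : ℕ) (X : Type u) [L.Structure X] :
    (mpowLang L m).Structure (MPow m X) where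
  funMap f := Empty.elim f
  RelMap {_} R := match R with
    | MPowRel.unary R i => fun a => Structure.RelMap R fun k => a 0 (i k)
    | MPowRel.eq _ _ _ i j => fun a => ∀ k, a 0 (i k) = a 1 (j k)

/-- Two `m`-tuples are equivalent when they lie in the same orbit of the automorphism group of
the `L'`-structure `B`. -/
def orbitSetoid (L' : FirstOrder.Language.{0, 0}) (m : ℕ) (B : Type u) [L'.Structure B] :
    Setoid (MPow m B) where
  r a b := ∃ α : B ≃[L'] B, ∀ k, α (a k) = b k
  iseqv :=
    { refl := fun _ => ⟨FirstOrder.Language.Equiv.refl L' B, fun _ => rfl⟩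
      symm := fun ⟨α, h⟩ => ⟨α.symm, fun k => by rw [← h k, α.symm_apply_apply]⟩
      trans := fun ⟨α, h⟩ ⟨β, h'⟩ =>
        ⟨β.comp α, fun k => by rw [FirstOrder.Language.Equiv.comp_apply, h k, h' k]⟩ }

/-- The domain of `B^{[m]}/Aut(B⁺)`, where `B⁺` is the `L'`-structure on `B`. -/
abbrev MPowQuot (L' : FirstOrder.Language.{0, 0}) (m : ℕ) (B : Type u) [L'.Structure B] : Type u :=
  RelQuot (orbitSetoid L' m B)

/-- The map `π` from homomorphisms `X → B` to homomorphisms `X^{[m]} → B^{[m]}/Aut(B⁺)`, sending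
`g` to `(a₁, …, aₘ) ↦ (g a₁, …, g aₘ)/Aut(B⁺)`. -/
def mpowPi (L L' : FirstOrder.Language.{0, 0}) [FiniteSignature L] (m : ℕ) (X : Type u) (B : Type v)
    [L.Structure X] [L.Structure B] [L'.Structure B] (g : X →[L] B) :
    MPow m X →[mpowLang L m] MPowQuot L' m B where
  toFun a := RelQuot.mk (orbitSetoid L' m B) fun k => g (a k)
  map_fun' f := Empty.elim f
  map_rel' {_} R a h := by
    refine ⟨fun k p => g (a k p), ?_, fun _ => rfl⟩
    cases R with
    | unary R i => exact g.map_rel R _ h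
    | eq ℓ h1 hm i j => exact fun k => congrArg g (h k)

/-! ### Instances, promise problems, polynomial-time reductions -/

/-- An input structure: a finite structure with domain `{0, …, size - 1}`. -/
structure FinInstance (L : FirstOrder.Language.{0, 0}) : Type where
  size : ℕ
  str : L.Structure (Fin size)

def FinInstance.Carrier {L : FirstOrder.Language.{0, 0}} (X : FinInstance L) : Type := Fin X.size

instance {L : FirstOrder.Language.{0, 0}} (X : FinInstance L) : L.Structure X.Carrier := X.str

/-- A listing of the relation symbols, used to write down structures. -/
def symbolList (L : FirstOrder.Language.{0, 0}) [hL : FiniteSignature L] : List (Σ ℓ, L.Relations ℓ) :=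
  haveI := hL.finite_relations
  (@Finset.univ _ (Fintype.ofFinite (Σ ℓ, L.Relations ℓ))).toList

open scoped Classical in
/-- The standard encoding of a finite structure with `n` elements as a binary word: the word
`1ⁿ0`, followed by, for each symbol of arity `ℓ`, the table of the `n ^ ℓ` truth values
of its interpretation; the `ℓ`-tuple `x` is listed at position `∑ k, x k * n ^ k`. -/
def FinInstance.encode {L : FirstOrder.Language.{0, 0}} [FiniteSignature L] (X : FinInstance L) :
    List Bool :=
  List.replicate X.size true ++ false :: (symbolList L).flatMap fun s =>
    List.ofFn fun p : Fin (X.size ^ s.1) =>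
      decide (X.str.RelMap s.2 (finFunctionFinEquiv.symm p))

/-- A promise problem, with instances encoded as binary words. -/
structure PromiseProblem where
  Inst : Type
  encode : Inst → List Bool
  yes : Set Inst
  no : Set Inst

/-- `PCSP(A, B)`: decide whether an input structure has a homomorphism to `A` or no
homomorphism to `B`. -/
def PCSP (L : FirstOrder.Language.{0, 0}) [FiniteSignature L] (A : Type u) (B : Type v)
    [L.Structure A] [L.Structure B] : PromiseProblem where
  Inst := FinInstance L
  encode := FinInstance.encode
  yes := {X | Nonempty (X.Carrier →[L] A)}
  no := {X | IsEmpty (X.Carrier →[L] B)}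

/-- `CSP(C) = PCSP(C, C)`. -/
def CSP (L : FirstOrder.Language.{0, 0}) [FiniteSignature L] (C : Type u) [L.Structure C] : PromiseProblem :=
  PCSP L C C

/-- `f` is computed by a Turing machine in polynomial time. -/
def IsPolyTime (P Q : PromiseProblem) (f : P.Inst → Q.Inst) : Prop :=
  Nonempty (Turing.TM2ComputableInPolyTime P.encode Q.encode f)

/-- `f` is a polynomial-time (many-one) reduction from `P` to `Q`. -/
def IsPolyReduction (P Q : PromiseProblem) (f : P.Inst → Q.Inst) : Prop :=
  IsPolyTime P Q f ∧ (∀ x ∈ P.yes, f x ∈ Q.yes) ∧ (∀ x ∈ P.no, f x ∈ Q.no)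

/-- `P` and `Q` are polynomial-time equivalent. -/
def PolyEquivalent (P Q : PromiseProblem) : Prop :=
  (∃ f, IsPolyReduction P Q f) ∧ (∃ g, IsPolyReduction Q P g)

/-- The operator `X ↦ X^{[m]}` is a full reduction from `PCSP(A, B)` to
`PCSP(A^{[m]}, B^{[m]}/Aut(B⁺))`, where `B⁺` is the `L'`-structure on `B`. -/
structure IsFullReduction (L L' : FirstOrder.Language.{0, 0}) [FiniteSignature L] (m : ℕ)
    (A : Type u) (B : Type v) [L.Structure A] [L.Structure B] [L'.Structure B] : Prop where
  /-- A map computing (an isomorphic copy of) `X^{[m]}` is a polynomial-time reduction. -/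
  reduction : ∃ f : FinInstance L → FinInstance (mpowLang L m),
    (∀ X : FinInstance L, Nonempty ((f X).Carrier ≃[mpowLang L m] MPow m X.Carrier)) ∧
    IsPolyReduction (PCSP L A B) (PCSP (mpowLang L m) (MPow m A) (MPowQuot L' m B)) f
  /-- Every homomorphism `X^{[m]} → B^{[m]}/Aut(B⁺)` is of the form `π(g)`; here `X` may be
  finite or countably infinite. -/
  full : ∀ (X : Type w) [Countable X] [L.Structure X],
    Function.Surjective (mpowPi L L' m X B)

end PromiseCSP

end

/-! Why the operator is full. A homomorphism `h` from `X^{[m]}` to `B^{[m]}/Aut(B⁺)` assigns an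
orbit to every `m`-tuple of `X`. By homogeneity an orbit is a quantifier-free type over `B⁺`, and
the relations `eq` force the types of two tuples to agree on whatever entries they share. So `h` is
a consistent system of local types, on at most `m` elements at a time. Such systems glue
(`exists_realizes`): prescribed equality is an equivalence relation, because transitivity involves
only three elements, and it is compatible with the prescribed relations, because exchanging one
entry of a tuple involves at most `(m - 1) + 1` elements. The quotient of `X` is a countable
structure whose substructures of size at most `m` all embed into `B⁺`; by the bounds all its finite
substructures embed, and by homogeneity so does the whole quotient. The composite `X → B` preserves
the relations of `B`, as each of their tuples fits into one `m`-tuple and definable relations are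
unions of orbits, and its image under `π` is `h` (`surjective_mpowPi`). Hence no-instances go to
no-instances; for yes-instances the operator is simply applied to homomorphisms.

The reduction back is a left adjoint of the operator, up to homomorphic equivalence. In `glue Y`
every element of `Y` is split into `m` coordinates. Coordinates linked by `eq` are not identified;
the relations are saturated under the generated equivalence instead, so the domain has size `m *
|Y|` and no representatives need to be computed. This direction needs none of the hypotheses on the
templates (`isPolyReduction_glue`).

For (2), part (1) is applied with `A = B = C` and `m` large. That `C^{[m]}` stays in the scope is
seen from the structure on `m`-tuples that compares coordinates. It is homogeneous because
automorphisms act coordinatewise, its bounds come from the same gluing lemma applied to `N × Fin m`,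
and it defines `C^{[m]}` because the relations are invariant under equality of quantifier-free
types.

Polynomial time is proved for actual multi-stack machines. Structures are kept as tables of bits,
counters in unary, and an output table is written by evaluating, at each position, a formula with
quantifiers bounded by counters. This suffices for `X^{[m]}`; for gluing, the equivalence relation
is computed beforehand by Warshall's algorithm. -/

open scoped FirstOrder

noncomputable section

namespace PromiseCSP

open FirstOrder FirstOrder.Language

open Turing

/-! ### Program fragments for machines with stacks of bits -/

section Steps

variable {K Λ : Type} [DecidableEq K]

/-- Statements of machines all of whose stacks hold bits, and whose internal state is the
symbol that was read last. -/
abbrev BitStmt (K Λ : Type) : Type := TM2.Stmt (fun _ : K => Bool) Λ (Option Bool)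

abbrev BitCfg (K Λ : Type) : Type := TM2.Cfg (fun _ : K => Bool) Λ (Option Bool)

/-- `Steps M c c' t`: the program `M` leads from `c` to `c'` in at most `t` steps. -/
inductive Steps (M : Λ → BitStmt K Λ) : BitCfg K Λ → BitCfg K Λ → ℕ → Prop
  | refl (c : BitCfg K Λ) (t : ℕ) : Steps M c c t
  | head {c c' c'' : BitCfg K Λ} {t : ℕ} (h : TM2.step M c = some c') (h' : Steps M c' c'' t) :
      Steps M c c'' (t + 1)

variable {M : Λ → BitStmt K Λ}

theorem Steps.mono {c c' : BitCfg K Λ} {t t' : ℕ} (h : Steps M c c' t) (ht : t ≤ t') :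
    Steps M c c' t' := by
  induction h generalizing t' with
  | refl c t => exact .refl _ _
  | head h _ ih =>
    obtain ⟨s, rfl⟩ : ∃ s, t' = s + 1 := ⟨t' - 1, by omega⟩
    exact .head h (ih (by omega))

theorem Steps.trans {c c' c'' : BitCfg K Λ} {t t' : ℕ} (h : Steps M c c' t)
    (h' : Steps M c' c'' t') : Steps M c c'' (t + t') := by
  induction h with
  | refl c t => exact h'.mono (by omega)
  | head h _ ih => exact Steps.mono (.head h (ih h')) (by omega)

/-- The machine model measures runs by exact iterates of the partial step function, so the bound `t`
has to yield an actual number of iterations. -/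
theorem Steps.exists_iterate {c c' : BitCfg K Λ} {t : ℕ} (h : Steps M c c' t) :
    ∃ k ≤ t, (flip bind (TM2.step M))^[k] (some c) = some c' := by
  induction h with
  | refl c t => exact ⟨0, by omega, rfl⟩
  | head h _ ih =>
    obtain ⟨k, hk, e⟩ := ih
    refine ⟨k + 1, by omega, ?_⟩
    rw [Function.iterate_succ_apply, ← e]
    congr 1

end Steps

/-- Continue at the label `e` instead of halting, and rename labels. -/
def stmtBind {K Λ Λ' : Type} (ι : Λ → Λ') (e : Λ') : BitStmt K Λ → BitStmt K Λ'
  | .push k f q => .push k f (stmtBind ι e q)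
  | .peek k f q => .peek k f (stmtBind ι e q)
  | .pop k f q => .pop k f (stmtBind ι e q)
  | .load a q => .load a (stmtBind ι e q)
  | .branch p q₁ q₂ => .branch p (stmtBind ι e q₁) (stmtBind ι e q₂)
  | .goto l => .goto fun v => ι (l v)
  | .halt => .goto fun _ => e

def cfgBind {K Λ Λ' : Type} (ι : Λ → Λ') (e : Λ') (c : BitCfg K Λ) : BitCfg K Λ' :=
  ⟨some (c.l.elim e ι), c.var, c.stk⟩

section

variable {K Λ Λ' : Type} [DecidableEq K]

theorem stepAux_stmtBind (ι : Λ → Λ') (e : Λ') (q : BitStmt K Λ) (v : Option Bool)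
    (S : K → List Bool) :
    TM2.stepAux (stmtBind ι e q) v S = cfgBind ι e (TM2.stepAux q v S) := by
  induction q generalizing v S with
  | branch p q₁ q₂ ih₁ ih₂ =>
    simp only [stmtBind, TM2.stepAux]
    cases p v
    · exact ih₂ _ _
    · exact ih₁ _ _
  | goto l => rfl
  | halt => rfl
  | _ => simp only [stmtBind, TM2.stepAux, *]

/-- A simulation: `cfgBind` sends halting configurations to the label `e`, so a finished run of `M`
becomes a run of `M'` that is about to continue at `e`. -/
theorem Steps.bind {M : Λ → BitStmt K Λ} {M' : Λ' → BitStmt K Λ'} (ι : Λ → Λ') (e : Λ')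
    (h : ∀ l, M' (ι l) = stmtBind ι e (M l)) {c c' : BitCfg K Λ} {t : ℕ} (hs : Steps M c c' t) :
    Steps M' (cfgBind ι e c) (cfgBind ι e c') t := by
  induction hs with
  | refl c t => exact .refl _ _
  | @head c c' c'' t h' _ ih =>
    refine .head ?_ ih
    obtain ⟨l, v, S⟩ := c
    cases l with
    | none => simp at h'
    | some l =>
      simp only [TM2.step, Option.some.injEq] at h'
      simp only [cfgBind, Option.elim, TM2.step, h l, stepAux_stmtBind, h']

end

/-- A program fragment, which is left by halting. -/
structure Frag (K : Type) where
  Λ : Type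
  fintype : Fintype Λ
  entry : Λ
  code : Λ → BitStmt K Λ

namespace Frag

variable {K : Type} [DecidableEq K]

/-- `F.Runs v S v' S' t`: when entered with internal state `v` and stacks `S`, the fragment is
left with internal state `v'` and stacks `S'` after at most `t` steps. -/
def Runs (F : Frag K) (v : Option Bool) (S : K → List Bool) (v' : Option Bool)
    (S' : K → List Bool) (t : ℕ) : Prop :=
  Steps F.code ⟨some F.entry, v, S⟩ ⟨none, v', S'⟩ t

/-- The effect on the stacks, when the internal state does not matter. -/
def Does (F : Frag K) (S S' : K → List Bool) (t : ℕ) : Prop :=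
  ∀ v, ∃ v', F.Runs v S v' S' t

theorem Does.mono {F : Frag K} {S S' : K → List Bool} {t t' : ℕ} (h : F.Does S S' t)
    (ht : t ≤ t') : F.Does S S' t' := fun v =>
  let ⟨v', h'⟩ := h v
  ⟨v', Steps.mono h' ht⟩

theorem Does.congr {F : Frag K} {S S' S'' : K → List Bool} {t t' : ℕ} (h : F.Does S S' t)
    (e : S' = S'') (ht : t ≤ t') : F.Does S S'' t' := e ▸ h.mono ht

/-- The fragment that consists of a single statement. -/
def stmt (q : BitStmt K Unit) : Frag K := ⟨Unit, inferInstance, (), fun _ => q⟩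

theorem stmt_runs {q : BitStmt K Unit} {v v' : Option Bool} {S S' : K → List Bool}
    (h : TM2.stepAux q v S = ⟨none, v', S'⟩) : (stmt q).Runs v S v' S' 1 :=
  .head (congrArg some h) (.refl _ _)

/-- One fragment after the other. -/
def seq (F G : Frag K) : Frag K where
  Λ := F.Λ ⊕ G.Λ
  fintype := haveI := F.fintype; haveI := G.fintype; inferInstance
  entry := Sum.inl F.entry
  code l := match l with
    | Sum.inl l => stmtBind Sum.inl (Sum.inr G.entry) (F.code l)
    | Sum.inr l => mapHalt (G.code l)
where
  /-- Rename the labels of the second fragment. -/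
  mapHalt : BitStmt K G.Λ → BitStmt K (F.Λ ⊕ G.Λ)
    | .push k f q => .push k f (mapHalt q)
    | .peek k f q => .peek k f (mapHalt q)
    | .pop k f q => .pop k f (mapHalt q)
    | .load a q => .load a (mapHalt q)
    | .branch p q₁ q₂ => .branch p (mapHalt q₁) (mapHalt q₂)
    | .goto l => .goto fun v => Sum.inr (l v)
    | .halt => .halt

theorem seq_stepAux (F G : Frag K) (q : BitStmt K G.Λ) (v : Option Bool) (S : K → List Bool) :
    TM2.stepAux (seq.mapHalt F G q) v S =
      ⟨(TM2.stepAux q v S).l.map Sum.inr, (TM2.stepAux q v S).var, (TM2.stepAux q v S).stk⟩ := by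
  induction q generalizing v S with
  | branch p q₁ q₂ ih₁ ih₂ =>
    simp only [seq.mapHalt, TM2.stepAux]
    cases p v
    · exact ih₂ _ _
    · exact ih₁ _ _
  | goto l => rfl
  | halt => rfl
  | _ => simp only [seq.mapHalt, TM2.stepAux, *]

theorem seq_steps_right (F G : Frag K) {c c' : BitCfg K G.Λ} {t : ℕ} (h : Steps G.code c c' t) :
    Steps (seq F G).code ⟨c.l.map Sum.inr, c.var, c.stk⟩ ⟨c'.l.map Sum.inr, c'.var, c'.stk⟩ t := by
  induction h with
  | refl c t => exact .refl _ _
  | @head c c' c'' t h' _ ih =>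
    refine .head ?_ ih
    obtain ⟨l, v, S⟩ := c
    cases l with
    | none => simp at h'
    | some l =>
      simp only [TM2.step, Option.some.injEq] at h'
      simp only [Option.map, TM2.step, seq, seq_stepAux, h']

theorem seq_runs {F G : Frag K} {v v' v'' : Option Bool} {S S' S'' : K → List Bool} {t t' : ℕ}
    (h : F.Runs v S v' S' t) (h' : G.Runs v' S' v'' S'' t') :
    (seq F G).Runs v S v'' S'' (t + t') :=
  Steps.trans (Steps.bind (M' := (seq F G).code) Sum.inl (Sum.inr G.entry) (fun _ => rfl) h)
    (seq_steps_right F G h')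

theorem seq_does {F G : Frag K} {S S' S'' : K → List Bool} {t t' : ℕ}
    (h : F.Does S S' t) (h' : G.Does S' S'' t') : (seq F G).Does S S'' (t + t') := fun v =>
  let ⟨v', e⟩ := h v
  let ⟨v'', e'⟩ := h' v'
  ⟨v'', seq_runs e e'⟩

/-- Remove symbols from the stack `k` until it is empty, each time running `F` with the removed
symbol as the internal state. -/
def whilePop (k : K) (F : Frag K) : Frag K where
  Λ := Option F.Λ
  fintype := haveI := F.fintype; inferInstance
  entry := none
  code l := match l with
    | none => .pop k (fun _ o => o) (.branch Option.isSome (.goto fun _ => some F.entry) .halt)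
    | some l => stmtBind some none (F.code l)

theorem Runs.congr_right {F : Frag K} {v v' : Option Bool} {S S' S'' : K → List Bool} {t : ℕ}
    (h : F.Runs v S v' S' t) (e : S' = S'') : F.Runs v S v' S'' t := e ▸ h

theorem whilePop_runs_nil {k : K} {F : Frag K} {v : Option Bool} {S : K → List Bool}
    (h : S k = []) : (whilePop k F).Runs v S none S 1 := by
  refine .head ?_ (.refl _ _)
  have : Function.update S k [] = S := by rw [← h, Function.update_eq_self]
  simp [whilePop, h, this]

theorem whilePop_runs_cons {k : K} {F : Frag K} {b : Bool} {l : List Bool}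
    {v v' v'' : Option Bool} {S S' S'' : K → List Bool} {t t' : ℕ} (h : S k = b :: l)
    (hF : F.Runs (some b) (Function.update S k l) v' S' t)
    (h' : (whilePop k F).Runs v' S' v'' S'' t') :
    (whilePop k F).Runs v S v'' S'' (t + t' + 1) := by
  have h1 := Steps.bind (M' := (whilePop k F).code) some none (fun _ => rfl) hF
  refine Steps.head ?_ (h1.trans h')
  simp [whilePop, h, cfgBind]

/-- The rule for loops counting down. -/
theorem whilePop_does {k : K} {F : Frag K} {t : ℕ} (Q : ℕ → K → List Bool)
    (hQ : ∀ i, Q i k = List.replicate i true) (n : ℕ)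
    (h : ∀ i < n, ∃ v', F.Runs (some true)
      (Function.update (Q (i + 1)) k (List.replicate i true)) v' (Q i) t) :
    (whilePop k F).Does (Q n) (Q 0) (n * (t + 1) + 1) := by
  intro v
  refine ⟨none, ?_⟩
  induction n generalizing v with
  | zero => exact Steps.mono (whilePop_runs_nil (by simp [hQ])) (by omega)
  | succ n ih =>
    obtain ⟨v', hv⟩ := h n (by omega)
    refine Steps.mono (whilePop_runs_cons (by rw [hQ]; rfl) hv
      (ih (fun i hi => h i (by omega)) v')) ?_
    rw [Nat.succ_mul]
    omega

/-- Move the content of the stack `a` to the stack `b`. -/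
def move (a b : K) : Frag K := whilePop a (stmt (.push b (fun o => o.getD false) .halt))

theorem move_does {a b : K} (hab : a ≠ b) (S : K → List Bool) :
    (move a b).Does S (Function.update (Function.update S a []) b ((S a).reverse ++ S b))
      ((S a).length * 2 + 1) := by
  intro v
  refine ⟨none, ?_⟩
  generalize hl : S a = l
  induction l generalizing S v with
  | nil =>
    have : Function.update (Function.update S a []) b ([].reverse ++ S b) = S := by
      rw [← hl, Function.update_eq_self, hl]
      simp
    rw [this]
    exact whilePop_runs_nil hl
  | cons c l ih =>
    have h := ih (S := Function.update (Function.update S a l) b (c :: S b)) (some c)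
      (by simp [hab])
    have e : Function.update (Function.update (Function.update (Function.update S a l) b
        (c :: S b)) a []) b (l.reverse ++ Function.update (Function.update S a l) b (c :: S b) b) =
        Function.update (Function.update S a []) b ((c :: l).reverse ++ S b) := by
      funext k
      simp only [Function.update_apply]
      split_ifs <;> simp_all
    rw [e] at h
    refine Steps.mono (whilePop_runs_cons hl (v' := some c) (stmt_runs ?_) h) ?_
    · simp [hab.symm]
    · simp only [List.length_cons]
      omega

/-- Variant of `move_does` with the effect described stack by stack. -/
theorem move_does' {a b : K} (hab : a ≠ b) {S S' : K → List Bool} (ha : S' a = [])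
    (hb : S' b = (S a).reverse ++ S b) (h : ∀ k, k ≠ a → k ≠ b → S' k = S k) :
    (move a b).Does S S' ((S a).length * 2 + 1) := by
  convert move_does hab S using 1
  funext k
  simp only [Function.update_apply]
  split_ifs with h1 h2 <;> simp_all

/-- Empty the stack `a`. -/
def clear (a : K) : Frag K := whilePop a (stmt .halt)

theorem clear_does (a : K) (S : K → List Bool) :
    (clear a).Does S (Function.update S a []) ((S a).length * 2 + 1) := by
  intro v
  refine ⟨none, ?_⟩
  generalize hl : S a = l
  induction l generalizing S v with
  | nil => exact (whilePop_runs_nil hl).congr_right (by rw [← hl, Function.update_eq_self])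
  | cons c l ih =>
    have h := ih (S := Function.update S a l) (some c) (by simp)
    rw [Function.update_idem] at h
    exact Steps.mono (whilePop_runs_cons hl (stmt_runs rfl) h) (by simp; omega)

/-- Add the content of `a` to `b`, where `w` is used for intermediate results. -/
def copy (a b w : K) : Frag K :=
  seq (move a w) (whilePop w (stmt (.push a (fun o => o.getD false)
    (.push b (fun o => o.getD false) .halt))))

theorem copy_does {a b w : K} (hab : a ≠ b) (haw : a ≠ w) (hbw : b ≠ w) {S S' : K → List Bool}
    (hw : S w = []) (hb : S' b = S a ++ S b) (h : ∀ k, k ≠ b → S' k = S k) :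
    (copy a b w).Does S S' ((S a).length * 4 + 2) := by
  -- Unloading `w` puts `l` reversed onto `a` and `b`. As the preceding `move` has reversed it once,
  -- the original order returns.
  have key : ∀ (l : List Bool) (v : Option Bool) (S S' : K → List Bool), S w = l → S' w = [] →
      S' a = l.reverse ++ S a → S' b = l.reverse ++ S b →
      (∀ k, k ≠ w → k ≠ a → k ≠ b → S' k = S k) →
      (whilePop w (stmt (.push a (fun o => o.getD false)
        (.push b (fun o => o.getD false) .halt)))).Runs v S none S' (l.length * 2 + 1) := by
    intro l
    induction l with
    | nil =>
      intro v S S' h1 h2 h3 h4 h5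
      have : S' = S := by
        funext k
        by_cases k = w <;> by_cases k = a <;> by_cases k = b <;> simp_all
      rw [this]
      exact whilePop_runs_nil h1
    | cons c l ih =>
      intro v S S' h1 h2 h3 h4 h5
      refine Steps.mono (whilePop_runs_cons h1 (v' := some c) (stmt_runs rfl)
        (ih _ _ S' ?_ h2 ?_ ?_ ?_)) (by simp; omega)
      · simp [haw.symm, hbw.symm]
      · simp [haw, hab, h3]
      · simp [hab.symm, hbw, h4]
      · intro k hw ha hb
        simp [hw, ha, hb, h5]
  refine Does.mono (seq_does (move_does haw S) (fun v => ⟨none, key _ v _ S' rfl ?_ ?_ ?_ ?_⟩)) ?_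
  · rw [h _ hbw.symm, hw]
  · simp [haw, hw, h a hab]
  · simp [hbw, hw, hab.symm, hb]
  · intro k h1 h2 h3
    simp [h1, h2, h k h3]
  · simp [hw]
    omega

end Frag

/-! ### Formulas over counters and tables, and their evaluation -/

/-- The stacks: counters (in unary), tables of bits, and auxiliary stacks. -/
inductive Stk (V J : Type) : Type
  | var (v : V)
  | tab (j : J)
  | p
  | q
  | w
  | tmp
  | ev
  | inp

instance (V J : Type) : DecidableEq (Stk V J) := Classical.decEq _

instance (V J : Type) [Finite V] [Finite J] : Finite (Stk V J) := by
  let g : V ⊕ J ⊕ Fin 6 → Stk V J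
    | Sum.inl v => .var v
    | Sum.inr (Sum.inl j) => .tab j
    | Sum.inr (Sum.inr i) => ![.p, .q, .w, .tmp, .ev, .inp] i
  refine Finite.of_surjective g ?_
  rintro (v | j | _ | _ | _ | _ | _ | _)
  · exact ⟨Sum.inl v, rfl⟩
  · exact ⟨Sum.inr (Sum.inl j), rfl⟩
  · exact ⟨Sum.inr (Sum.inr 0), rfl⟩
  · exact ⟨Sum.inr (Sum.inr 1), rfl⟩
  · exact ⟨Sum.inr (Sum.inr 2), rfl⟩
  · exact ⟨Sum.inr (Sum.inr 3), rfl⟩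
  · exact ⟨Sum.inr (Sum.inr 4), rfl⟩
  · exact ⟨Sum.inr (Sum.inr 5), rfl⟩

variable {V J : Type}

/-- The stacks that store the counters `x`, the tables `T`, the truth values `e` and the unread
input `r`. -/
def store (x : V → ℕ) (T : J → List Bool) (e r : List Bool) : Stk V J → List Bool
  | .var v => List.replicate (x v) true
  | .tab j => T j
  | .ev => e
  | .inp => r
  | _ => []

/-- The number with the digits and bases listed by `l`, least significant digit first. -/
def idx (x : V → ℕ) : List (V × V) → ℕ
  | [] => 0
  | (d, b) :: l => x d + x b * idx x l

def idxBound : List (V × V) → Polynomial ℕ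
  | [] => 0
  | _ :: l => Polynomial.X + Polynomial.X * idxBound l

theorem idx_le (x : V → ℕ) (M : ℕ) (hM : ∀ v, x v ≤ M) (l : List (V × V)) :
    idx x l ≤ (idxBound l).eval M := by
  induction l with
  | nil => simp [idx]
  | cons a l ih =>
    simp only [idx, idxBound, Polynomial.eval_add, Polynomial.eval_X, Polynomial.eval_mul]
    exact Nat.add_le_add (hM _) (Nat.mul_le_mul (hM _) ih)

namespace Frag

/-- Compute `idx x l` on the stack `p`. -/
def index : List (V × V) → Frag (Stk V J)
  | [] => stmt .halt
  | (d, b) :: l => seq (index l) (seq (whilePop .p (copy (.var b) .q .w))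
      (seq (copy (.var d) .q .w) (move .q .p)))

def indexCost : List (V × V) → Polynomial ℕ
  | [] => 1
  | a :: l => indexCost l + (idxBound l * (4 * Polynomial.X + 3) + 1) + (4 * Polynomial.X + 2) +
      (2 * idxBound (a :: l) + 1)

/-- Horner's scheme: the value for the tail is left on `p`, each of its marks is traded for a copy
of the base on `q`, the digit is added, and the result moves back to `p`. -/
theorem index_does {x : V → ℕ} {M : ℕ} (hM : ∀ v, x v ≤ M) {S : Stk V J → List Bool}
    (hx : ∀ v, S (.var v) = List.replicate (x v) true) (hp : S .p = []) (hq : S .q = [])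
    (hw : S .w = []) (l : List (V × V)) :
    (index l).Does S (Function.update S .p (List.replicate (idx x l) true))
      ((indexCost l).eval M) := by
  induction l with
  | nil =>
    intro v
    refine ⟨v, Steps.mono (stmt_runs (v' := v) ?_) ?_⟩
    · have : Function.update S .p [] = S := by rw [← hp, Function.update_eq_self]
      simp [idx, this]
    · simp [indexCost]
  | cons a l ih =>
    obtain ⟨d, b⟩ := a
    have hI := idx_le x M hM l
    have hI' := idx_le x M hM ((d, b) :: l)
    -- Loop invariant: with `i` marks left on `p`, the other `idx x l - i` rounds have each added `x
    -- b` to `q`.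
    let Q : ℕ → Stk V J → List Bool := fun i =>
      Function.update (Function.update S .p (List.replicate i true)) .q
        (List.replicate ((idx x l - i) * x b) true)
    have h1 := whilePop_does (k := Stk.p) (F := copy (.var b) .q .w) (t := M * 4 + 2) Q
      (by simp [Q]) (idx x l) (by
        intro i hi
        refine Does.mono (copy_does (by simp) (by simp) (by simp) ?_ ?_ ?_) ?_ _
        · simp [Q, hw]
        · simp only [Q, Function.update_self, ne_eq, reduceCtorEq, not_false_eq_true,
            Function.update_of_ne, hx, List.replicate_append_replicate]
          congr 1
          obtain ⟨c, hc⟩ : ∃ c, idx x l = i + 1 + c := ⟨idx x l - (i + 1), by omega⟩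
          rw [hc, show i + 1 + c - i = c + 1 by omega, show i + 1 + c - (i + 1) = c by omega]
          ring
        · intro k hk
          by_cases h : k = .p <;> simp [Q, hk, h]
        · simp only [Q, ne_eq, reduceCtorEq, not_false_eq_true, Function.update_of_ne, hx,
            List.length_replicate]
          have := hM b
          omega)
    have e1 : Q (idx x l) = Function.update S .p (List.replicate (idx x l) true) := by
      simp only [Q, Nat.sub_self, Nat.zero_mul, List.replicate_zero]
      rw [Function.update_eq_self_iff]
      simp [hq]
    rw [e1] at h1
    have e2 : Q 0 = Function.update S .q (List.replicate (idx x l * x b) true) := by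
      simp only [Q, Nat.sub_zero, List.replicate_zero, ← hp, Function.update_eq_self]
    rw [e2] at h1
    have h2 := copy_does (K := Stk V J) (a := .var d) (b := .q) (w := .w) (by simp) (by simp)
      (by simp) (S := Function.update S .q (List.replicate (idx x l * x b) true))
      (S' := Function.update S .q (List.replicate (idx x ((d, b) :: l)) true)) (by simp [hw])
      (by simp [hx, idx, Nat.mul_comm]) (by intro k hk; simp [hk])
    have h3 := move_does' (K := Stk V J) (a := .q) (b := .p) (by simp)
      (S := Function.update S .q (List.replicate (idx x ((d, b) :: l)) true))
      (S' := Function.update S .p (List.replicate (idx x ((d, b) :: l)) true)) (by simp [hq])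
      (by simp [hp]) (by intro k h h'; simp [h, h'])
    refine Does.mono (seq_does ih (seq_does h1 (seq_does h2 h3))) ?_
    have hd := hM d
    simp only [indexCost, Polynomial.eval_add, Polynomial.eval_mul, Polynomial.eval_X,
      Polynomial.eval_one, Polynomial.eval_ofNat, Function.update_self, List.length_replicate,
      ne_eq, reduceCtorEq, not_false_eq_true, Function.update_of_ne, hx]
    have := Nat.mul_le_mul_right (M * 4 + 2 + 1) hI
    have e : 4 * M + 3 = M * 4 + 2 + 1 := by ring
    rw [e]
    omega

end Frag

variable {V J : Type}

section

variable (x : V → ℕ) (T : J → List Bool) (e r : List Bool)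

@[simp] theorem store_var (v : V) : store x T e r (.var v) = List.replicate (x v) true := rfl
@[simp] theorem store_tab (j : J) : store x T e r (.tab j) = T j := rfl
@[simp] theorem store_p : store x T e r .p = [] := rfl
@[simp] theorem store_q : store x T e r .q = [] := rfl
@[simp] theorem store_w : store x T e r .w = [] := rfl
@[simp] theorem store_tmp : store x T e r .tmp = [] := rfl
@[simp] theorem store_ev : store x T e r .ev = e := rfl
@[simp] theorem store_inp : store x T e r .inp = r := rfl

end

section

variable (x : V → ℕ) (T : J → List Bool) (e r : List Bool)

theorem update_store_var [DecidableEq V] (v : V) (i : ℕ) :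
    Function.update (store x T e r) (.var v) (List.replicate i true) =
      store (Function.update x v i) T e r := by
  funext k
  cases k with
  | var v' =>
    by_cases h : v' = v
    · subst h; simp
    · simp [h]
  | _ => simp

theorem update_store_tab [DecidableEq J] (j : J) (l : List Bool) :
    Function.update (store x T e r) (.tab j) l = store x (Function.update T j l) e r := by
  funext k
  cases k with
  | tab j' =>
    by_cases h : j' = j
    · subst h; simp
    · simp [h]
  | _ => simp

theorem update_store_ev (l : List Bool) :
    Function.update (store x T e r) .ev l = store x T l r := by
  funext k
  cases k <;> simp

theorem update_store_inp (l : List Bool) :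
    Function.update (store x T e r) .inp l = store x T e l := by
  funext k
  cases k <;> simp

end

namespace Frag

/-- Run `F` for all values of the counter `v` below the counter `b`, in descending order. -/
def forDown (v b : V) (F : Frag (Stk V J)) : Frag (Stk V J) :=
  seq (copy (.var b) (.var v) .w) (whilePop (.var v) F)

def forCost (c : Polynomial ℕ) : Polynomial ℕ := Polynomial.X * (c + 1) + 1 + (4 * Polynomial.X + 2)

/-- `T i` and `e i` describe the state once all values `≥ i` are processed, hence the start at `x b`
and the end at `0`. The mark is popped before the body runs, so the body sees the value `i` while it
leads from state `i + 1` to state `i`. -/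
theorem forDown_does [DecidableEq V] {v b : V} (hbv : b ≠ v) {F : Frag (Stk V J)} {M : ℕ}
    {x : V → ℕ} (hM : x b ≤ M) (hv : x v = 0) {c : Polynomial ℕ} (T : ℕ → J → List Bool)
    (e : ℕ → List Bool) (r : List Bool)
    (hF : ∀ i < x b, F.Does (store (Function.update x v i) (T (i + 1)) (e (i + 1)) r)
      (store (Function.update x v i) (T i) (e i) r) (c.eval M)) :
    (forDown v b F).Does (store x (T (x b)) (e (x b)) r) (store x (T 0) (e 0) r)
      ((forCost c).eval M) := by
  have h1 := copy_does (K := Stk V J) (a := .var b) (b := .var v) (w := .w) (by simpa using hbv)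
    (by simp) (by simp) (S := store x (T (x b)) (e (x b)) r)
    (S' := store (Function.update x v (x b)) (T (x b)) (e (x b)) r) (by simp) (by simp [hv])
    (by
      intro k hk
      rw [← update_store_var, Function.update_of_ne hk])
  have h2 := whilePop_does (k := Stk.var v) (F := F) (t := c.eval M)
    (fun i => store (Function.update x v i) (T i) (e i) r) (by simp) (x b) (by
      intro i hi
      rw [update_store_var, Function.update_idem]
      exact hF i hi _)
  have e0 : Function.update x v 0 = x := by rw [← hv, Function.update_eq_self]
  simp only [e0] at h2
  refine Does.mono (seq_does h1 h2) ?_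
  simp only [forCost, Polynomial.eval_add, Polynomial.eval_mul, Polynomial.eval_X,
      Polynomial.eval_one, Polynomial.eval_ofNat, store_var, List.length_replicate]
  have := Nat.mul_le_mul_right (c.eval M + 1) hM
  omega

end Frag

/-- Formulas with bounded quantifiers over counters and tables. -/
inductive Fm (V J : Type) : Type
  | const (b : Bool)
  | look (j : J) (l : List (V × V))
  | eq (v : V) (l : List (V × V))
  | and (φ ψ : Fm V J)
  | or (φ ψ : Fm V J)
  | ex (v b : V) (φ : Fm V J)

namespace Fm

def Holds [DecidableEq V] (T : J → List Bool) : (V → ℕ) → Fm V J → Prop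
  | _, const b => b = true
  | x, look j l => (T j)[idx x l]? = some true
  | x, eq v l => x v = idx x l
  | x, and φ ψ => φ.Holds T x ∧ ψ.Holds T x
  | x, or φ ψ => φ.Holds T x ∨ ψ.Holds T x
  | x, ex v b φ => ∃ i < x b, φ.Holds T (Function.update x v i)

/-- The bound variables of `φ` are zero and differ from their bounds. -/
def Fresh [DecidableEq V] : (V → ℕ) → Fm V J → Prop
  | _, const _ => True
  | _, look _ _ => True
  | _, eq _ _ => True
  | x, and φ ψ => φ.Fresh x ∧ ψ.Fresh x
  | x, or φ ψ => φ.Fresh x ∧ ψ.Fresh x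
  | x, ex v b φ => b ≠ v ∧ x v = 0 ∧ ∀ i < x b, φ.Fresh (Function.update x v i)

/-- The table `j` does not occur in `φ`. -/
def Avoids (j : J) : Fm V J → Prop
  | const _ => True
  | look j' _ => j' ≠ j
  | eq _ _ => True
  | and φ ψ => φ.Avoids j ∧ ψ.Avoids j
  | or φ ψ => φ.Avoids j ∧ ψ.Avoids j
  | ex _ _ φ => φ.Avoids j

/-- This allows a table to grow while the formula that defines its entries is still being evaluated.
-/
theorem Avoids.holds_update [DecidableEq V] [DecidableEq J] {j : J} {φ : Fm V J} (h : φ.Avoids j)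
    (T : J → List Bool) (l : List Bool) (x : V → ℕ) :
    φ.Holds (Function.update T j l) x ↔ φ.Holds T x := by
  induction φ generalizing x with
  | const | eq => rfl
  | look j' => simp only [Holds, Function.update_of_ne h]
  | and φ ψ ih₁ ih₂ => simp only [Holds, ih₁ h.1, ih₂ h.2]
  | or φ ψ ih₁ ih₂ => simp only [Holds, ih₁ h.1, ih₂ h.2]
  | ex v b φ ih => simp only [Holds, ih h]

end Fm

namespace Frag

/-- Look up the bit of the table `j` at position `idx x l`. -/
def lookup (j : J) (l : List (V × V)) : Frag (Stk V J) :=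
  seq (index l) (seq
    (whilePop .p (stmt (.pop (.tab j) (fun _ o => o) (.branch Option.isSome
      (.push .tmp (fun o => o.getD false) .halt) .halt))))
    (seq (stmt (.peek (.tab j) (fun _ o => o) (.push .ev (fun o => o.getD false) .halt)))
      (move .tmp (.tab j))))

def lookupCost (l : List (V × V)) : Polynomial ℕ :=
  indexCost l + (2 * idxBound l + 1) + 1 + (2 * idxBound l + 1)

/-- As many bits as `p` has marks are shifted from the table to `tmp`; the bit then on top is the
wanted one, and moving `tmp` back restores the table. -/
theorem lookup_does {x : V → ℕ} {M : ℕ} (hM : ∀ v, x v ≤ M) (T : J → List Bool)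
    (e r : List Bool) (j : J) (l : List (V × V)) :
    (lookup j l).Does (store x T e r)
      (store x T (decide ((T j)[idx x l]? = some true) :: e) r) ((lookupCost l).eval M) := by
  classical
  have h1 := index_does hM (S := store x T e r) (by simp) (by simp) (by simp) (by simp) l
  have hI := idx_le x M hM l
  generalize idx x l = I at *
  -- `i` marks remain on `p`, and the first `i'` bits of the table lie reversed on `tmp`.
  let Q : List Bool → ℕ → ℕ → Stk V J → List Bool := fun e i i' =>
    Function.update (Function.update (Function.update (store x T e r)
      .p (List.replicate i true)) (.tab j) ((T j).drop i')) .tmp ((T j).take i').reverse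
  have h2 := whilePop_does (k := Stk.p) (F := (stmt (.pop (.tab j) (fun _ o => o)
      (.branch Option.isSome (.push .tmp (fun o => o.getD false) .halt) .halt)) :
        Frag (Stk V J))) (t := 1)
    (fun i => Q e i (I - i)) (by simp [Q]) I (by
      intro i hi
      obtain ⟨c, hc⟩ : ∃ c, I = i + 1 + c := ⟨I - (i + 1), by omega⟩
      have e1 : I - i = c + 1 := by omega
      have e2 : I - (i + 1) = c := by omega
      simp only [e1, e2]
      rcases hd : (T j)[c]? with _ | b
      -- The table is exhausted: nothing is popped, so nothing may be pushed to `tmp`.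
      · have hlen : (T j).length ≤ c := by simpa using hd
        refine ⟨none, stmt_runs ?_⟩
        simp [Q, List.drop_eq_nil_of_le hlen]
        funext k
        cases k with
        | tab j' =>
          by_cases h : j' = j
          · subst h; simp; omega
          · simp [h]
        | tmp => simp [List.take_of_length_le hlen, List.take_of_length_le (Nat.le_succ_of_le hlen)]
        | _ => simp
      · have hlen : c < (T j).length := (List.getElem?_eq_some_iff.1 hd).1
        have hdrop : (T j).drop c = b :: (T j).drop (c + 1) := by
          rw [List.drop_eq_getElem_cons hlen, (List.getElem?_eq_some_iff.1 hd).2]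
        refine ⟨some b, stmt_runs ?_⟩
        simp [Q, hdrop]
        funext k
        cases k with
        | tab j' =>
          by_cases h : j' = j
          · subst h; simp
          · simp [h]
        | tmp => simp [List.take_add_one, hd]
        | _ => simp)
  have eQ : Q e I (I - I) = Function.update (store x T e r) .p (List.replicate I true) := by
    funext k
    cases k with
    | tab j' =>
      by_cases h : j' = j
      · subst h; simp [Q]
      · simp [Q, h]
    | _ => simp [Q]
  rw [eQ, Nat.sub_zero] at h2
  have h3 : (stmt (.peek (.tab j) (fun _ o => o) (.push .ev (fun o => o.getD false) .halt)) :
      Frag (Stk V J)).Does (Q e 0 I) (Q (decide ((T j)[I]? = some true) :: e) 0 I) 1 := by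
    refine fun v => ⟨(T j)[I]?, stmt_runs ?_⟩
    simp [Q, List.head?_drop]
    funext k
    cases k with
    | tab j' =>
      by_cases h : j' = j
      · subst h; simp
      · simp [h]
    | ev =>
      rcases (T j)[I]? with _ | b
      · simp
      · cases b <;> simp
    | _ => simp
  have h4 := move_does' (K := Stk V J) (a := .tmp) (b := .tab j) (by simp)
    (S := Q (decide ((T j)[I]? = some true) :: e) 0 I)
    (S' := store x T (decide ((T j)[I]? = some true) :: e) r) (by simp) (by simp [Q])
    (by
      intro k hk hk'
      cases k <;> simp_all [Q])
  refine Does.mono (seq_does h1 (seq_does h2 (seq_does h3 h4))) ?_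
  simp [lookupCost, Q]
  omega

/-- Test whether the counter `v` has the value `idx x l`. -/
def test (v : V) (l : List (V × V)) : Frag (Stk V J) :=
  seq (index l) (seq (copy (.var v) .q .w)
    (seq (whilePop .p (stmt (.pop .q (fun _ o => o)
      (.branch Option.isSome .halt (.push .tmp (fun _ => true) .halt)))))
    (seq (stmt (.peek .q (fun _ o => o) (.branch Option.isSome
      (.push .ev (fun _ => false) .halt)
      (.peek .tmp (fun _ o => o) (.push .ev (fun o => !o.isSome) .halt)))))
    (seq (clear .q) (clear .tmp)))))

def testCost (l : List (V × V)) : Polynomial ℕ :=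
  indexCost l + (4 * Polynomial.X + 2) + (2 * idxBound l + 1) + 1 + (2 * Polynomial.X + 1) +
    (2 * idxBound l + 1)

/-- The index on `p` is cancelled against a copy of the counter on `q`. In truncated subtraction, `n
- I` marks survive on `q` and `I - n` failed cancellations are recorded on `tmp`; the numbers are
equal iff both stacks are empty. -/
theorem test_does {x : V → ℕ} {M : ℕ} (hM : ∀ v, x v ≤ M) (T : J → List Bool)
    (e r : List Bool) (v : V) (l : List (V × V)) :
    (test v l).Does (store x T e r)
      (store x T (decide (x v = idx x l) :: e) r) ((testCost l).eval M) := by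
  have h1 := index_does hM (S := store x T e r) (by simp) (by simp) (by simp) (by simp) l
  have hI := idx_le x M hM l
  have hv := hM v
  generalize idx x l = I at *
  generalize hn : x v = n at *
  let Q : List Bool → ℕ → ℕ → ℕ → Stk V J → List Bool := fun e i a b =>
    Function.update (Function.update (Function.update (store x T e r)
      .p (List.replicate i true)) .q (List.replicate a true)) .tmp (List.replicate b true)
  have h2 := copy_does (K := Stk V J) (a := .var v) (b := .q) (w := .w) (by simp) (by simp)
      (by simp) (S := Function.update (store x T e r) .p (List.replicate I true))
      (S' := Q e I n 0) (by simp) (by simp [Q, hn])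
      (by
        intro k hk
        cases k <;> simp_all [Q])
  have h3 := whilePop_does (k := Stk.p) (F := (stmt (.pop .q (fun _ o => o)
      (.branch Option.isSome .halt (.push .tmp (fun _ => true) .halt))) :
        Frag (Stk V J))) (t := 1)
    (fun i => Q e i (n - (I - i)) ((I - i) - n)) (by simp [Q]) I (by
      intro i hi
      obtain ⟨c, hc⟩ : ∃ c, I = i + 1 + c := ⟨I - (i + 1), by omega⟩
      have e1 : I - i = c + 1 := by omega
      have e2 : I - (i + 1) = c := by omega
      simp only [e1, e2]
      by_cases h : c < n
      · obtain ⟨d, hd⟩ : ∃ d, n = c + 1 + d := ⟨n - (c + 1), by omega⟩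
        have e3 : n - c = d + 1 := by omega
        have e4 : n - (c + 1) = d := by omega
        have e5 : c - n = 0 := by omega
        have e6 : c + 1 - n = 0 := by omega
        refine ⟨some true, stmt_runs ?_⟩
        simp only [e3, e4, e5, e6]
        simp [Q, List.replicate_succ]
        funext k
        cases k <;> simp
      · have e3 : n - c = 0 := by omega
        have e4 : n - (c + 1) = 0 := by omega
        have e5 : c + 1 - n = c - n + 1 := by omega
        refine ⟨none, stmt_runs ?_⟩
        simp only [e3, e4, e5]
        simp [Q, List.replicate_succ]
        funext k
        cases k <;> simp)
  simp only [Nat.sub_self, Nat.sub_zero, Nat.zero_sub] at h3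
  have h4 : (stmt (.peek .q (fun _ o => o) (.branch Option.isSome
      (.push .ev (fun _ => false) .halt)
      (.peek .tmp (fun _ o => o) (.push .ev (fun o => !o.isSome) .halt)))) :
      Frag (Stk V J)).Does (Q e 0 (n - I) (I - n))
        (Q (decide (n = I) :: e) 0 (n - I) (I - n)) 1 := by
    intro v
    have hup : ∀ b, Function.update (Q e 0 (n - I) (I - n)) .ev (b :: e) =
        Q (b :: e) 0 (n - I) (I - n) := by
      intro b
      funext k
      cases k <;> simp [Q]
    rcases lt_trichotomy n I with h | h | h
    · obtain ⟨d, hd⟩ : ∃ d, I - n = d + 1 := ⟨I - n - 1, by omega⟩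
      refine ⟨some true, stmt_runs ?_⟩
      have : n - I = 0 := by omega
      have hne : n ≠ I := by omega
      rw [decide_eq_false hne, ← hup]
      simp [Q, hd, this, List.replicate_succ]
    · refine ⟨none, stmt_runs ?_⟩
      rw [decide_eq_true h, ← hup]
      subst h
      simp [Q]
    · obtain ⟨d, hd⟩ : ∃ d, n - I = d + 1 := ⟨n - I - 1, by omega⟩
      refine ⟨some true, stmt_runs ?_⟩
      have hne : n ≠ I := by omega
      rw [decide_eq_false hne, ← hup]
      simp [Q, hd, List.replicate_succ]
  have h5 := clear_does .q (Q (decide (n = I) :: e) 0 (n - I) (I - n))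
  have h6 := clear_does .tmp (Function.update (Q (decide (n = I) :: e) 0 (n - I) (I - n)) .q [])
  have eQ : Function.update (Function.update (Q (decide (n = I) :: e) 0 (n - I) (I - n)) .q [])
      .tmp [] = store x T (decide (n = I) :: e) r := by
    funext k
    cases k <;> simp [Q]
  rw [eQ] at h6
  refine Does.mono (seq_does h1 (seq_does h2 (seq_does h3 (seq_does h4 (seq_does h5 h6))))) ?_
  simp [testCost, Q, hn]
  omega

/-- Replace the two topmost truth values by their value under `f`. -/
def combine (f : Bool → Bool → Bool) : Frag (Stk V J) :=
  stmt (.pop .ev (fun _ o => o) (.pop .ev (fun a b => some (f (b.getD false) (a.getD false)))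
    (.push .ev (fun o => o.getD false) .halt)))

theorem combine_does (f : Bool → Bool → Bool) (x : V → ℕ) (T : J → List Bool) (a b : Bool)
    (e r : List Bool) :
    (combine f).Does (store x T (b :: a :: e) r) (store x T (f a b :: e) r) 1 := by
  refine fun v => ⟨some (f a b), stmt_runs ?_⟩
  simp
  funext k
  cases k <;> simp

def pushEv (b : Bool) : Frag (Stk V J) := stmt (.push .ev (fun _ => b) .halt)

theorem pushEv_does (b : Bool) (x : V → ℕ) (T : J → List Bool) (e r : List Bool) :
    (pushEv b).Does (store x T e r) (store x T (b :: e) r) 1 :=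
  fun v => ⟨v, stmt_runs (by simp [update_store_ev])⟩

end Frag

namespace Fm

/-- The fragment that evaluates a formula. -/
def frag : Fm V J → Frag (Stk V J)
  | const b => .pushEv b
  | look j l => .lookup j l
  | eq v l => .test v l
  | and φ ψ => .seq φ.frag (.seq ψ.frag (.combine (· && ·)))
  | or φ ψ => .seq φ.frag (.seq ψ.frag (.combine (· || ·)))
  | ex v b φ => .seq (.pushEv false) (.forDown v b (.seq φ.frag (.combine (· || ·))))

def cost : Fm V J → Polynomial ℕ
  | const _ => 1
  | look _ l => Frag.lookupCost l
  | eq _ l => Frag.testCost l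
  | and φ ψ => φ.cost + (ψ.cost + 1)
  | or φ ψ => φ.cost + (ψ.cost + 1)
  | ex _ _ φ => 1 + Frag.forCost (φ.cost + 1)

open scoped Classical in
-- `ev` works as an evaluation stack: each subformula leaves one bit above `e`, and connectives
-- replace the two topmost bits by one.
theorem frag_does [DecidableEq V] (φ : Fm V J) {x : V → ℕ} {M : ℕ} (hM : ∀ v, x v ≤ M)
    (T : J → List Bool) (e r : List Bool) (hx : φ.Fresh x) :
    φ.frag.Does (store x T e r) (store x T (decide (φ.Holds T x) :: e) r) (φ.cost.eval M) := by
  induction φ generalizing x e with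
  | const b =>
    refine (Frag.pushEv_does b x T e r).congr ?_ (by simp [cost])
    cases b <;> simp [Holds]
  | look j l => exact (Frag.lookup_does hM T e r j l).congr (by
      congr 2
      rw [Bool.eq_iff_iff]
      simp only [decide_eq_true_iff]
      simp [Holds]) le_rfl
  | eq v l => exact (Frag.test_does hM T e r v l).congr (by
      congr 2
      rw [Bool.eq_iff_iff]
      simp only [decide_eq_true_iff]
      simp [Holds]) le_rfl
  | and φ ψ ih₁ ih₂ =>
    exact (Frag.seq_does (ih₁ hM e hx.1) (Frag.seq_does (ih₂ hM _ hx.2)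
      (Frag.combine_does _ _ _ _ _ _ _))).congr (by
      congr 2
      rw [Bool.eq_iff_iff]
      simp only [decide_eq_true_iff, Bool.and_eq_true]
      simp [Holds]) (by simp [cost])
  | or φ ψ ih₁ ih₂ =>
    exact (Frag.seq_does (ih₁ hM e hx.1) (Frag.seq_does (ih₂ hM _ hx.2)
      (Frag.combine_does _ _ _ _ _ _ _))).congr (by
      congr 2
      rw [Bool.eq_iff_iff]
      simp only [decide_eq_true_iff, Bool.or_eq_true]
      simp [Holds]) (by simp [cost])
  | ex v b φ ih =>
    obtain ⟨hbv, hv, hφ⟩ := hx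
    have h2 := Frag.forDown_does (J := J) hbv (F := .seq φ.frag (.combine (· || ·))) (hM b) hv
      (c := φ.cost + 1) (fun _ => T)
      -- The bit on top of `e` is the disjunction over the values `i' ≥ i` visited so far. At `i = x
      -- b` it is `false`, at `i = 0` the quantifier is decided.
      (fun i => decide (∃ i' < x b, i ≤ i' ∧ φ.Holds T (Function.update x v i')) :: e) r (by
        intro i hi
        have hM' : ∀ v', Function.update x v i v' ≤ M := by
          intro v'
          by_cases h : v' = v
          · subst h
            simpa using (hi.trans_le (hM b)).le
          · simpa [h] using hM v'
        refine (Frag.seq_does (ih hM' _ (hφ i hi)) (Frag.combine_does _ _ _ _ _ _ _)).congr ?_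
          (by simp)
        congr 2
        rw [Bool.eq_iff_iff]
        simp only [decide_eq_true_eq, Bool.or_eq_true]
        constructor
        · rintro (⟨i', h1, h2, h3⟩ | h)
          · exact ⟨i', h1, by omega, h3⟩
          · exact ⟨i, hi, le_rfl, h⟩
        · rintro ⟨i', h1, h2, h3⟩
          rcases Nat.eq_or_lt_of_le h2 with rfl | h2
          · exact .inr h3
          · exact .inl ⟨i', h1, h2, h3⟩)
    have h1 := Frag.pushEv_does (V := V) (J := J) false x T e r
    have e0 : decide (∃ i' < x b, x b ≤ i' ∧ φ.Holds T (Function.update x v i')) = false := by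
      rw [decide_eq_false_iff_not]
      rintro ⟨i', h1, h2, -⟩
      omega
    rw [e0] at h2
    exact (Frag.seq_does h1 h2).congr (by
      congr 2
      rw [Bool.eq_iff_iff]
      simp only [decide_eq_true_iff]
      simp [Holds]) (by simp [cost])

end Fm

/-! ### Writing tables of formulas, and reading the input -/

variable {V J : Type}

theorem flatMap_range_mul {α : Type*} (g : ℕ → α) (a b : ℕ) :
    ((List.range a).flatMap fun i => (List.range b).map fun p => g (i * b + p)) =
      (List.range (a * b)).map g := by
  induction a with
  | zero => simp
  | succ a ih =>
    rw [List.range_succ, List.flatMap_append, ih, Nat.succ_mul, List.range_add, List.map_append]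
    simp [Function.comp_def]

/-- Nested loops set the last argument first and the others later; the result is the same assignment
as setting all of them at once. -/
theorem extend_snoc [DecidableEq V] {d : ℕ} {a : Fin (d + 1) → V} (ha : Function.Injective a)
    (y : Fin d → ℕ) (i : ℕ) (x : V → ℕ) :
    Function.extend (a ∘ Fin.castSucc) y (Function.update x (a (Fin.last d)) i) =
      Function.extend a (Fin.snoc y i : Fin (d + 1) → ℕ) x := by
  have ha' : Function.Injective (a ∘ Fin.castSucc) := ha.comp (Fin.castSucc_injective d)
  funext v
  by_cases h : ∃ k, a k = v
  · obtain ⟨k, rfl⟩ := h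
    rw [ha.extend_apply]
    refine Fin.lastCases ?_ (fun k => ?_) k
    · rw [Function.extend_apply', Function.update_self, Fin.snoc_last]
      rintro ⟨k, hk⟩
      exact (Fin.castSucc_lt_last k).ne (ha hk)
    · rw [Fin.snoc_castSucc]
      exact ha'.extend_apply _ _ k
  · rw [Function.extend_apply' _ _ _ h, Function.extend_apply', Function.update_of_ne]
    · rintro rfl
      exact h ⟨_, rfl⟩
    · rintro ⟨k, hk⟩
      exact h ⟨_, hk⟩

open scoped Classical in
/-- The table of the formula `φ` with arguments `a k` below `x b`, first argument least
significant. -/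
def tableOf [DecidableEq V] (T : J → List Bool) (x : V → ℕ) (b : V) {d : ℕ} (a : Fin d → V)
    (φ : Fm V J) : List Bool :=
  (List.range (x b ^ d)).map fun p =>
    decide (φ.Holds T (Function.extend a (fun i => p / x b ^ (i : ℕ) % x b) x))

theorem tableOf_update [DecidableEq V] [DecidableEq J] {j : J} {φ : Fm V J} (hj : φ.Avoids j)
    (T : J → List Bool) (l : List Bool) (x : V → ℕ) (b : V) {d : ℕ} (a : Fin d → V) :
    tableOf (Function.update T j l) x b a φ = tableOf T x b a φ :=
  List.map_congr_left fun _ _ => decide_eq_decide.2 (hj.holds_update _ _ _)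

/-- The last argument is the most significant digit of the position, so fixing it to `i` selects the
`i`-th block of length `x b ^ d`. -/
theorem tableOf_succ [DecidableEq V] (T : J → List Bool) (x : V → ℕ) (b : V) {d : ℕ}
    {a : Fin (d + 1) → V} (ha : Function.Injective a) (hb : ∀ i, a i ≠ b) (φ : Fm V J) :
    tableOf T x b a φ = (List.range (x b)).flatMap fun i =>
      tableOf T (Function.update x (a (Fin.last d)) i) b (a ∘ Fin.castSucc) φ := by
  classical
  simp only [tableOf]
  rw [Nat.pow_succ', ← flatMap_range_mul]
  refine List.flatMap_congr fun i hi => ?_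
  rw [Function.update_of_ne (hb _).symm]
  refine List.map_congr_left fun p hp => ?_
  rw [List.mem_range] at hi hp
  rw [extend_snoc ha]
  congr 3
  funext k
  refine Fin.lastCases ?_ (fun k => ?_) k
  · rw [Fin.snoc_last, Fin.val_last, Nat.mul_comm, Nat.mul_add_div (by omega),
      Nat.div_eq_of_lt hp, Nat.add_zero, Nat.mod_eq_of_lt hi]
  · rw [Fin.snoc_castSucc, Fin.val_castSucc]
    obtain ⟨c, hc⟩ : ∃ c, d = k + (c + 1) := ⟨d - (k + 1), by omega⟩
    have hpos : 0 < x b ^ (k : ℕ) := Nat.pow_pos (by omega)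
    -- For `k < d` the leading digit contributes a multiple of `x b ^ (k + 1)`, which does not
    -- affect digit `k`.
    have : i * x b ^ d + p = x b ^ (k : ℕ) * (x b * (i * x b ^ c)) + p := by
      conv_lhs => rw [hc, Nat.pow_add, Nat.pow_succ]
      ring
    rw [this, Nat.mul_add_div hpos, Nat.mul_add_mod]

namespace Frag

/-- Put the table of `φ` onto the stack `tab j`. -/
def tabulate (j : J) (b : V) : (d : ℕ) → (Fin d → V) → Fm V J → Frag (Stk V J)
  | 0, _, φ => seq φ.frag (stmt (.pop .ev (fun _ o => o) (.push (.tab j) (fun o => o.getD false)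
      .halt)))
  | d + 1, a, φ => forDown (a (Fin.last d)) b (tabulate j b d (a ∘ Fin.castSucc) φ)

def tabulateCost (φ : Fm V J) : ℕ → Polynomial ℕ
  | 0 => φ.cost + 1
  | d + 1 => forCost (tabulateCost φ d)

/-- Entries are pushed on top of what is there, and the loops run downwards, so the finished table
reads upwards. -/
theorem tabulate_does [DecidableEq V] [DecidableEq J] {M : ℕ} (T : J → List Bool)
    (e r : List Bool) {j : J} {b : V} {φ : Fm V J} (hj : φ.Avoids j) {d : ℕ} {a : Fin d → V}
    (ha : Function.Injective a) (hb : ∀ i, a i ≠ b) {x : V → ℕ} (hM : ∀ v, x v ≤ M)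
    (hx : ∀ i, x (a i) = 0)
    (hφ : ∀ y : Fin d → ℕ, (∀ i, y i < x b) → φ.Fresh (Function.extend a y x)) :
    (tabulate j b d a φ).Does (store x T e r)
      (store x (Function.update T j (tableOf T x b a φ ++ T j)) e r)
      ((tabulateCost φ d).eval M) := by
  classical
  induction d generalizing x T with
  | zero =>
    have hext : ∀ y : Fin 0 → ℕ, Function.extend a y x = x := fun y => by
      funext v
      exact Function.extend_apply' _ _ _ (by rintro ⟨k, -⟩; exact k.elim0)
    have h := φ.frag_does hM T e r (by simpa [hext] using hφ Fin.elim0 (fun i => i.elim0))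
    refine Does.congr (seq_does h (fun v => ⟨some (decide (φ.Holds T x)), stmt_runs rfl⟩)) ?_
      (by simp [tabulateCost])
    simp [tableOf, hext, update_store_ev, update_store_tab]
  | succ d ih =>
    -- The blocks with index `≥ i` are already on the stack.
    let T' : ℕ → J → List Bool := fun i => Function.update T j
      ((((List.range (x b)).drop i).flatMap fun i =>
        tableOf T (Function.update x (a (Fin.last d)) i) b (a ∘ Fin.castSucc) φ) ++ T j)
    have h := forDown_does (v := a (Fin.last d)) (b := b) (hb _).symm
      (F := tabulate j b d (a ∘ Fin.castSucc) φ) (hM b) (hx _) (c := tabulateCost φ d) T'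
      (fun _ => e) r (by
        intro i hi
        have hb' : Function.update x (a (Fin.last d)) i b = x b :=
          Function.update_of_ne (hb _).symm _ _
        have h1 := ih (T' (i + 1)) (ha.comp (Fin.castSucc_injective d)) (fun k => hb k.castSucc)
          (x := Function.update x (a (Fin.last d)) i) (by
            intro v
            by_cases h : v = a (Fin.last d)
            · subst h
              simpa using (hi.trans_le (hM b)).le
            · simpa [h] using hM v)
          (by
            intro k
            rw [Function.comp_apply, Function.update_of_ne, hx]
            exact fun h => (Fin.castSucc_lt_last k).ne (ha h))
          (by
            intro y hy
            rw [hb'] at hy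
            rw [extend_snoc ha]
            refine hφ _ (Fin.lastCases ?_ fun k => ?_)
            · simpa using hi
            · simpa using hy k)
        refine h1.congr ?_ le_rfl
        congr 1
        have ht : tableOf (T' (i + 1)) (Function.update x (a (Fin.last d)) i) b
            (a ∘ Fin.castSucc) φ =
            tableOf T (Function.update x (a (Fin.last d)) i) b (a ∘ Fin.castSucc) φ := by
          exact tableOf_update hj _ _ _ _ _
        rw [ht]
        have hdrop : (List.range (x b)).drop i = i :: (List.range (x b)).drop (i + 1) := by
          rw [List.drop_eq_getElem_cons (by simpa using hi), List.getElem_range]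
        simp only [T', hdrop, Function.update_idem, Function.update_self, List.flatMap_cons,
          List.append_assoc])
    have e1 : T' (x b) = T := by simp [T', List.drop_eq_nil_of_le]
    rw [e1] at h
    refine h.congr ?_ le_rfl
    rw [tableOf_succ T x b ha hb]
    simp [T']

/-- Read a number in unary, terminated by `false`, from the input. -/
def readUnary (v : V) : Frag (Stk V J) where
  Λ := Unit
  fintype := inferInstance
  entry := ()
  code _ := .pop .inp (fun _ o => o) (.branch (fun o => o == some true)
    (.push (.var v) (fun _ => true) (.goto fun _ => ())) .halt)

theorem readUnary_does [DecidableEq V] {v : V} (x : V → ℕ) (hv : x v = 0) (T : J → List Bool)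
    (e r : List Bool) (n : ℕ) :
    (readUnary v).Does (store x T e (List.replicate n true ++ false :: r))
      (store (Function.update x v n) T e r) (n + 1) := by
  have key : ∀ (k : ℕ) (o : Option Bool) (i : ℕ), (readUnary v : Frag (Stk V J)).Runs o
      (store (Function.update x v i) T e (List.replicate k true ++ false :: r)) (some false)
      (store (Function.update x v (i + k)) T e r) (k + 1) := by
    intro k
    induction k with
    | zero =>
      intro o i
      refine .head ?_ (.refl _ _)
      simp [readUnary, update_store_inp]
    | succ k ih =>
      intro o i
      have h := ih (some true) (i + 1)
      rw [show i + 1 + k = i + (k + 1) by ring] at h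
      refine .head ?_ h
      rw [List.replicate_succ, List.cons_append]
      generalize List.replicate k true ++ false :: r = l
      have := update_store_var (Function.update x v i) T e l v (i + 1)
      rw [Function.update_idem, List.replicate_succ] at this
      simpa [readUnary, update_store_inp] using this
  intro o
  refine ⟨some false, ?_⟩
  have := key n o 0
  rwa [← hv, Function.update_eq_self, hv, Nat.zero_add] at this

/-- Read a table of size `idx x l` from the input. -/
def readTable (l : List (V × V)) (j : J) : Frag (Stk V J) :=
  seq (index l) (seq
    (whilePop .p (stmt (.pop .inp (fun _ o => o) (.push .tmp (fun o => o.getD false) .halt))))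
    (move .tmp (.tab j)))

def readTableCost (l : List (V × V)) : Polynomial ℕ := indexCost l + (4 * idxBound l + 2)

theorem readTable_does [DecidableEq J] {x : V → ℕ} {M : ℕ} (hM : ∀ v, x v ≤ M)
    (T : J → List Bool) (e r t : List Bool) (j : J) (hj : T j = []) (l : List (V × V))
    (hl : t.length = idx x l) :
    (readTable l j).Does (store x T e (t ++ r))
      (store x (Function.update T j t) e r) ((readTableCost l).eval M) := by
  have h1 := index_does hM (S := store x T e (t ++ r)) (by simp) (by simp) (by simp) (by simp) l
  have hI := idx_le x M hM l
  rw [← hl] at h1 hI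
  let Q : ℕ → Stk V J → List Bool := fun i =>
    Function.update (Function.update (store x T e (t.drop (t.length - i) ++ r))
      .p (List.replicate i true)) .tmp (t.take (t.length - i)).reverse
  have h2 := whilePop_does (k := Stk.p) (F := (stmt (.pop .inp (fun _ o => o)
      (.push .tmp (fun o => o.getD false) .halt)) : Frag (Stk V J))) (t := 1)
    Q (by simp [Q]) t.length (by
      intro i hi
      obtain ⟨c, hc⟩ : ∃ c, t.length = i + 1 + c := ⟨t.length - (i + 1), by omega⟩
      have e1 : t.length - i = c + 1 := by omega
      have e2 : t.length - (i + 1) = c := by omega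
      have hlen : c < t.length := by omega
      obtain ⟨b, hdrop, hb⟩ : ∃ b, t.drop c = b :: t.drop (c + 1) ∧ t[c]? = some b :=
        ⟨t[c], List.drop_eq_getElem_cons hlen, List.getElem?_eq_getElem hlen⟩
      simp only [Q, e1, e2]
      refine ⟨some b, stmt_runs ?_⟩
      simp [hdrop]
      funext k
      cases k with
      | tmp => simp [List.take_add_one, hb]
      | _ => simp)
  have eQ : Q t.length = Function.update (store x T e (t ++ r)) .p
      (List.replicate t.length true) := by
    funext k
    cases k <;> simp [Q]
  rw [eQ] at h2
  have h3 := move_does' (K := Stk V J) (a := .tmp) (b := .tab j) (by simp)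
    (S := Q 0) (S' := store x (Function.update T j t) e r) (by simp) (by simp [Q, hj])
    (by
      intro k hk hk'
      cases k <;> simp_all [Q])
  refine Does.mono (seq_does h1 (seq_does h2 h3)) ?_
  simp [readTableCost, Q]
  omega

/-- Set the counter `v` to `idx x l`. -/
def setIndex (v : V) (l : List (V × V)) : Frag (Stk V J) := seq (index l) (move .p (.var v))

def setIndexCost (l : List (V × V)) : Polynomial ℕ := indexCost l + (2 * idxBound l + 1)

theorem setIndex_does [DecidableEq V] {x : V → ℕ} {M : ℕ} (hM : ∀ v, x v ≤ M)
    (T : J → List Bool) (e r : List Bool) (v : V) (hv : x v = 0) (l : List (V × V)) :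
    (setIndex v l).Does (store x T e r) (store (Function.update x v (idx x l)) T e r)
      ((setIndexCost l).eval M) := by
  have h1 := index_does hM (S := store x T e r) (by simp) (by simp) (by simp) (by simp) l
  have hI := idx_le x M hM l
  have h2 := move_does' (K := Stk V J) (a := .p) (b := .var v) (by simp)
    (S := Function.update (store x T e r) .p (List.replicate (idx x l) true))
    (S' := store (Function.update x v (idx x l)) T e r) (by simp) (by simp [hv])
    (by
      intro k hk hk'
      rw [← update_store_var, Function.update_of_ne hk', Function.update_of_ne hk])
  refine Does.mono (seq_does h1 h2) ?_
  simp [setIndexCost]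
  omega

/-- Add `c` to the counter `v`. -/
def addConst (v : V) : ℕ → Frag (Stk V J)
  | 0 => stmt .halt
  | c + 1 => seq (stmt (.push (.var v) (fun _ => true) .halt)) (addConst v c)

theorem addConst_does [DecidableEq V] (x : V → ℕ) (T : J → List Bool) (e r : List Bool) (v : V)
    (c : ℕ) : (addConst v c).Does (store x T e r) (store (Function.update x v (x v + c)) T e r)
      (c + 1) := by
  induction c generalizing x with
  | zero =>
    refine fun o => ⟨o, (stmt_runs rfl).congr_right ?_⟩
    simp
  | succ c ih =>
    have h1 : (stmt (.push (.var v) (fun _ => true) .halt) : Frag (Stk V J)).Does (store x T e r)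
        (store (Function.update x v (x v + 1)) T e r) 1 := by
      refine fun o => ⟨o, stmt_runs ?_⟩
      rw [← update_store_var]
      simp [List.replicate_succ]
    refine (seq_does h1 (ih _)).congr ?_ (by omega)
    simp [Nat.add_assoc, Nat.add_comm 1 c]

/-- Empty the stacks in a list. -/
def clearAll {K : Type} [DecidableEq K] : List K → Frag K
  | [] => stmt .halt
  | k :: ks => seq (clear k) (clearAll ks)

theorem clearAll_does {K : Type} [DecidableEq K] (ks : List K) {B : ℕ} (S : K → List Bool)
    (hB : ∀ k ∈ ks, (S k).length ≤ B) :
    (clearAll ks).Does S (fun k => if k ∈ ks then [] else S k) (ks.length * (2 * B + 1) + 1) := by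
  induction ks generalizing S with
  | nil =>
    have : (fun k => if k ∈ ([] : List K) then [] else S k) = S := by simp
    rw [this]
    exact fun v => ⟨v, Steps.mono (stmt_runs rfl) (by simp)⟩
  | cons a ks ih =>
    refine (seq_does (clear_does a S) (ih (Function.update S a []) ?_)).congr ?_ ?_
    · intro k hk
      by_cases h : k = a <;> simp [h, hB k (List.mem_cons_of_mem a hk)]
    · funext k
      by_cases h : k = a <;> simp [h]
    · have := hB a (by simp)
      simp only [List.length_cons, Nat.succ_mul]
      omega

end Frag

/-! ### From fragments to Turing machines -/

open scoped Classical in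
/-- A fragment that leaves nothing but the output is a machine. -/
theorem isPolyTime_of_frag [Finite V] [Finite J] {P Q : PromiseProblem} {f : P.Inst → Q.Inst}
    (F : Frag (Stk V J)) (j : J) (time : Polynomial ℕ)
    (h : ∀ a, F.Does (store (fun _ => 0) (fun _ => []) [] (P.encode a))
      (Function.update (fun _ => []) (.tab j) (Q.encode (f a)))
      (time.eval (P.encode a).length)) : IsPolyTime P Q f := by
  -- The final configuration must have the initial internal state, hence the added reset to `none`.
  let G : Frag (Stk V J) := F.seq (.stmt (.load (fun _ => none) .halt))
  have : Fintype (Stk V J) := Fintype.ofFinite _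
  have : Fintype G.Λ := G.fintype
  let tm : FinTM2 :=
    { K := Stk V J
      k₀ := .inp
      k₁ := .tab j
      Γ := fun _ => Bool
      Λ := G.Λ
      main := G.entry
      σ := Option Bool
      initialState := none
      Γk₀Fin := inferInstanceAs (Fintype Bool)
      m := G.code }
  refine ⟨{
    tm := tm
    inputAlphabet := Equiv.refl Bool
    outputAlphabet := Equiv.refl Bool
    time := time + 1
    outputsFun := fun a => ?_ }⟩
  have hinit : initList tm (List.map (Equiv.refl Bool).invFun (P.encode a)) =
      (⟨some G.entry, none, store (fun _ => 0) (fun _ => []) [] (P.encode a)⟩ :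
        BitCfg (Stk V J) G.Λ) := by
    have : (List.map (Equiv.refl Bool).invFun (P.encode a)) = P.encode a := List.map_id _
    rw [this]
    unfold initList
    congr 1
    funext k
    cases k <;> simp [tm]
  have hhalt : haltList tm (List.map (Equiv.refl Bool).invFun (Q.encode (f a))) =
      (⟨none, none, Function.update (fun _ => []) (.tab j) (Q.encode (f a))⟩ :
        BitCfg (Stk V J) G.Λ) := by
    have : (List.map (Equiv.refl Bool).invFun (Q.encode (f a))) = Q.encode (f a) := List.map_id _
    rw [this]
    unfold haltList
    congr 1
    funext k
    by_cases hk : k = .tab j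
    · subst hk
      simp [tm]
    · simp [tm, hk]
  have hG : ∃ k ≤ time.eval (P.encode a).length + 1, (flip bind (TM2.step G.code))^[k]
      (some ⟨some G.entry, none, store (fun _ => 0) (fun _ => []) [] (P.encode a)⟩) =
      some ⟨none, none, Function.update (fun _ => []) (.tab j) (Q.encode (f a))⟩ := by
    obtain ⟨v', hv⟩ := h a none
    exact (Frag.seq_runs hv (Frag.stmt_runs (v' := none) rfl)).exists_iterate
  refine ⟨⟨hG.choose, ?_⟩, by simpa using hG.choose_spec.1⟩
  have e := hG.choose_spec.2
  rw [hinit, Option.map_some, hhalt]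
  exact e

/-! ### Programs that read and write structures -/

/-- The counters: the size of the input, constants, the size of the output, three auxiliary ones,
and further ones indexed by `A`. -/
inductive Ctr (A : Type) : Type
  | n
  | zero
  | one
  | size
  | ex₁
  | ex₂
  | piv
  | arr (a : A)

instance (A : Type) : DecidableEq (Ctr A) := Classical.decEq _

instance (A : Type) [Finite A] : Finite (Ctr A) := by
  let g : A ⊕ Fin 7 → Ctr A
    | Sum.inl a => .arr a
    | Sum.inr i => ![.n, .zero, .one, .size, .ex₁, .ex₂, .piv] i
  refine Finite.of_surjective g ?_
  rintro (_ | _ | _ | _ | _ | _ | _ | a)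
  · exact ⟨Sum.inr 0, rfl⟩
  · exact ⟨Sum.inr 1, rfl⟩
  · exact ⟨Sum.inr 2, rfl⟩
  · exact ⟨Sum.inr 3, rfl⟩
  · exact ⟨Sum.inr 4, rfl⟩
  · exact ⟨Sum.inr 5, rfl⟩
  · exact ⟨Sum.inr 6, rfl⟩
  · exact ⟨Sum.inl a, rfl⟩

/-- The counters after reading the input. -/
def Ctr.init {A : Type} (n : ℕ) : Ctr A → ℕ
  | .n => n
  | .one => 1
  | _ => 0

/-- The relation symbols of `L`. -/
abbrev Sym (L : FirstOrder.Language.{0, 0}) : Type := Σ ℓ, L.Relations ℓ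

instance (L : FirstOrder.Language.{0, 0}) : DecidableEq (Sym L) := Classical.decEq _

instance (L : FirstOrder.Language.{0, 0}) [hL : FiniteSignature L] : Finite (Sym L) :=
  hL.finite_relations

/-- The digit `1` preceded by `ℓ` zeros: in this way the index routine also computes the size of the
table of an `ℓ`-ary relation. -/
theorem idx_replicate {V : Type} (x : V → ℕ) (z o b : V) (hz : x z = 0) (ho : x o = 1) (ℓ : ℕ) :
    idx x (List.replicate ℓ (z, b) ++ [(o, b)]) = x b ^ ℓ := by
  induction ℓ with
  | zero => simp [idx, ho]
  | succ ℓ ih => simp [List.replicate_succ, idx, hz, ih, Nat.pow_succ']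

theorem idx_ofFn {V : Type} (x : V → ℕ) (b : V) {ℓ : ℕ} (a : Fin ℓ → V) :
    idx x (List.ofFn fun k => (a k, b)) = ∑ k, x (a k) * x b ^ (k : ℕ) := by
  induction ℓ with
  | zero => simp [idx]
  | succ ℓ ih =>
    rw [List.ofFn_succ, idx, ih fun k => a k.succ, Fin.sum_univ_succ, Finset.mul_sum]
    simp only [Fin.val_zero, pow_zero, mul_one, Fin.val_succ, pow_succ]
    congr 1
    exact Finset.sum_congr rfl fun k _ => by ring

namespace FinInstance

variable {L : FirstOrder.Language.{0, 0}}

open scoped Classical in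
/-- The table of a relation. -/
def bits (X : FinInstance L) (s : Sym L) : List Bool :=
  List.ofFn fun p : Fin (X.size ^ s.1) => decide (X.str.RelMap s.2 (finFunctionFinEquiv.symm p))

theorem encode_eq [FiniteSignature L] (X : FinInstance L) :
    X.encode = List.replicate X.size true ++ false :: (symbolList L).flatMap X.bits := rfl

theorem length_bits (X : FinInstance L) (s : Sym L) : (X.bits s).length = X.size ^ s.1 := by
  simp [bits]

/-- Both `idx` and the encoding take the first argument as the least significant digit, so a `look`
formula evaluates an atomic formula of the input. -/
theorem getElem?_bits {V : Type} (X : FinInstance L) {ℓ : ℕ} (R : L.Relations ℓ) {x : V → ℕ}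
    {b : V} (hb : x b = X.size) {a : Fin ℓ → V} (y : Fin ℓ → Fin X.size)
    (hy : ∀ k, x (a k) = y k) :
    (X.bits ⟨ℓ, R⟩)[idx x (List.ofFn fun k => (a k, b))]? = some true ↔ X.str.RelMap R y := by
  have : idx x (List.ofFn fun k => (a k, b)) = finFunctionFinEquiv y := by
    rw [idx_ofFn, finFunctionFinEquiv_apply]
    simp [hb, hy]
  classical
  rw [this, bits, List.getElem?_ofFn, dif_pos (Fin.is_lt _), Option.some.injEq, decide_eq_true_iff,
    Fin.eta, Equiv.symm_apply_apply]

theorem mem_symbolList [FiniteSignature L] (s : Sym L) : s ∈ symbolList L := by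
  simp [symbolList]

theorem nodup_symbolList [FiniteSignature L] : (symbolList L).Nodup := Finset.nodup_toList _

theorem size_lt_length_encode [FiniteSignature L] (X : FinInstance L) :
    X.size < X.encode.length := by
  rw [encode_eq]
  simp

theorem length_bits_le [FiniteSignature L] (X : FinInstance L) (s : Sym L) :
    (X.bits s).length ≤ X.encode.length := by
  rw [encode_eq, List.length_append, List.length_cons, List.length_flatMap]
  have := List.single_le_sum (l := (symbolList L).map fun s => (X.bits s).length)
    (fun _ _ => Nat.zero_le _) _ (List.mem_map_of_mem (mem_symbolList s))
  omega

end FinInstance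

namespace Frag

variable {A J : Type} {L : FirstOrder.Language.{0, 0}}

def tableSize (s : Sym L) : List (Ctr A × Ctr A) :=
  List.replicate s.1 (.zero, .n) ++ [(.one, .n)]

def readTables : List (Sym L) → Frag (Stk (Ctr A) (Sym L ⊕ J))
  | [] => stmt .halt
  | s :: ss => seq (readTable (tableSize s) (Sum.inl s)) (readTables ss)

def readTablesCost (A : Type) : List (Sym L) → Polynomial ℕ
  | [] => 1
  | s :: ss => readTableCost (tableSize (A := A) s) + readTablesCost A ss

theorem readTables_does {x : Ctr A → ℕ} {M : ℕ} (hM : ∀ v, x v ≤ M) (h0 : x .zero = 0)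
    (h1 : x .one = 1) (t : Sym L → List Bool) (ht : ∀ s, (t s).length = x .n ^ s.1)
    (e r : List Bool) (ss : List (Sym L)) (hss : ss.Nodup) (T : Sym L ⊕ J → List Bool)
    (hT : ∀ s ∈ ss, T (Sum.inl s) = []) :
    (readTables ss).Does (store x T e (ss.flatMap t ++ r))
      (store x (Sum.elim (fun s => if s ∈ ss then t s else T (Sum.inl s)) fun j => T (Sum.inr j))
        e r) ((readTablesCost A ss).eval M) := by
  classical
  induction ss generalizing T with
  | nil =>
    refine fun v => ⟨v, Steps.mono ((stmt_runs rfl).congr_right ?_) (by simp [readTablesCost])⟩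
    simp only [List.flatMap_nil, List.nil_append, List.not_mem_nil, if_false]
    congr 1
    funext j
    cases j <;> rfl
  | cons s ss ih =>
    have h2 := readTable_does hM T e (ss.flatMap t ++ r) (t s) (Sum.inl s) (hT s (by simp))
      (tableSize s) (by rw [tableSize, idx_replicate _ _ _ _ h0 h1, ht])
    rw [List.nodup_cons] at hss
    have h3 := ih hss.2 (Function.update T (Sum.inl s) (t s)) (by
      intro s' hs'
      rw [Function.update_of_ne, hT s' (by simp [hs'])]
      rintro ⟨⟩
      exact hss.1 hs')
    rw [List.flatMap_cons, List.append_assoc]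
    refine (seq_does h2 h3).congr ?_ (by simp [readTablesCost])
    congr 1
    funext j
    rcases j with s' | j
    · by_cases h : s' = s
      · subst h
        simp [hss.1]
      · simp [h]
    · simp

/-- Read a structure. -/
def read (L : FirstOrder.Language.{0, 0}) [FiniteSignature L] (A J : Type) :
    Frag (Stk (Ctr A) (Sym L ⊕ J)) :=
  seq (readUnary .n) (seq (addConst .one 1) (readTables (symbolList L)))

theorem read_does [FiniteSignature L] (X : FinInstance L) :
    (read L A J).Does (store (fun _ => 0) (fun _ => []) [] X.encode)
      (store (Ctr.init X.size) (Sum.elim X.bits fun _ => []) [] [])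
      ((Polynomial.X + 2 + readTablesCost A (symbolList L)).eval X.encode.length) := by
  have hlt := X.size_lt_length_encode
  have h1 := readUnary_does (J := Sym L ⊕ J) (v := Ctr.n (A := A)) (fun _ => 0) rfl (fun _ => [])
    [] ((symbolList L).flatMap X.bits) X.size
  rw [← FinInstance.encode_eq] at h1
  have h2 := addConst_does (J := Sym L ⊕ J) (Function.update (fun _ => 0) (Ctr.n (A := A)) X.size)
    (fun _ => []) [] ((symbolList L).flatMap X.bits) .one 1
  have e : Function.update (Function.update (fun _ => 0) (Ctr.n (A := A)) X.size) .one
      (Function.update (fun _ => 0) (Ctr.n (A := A)) X.size .one + 1) = Ctr.init X.size := by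
    funext v
    cases v <;> simp [Ctr.init]
  rw [e] at h2
  have h3 := readTables_does (J := J) (x := Ctr.init (A := A) X.size) (M := X.encode.length)
    (by intro v; cases v <;> simp [Ctr.init] <;> omega) rfl rfl X.bits X.length_bits [] []
    (symbolList L) FinInstance.nodup_symbolList (fun _ => []) (fun _ _ => rfl)
  rw [List.append_nil] at h3
  refine (seq_does h1 (seq_does h2 h3)).congr ?_ ?_
  · simp [FinInstance.mem_symbolList]
  · simp
    omega

end Frag

/-- What is written to the output: the number of elements is `x b ^ d`, and the table of the
symbol `s` is given by the formula `φ s` with the arguments `args s`. -/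
structure Output (L' : FirstOrder.Language.{0, 0}) (V J : Type) where
  j : J
  b : V
  d : ℕ
  a : Fin d → V
  ar : Sym L' → ℕ
  args : (s : Sym L') → Fin (ar s) → V
  φ : Sym L' → Fm V J

namespace Output

variable {L' : FirstOrder.Language.{0, 0}} {V J : Type} (O : Output L' V J)

/-- The conditions under which the output can be written. -/
structure Ok [DecidableEq V] (x : V → ℕ) (T : J → List Bool) : Prop where
  empty : T O.j = []
  a_injective : Function.Injective O.a
  a_ne : ∀ i, O.a i ≠ O.b
  a_zero : ∀ i, x (O.a i) = 0
  avoids : ∀ s, (O.φ s).Avoids O.j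
  args_injective : ∀ s, Function.Injective (O.args s)
  args_ne : ∀ s i, O.args s i ≠ O.b
  args_zero : ∀ s i, x (O.args s i) = 0
  fresh : ∀ s y, (∀ i, y i < x O.b) → (O.φ s).Fresh (Function.extend (O.args s) y x)

def writeTables : List (Sym L') → Frag (Stk V J)
  | [] => .stmt .halt
  | s :: ss => .seq (writeTables ss) (.tabulate O.j O.b (O.ar s) (O.args s) (O.φ s))

def writeTablesCost : List (Sym L') → Polynomial ℕ
  | [] => 1
  | s :: ss => writeTablesCost ss + Frag.tabulateCost (O.φ s) (O.ar s)

/-- A stack is filled from its far end, so the tables of later symbols are written first. -/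
theorem writeTables_does [DecidableEq V] [DecidableEq J] {x : V → ℕ} {T : J → List Bool}
    (h : O.Ok x T) {M : ℕ} (hM : ∀ v, x v ≤ M) (ss : List (Sym L')) :
    (O.writeTables ss).Does (store x T [] [])
      (store x (Function.update T O.j (ss.flatMap fun s => tableOf T x O.b (O.args s) (O.φ s)))
        [] []) ((O.writeTablesCost ss).eval M) := by
  induction ss with
  | nil =>
    refine fun v => ⟨v, Steps.mono ((Frag.stmt_runs rfl).congr_right ?_)
      (by simp [writeTablesCost])⟩
    rw [List.flatMap_nil, ← h.empty, Function.update_eq_self]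
  | cons s ss ih =>
    have h1 := Frag.tabulate_does (Function.update T O.j
      (ss.flatMap fun s => tableOf T x O.b (O.args s) (O.φ s))) [] [] (h.avoids s)
      (h.args_injective s) (h.args_ne s) hM (h.args_zero s) (h.fresh s)
    refine (Frag.seq_does ih h1).congr ?_ (by simp [writeTablesCost])
    rw [tableOf_update (h.avoids s)]
    simp

/-- The word is written back to front. The leading `1ⁿ` is obtained as the table of the constant
formula `true` with `d` arguments, which has `x b ^ d` entries. -/
def write [FiniteSignature L'] : Frag (Stk V J) :=
  .seq (O.writeTables (symbolList L')) (.seq (.stmt (.push (.tab O.j) (fun _ => false) .halt))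
    (.tabulate O.j O.b O.d O.a (.const true)))

def writeCost [FiniteSignature L'] : Polynomial ℕ :=
  O.writeTablesCost (symbolList L') + (1 + Frag.tabulateCost (.const true : Fm V J) O.d)

theorem write_does [DecidableEq V] [DecidableEq J] [FiniteSignature L'] {x : V → ℕ}
    {T : J → List Bool} (h : O.Ok x T) {M : ℕ} (hM : ∀ v, x v ≤ M) {Y : FinInstance L'}
    (hsize : Y.size = x O.b ^ O.d)
    (hbits : ∀ s, Y.bits s = tableOf T x O.b (O.args s) (O.φ s)) :
    O.write.Does (store x T [] []) (store x (Function.update T O.j Y.encode) [] [])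
      (O.writeCost.eval M) := by
  have h1 := O.writeTables_does h hM (symbolList L')
  simp only [← hbits] at h1
  have h2 : (Frag.stmt (.push (.tab O.j) (fun _ => false) .halt)).Does
      (store x (Function.update T O.j ((symbolList L').flatMap Y.bits)) [] [])
      (store x (Function.update T O.j (false :: (symbolList L').flatMap Y.bits)) [] []) 1 := by
    refine fun v => ⟨v, Frag.stmt_runs ?_⟩
    simp [update_store_tab]
  have h3 := Frag.tabulate_does (Function.update T O.j (false :: (symbolList L').flatMap Y.bits))
    [] [] (j := O.j) (b := O.b) (φ := .const true) trivial h.a_injective h.a_ne hM h.a_zero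
    (fun _ _ => trivial)
  refine (Frag.seq_does h1 (Frag.seq_does h2 h3)).congr ?_ (by simp [writeCost])
  have e : tableOf (Function.update T O.j (false :: (symbolList L').flatMap Y.bits)) x O.b O.a
      (.const true) = List.replicate Y.size true := by
    simp [tableOf, Fm.Holds, hsize, List.map_const']
  rw [e, Function.update_idem, Function.update_self, FinInstance.encode_eq]

end Output

open scoped Classical in
/-- Read a structure, compute auxiliary counters and tables, and write a structure. -/
theorem isPolyTime_of_output {L L' : FirstOrder.Language.{0, 0}} [FiniteSignature L]
    [FiniteSignature L'] {A J : Type} [Finite A] [Finite J] {C : Type*} {D : Type*} {C' : Type*}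
    {D' : Type*} [L.Structure C] [L.Structure D] [L'.Structure C'] [L'.Structure D']
    {f : FinInstance L → FinInstance L'} (O : Output L' (Ctr A) (Sym L ⊕ J))
    (F : Frag (Stk (Ctr A) (Sym L ⊕ J))) (cost bound : Polynomial ℕ)
    (x : FinInstance L → Ctr A → ℕ) (T : FinInstance L → Sym L ⊕ J → List Bool)
    (hF : ∀ X, F.Does (store (Ctr.init X.size) (Sum.elim X.bits fun _ => []) [] [])
      (store (x X) (T X) [] []) (cost.eval X.encode.length))
    (hO : ∀ X, O.Ok (x X) (T X))
    (hx : ∀ X v, x X v ≤ bound.eval X.encode.length)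
    (hT : ∀ X j, (T X j).length ≤ bound.eval X.encode.length)
    (hsize : ∀ X, (f X).size = x X O.b ^ O.d)
    (hbits : ∀ X s, (f X).bits s = tableOf (T X) (x X) O.b (O.args s) (O.φ s)) :
    IsPolyTime (PCSP L C D) (PCSP L' C' D') f := by
  have : Fintype (Stk (Ctr A) (Sym L ⊕ J)) := Fintype.ofFinite _
  let ks := (Finset.univ.erase (Stk.tab O.j : Stk (Ctr A) (Sym L ⊕ J))).toList
  refine isPolyTime_of_frag (.seq (.read L A J) (.seq F (.seq O.write (.clearAll ks)))) O.j
    ((Polynomial.X + 2 + Frag.readTablesCost A (symbolList L)) + (cost + (O.writeCost.comp bound +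
      (Polynomial.C ks.length * (2 * bound + 1) + 1)))) fun X => ?_
  have h3 := O.write_does (hO X) (hx X) (hsize X) (hbits X)
  have h4 := Frag.clearAll_does ks (B := bound.eval X.encode.length)
    (store (x X) (Function.update (T X) O.j (f X).encode) [] []) (by
      intro k hk
      simp only [ks, Finset.mem_toList, Finset.mem_erase, Finset.mem_univ, and_true] at hk
      cases k with
      | var v => simpa using hx X v
      | tab j =>
        have : j ≠ O.j := fun h => hk (h ▸ rfl)
        simpa [this] using hT X j
      | _ => simp)
  refine (Frag.seq_does (Frag.read_does X) (Frag.seq_does (hF X) (Frag.seq_does h3 h4))).congr ?_ ?_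
  · funext k
    by_cases hk : k = .tab O.j
    · subst hk
      simp only [ks, Finset.mem_toList, Finset.mem_erase, store_tab, Function.update_self]
      simp
      rfl
    · simp [ks, hk]
  · simp only [Polynomial.eval_add, Polynomial.eval_mul, Polynomial.eval_comp, Polynomial.eval_C,
      Polynomial.eval_one, Polynomial.eval_ofNat, Polynomial.eval_X]
    exact le_rfl

namespace Fm

variable {V J : Type}

/-- Finite conjunctions. -/
def all (l : List (Fm V J)) : Fm V J := l.foldr and (const true)

/-- Finite disjunctions. -/
def any (l : List (Fm V J)) : Fm V J := l.foldr or (const false)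

theorem holds_all [DecidableEq V] {T : J → List Bool} {x : V → ℕ} {l : List (Fm V J)} :
    (all l).Holds T x ↔ ∀ φ ∈ l, φ.Holds T x := by
  induction l with
  | nil => simp [all, Holds]
  | cons φ l ih => simp [all, Holds] at ih ⊢; simp [ih]

theorem holds_any [DecidableEq V] {T : J → List Bool} {x : V → ℕ} {l : List (Fm V J)} :
    (any l).Holds T x ↔ ∃ φ ∈ l, φ.Holds T x := by
  induction l with
  | nil => simp [any, Holds]
  | cons φ l ih => simp [any, Holds] at ih ⊢; simp [ih]

theorem fresh_all [DecidableEq V] {x : V → ℕ} {l : List (Fm V J)} (h : ∀ φ ∈ l, φ.Fresh x) :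
    (all l).Fresh x := by
  induction l with
  | nil => trivial
  | cons φ l ih => exact ⟨h φ (by simp), ih fun ψ hψ => h ψ (by simp [hψ])⟩

theorem fresh_any [DecidableEq V] {x : V → ℕ} {l : List (Fm V J)} (h : ∀ φ ∈ l, φ.Fresh x) :
    (any l).Fresh x := by
  induction l with
  | nil => trivial
  | cons φ l ih => exact ⟨h φ (by simp), ih fun ψ hψ => h ψ (by simp [hψ])⟩

theorem avoids_all {j : J} {l : List (Fm V J)} (h : ∀ φ ∈ l, φ.Avoids j) : (all l).Avoids j := by
  induction l with
  | nil => trivial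
  | cons φ l ih => exact ⟨h φ (by simp), ih fun ψ hψ => h ψ (by simp [hψ])⟩

theorem avoids_any {j : J} {l : List (Fm V J)} (h : ∀ φ ∈ l, φ.Avoids j) : (any l).Avoids j := by
  induction l with
  | nil => trivial
  | cons φ l ih => exact ⟨h φ (by simp), ih fun ψ hψ => h ψ (by simp [hψ])⟩

end Fm

/-! ### The structure `X^{[m]}` is computable in polynomial time -/

section Power

variable {L : FirstOrder.Language.{0, 0}} (m : ℕ)

/-- The structure `X^{[m]}`, with its elements numbered. -/
def powInstance (X : FinInstance L) : FinInstance (mpowLang L m) where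
  size := X.size ^ m
  str :=
    { funMap := fun f => Empty.elim f
      RelMap := fun R x => Structure.RelMap (M := MPow m X.Carrier) R
        fun k => (finFunctionFinEquiv.symm (x k) : Fin m → Fin X.size) }

def powInstanceEquiv (X : FinInstance L) :
    (powInstance m X).Carrier ≃[mpowLang L m] MPow m X.Carrier where
  toEquiv := finFunctionFinEquiv.symm
  map_fun' f := Empty.elim f
  map_rel' _ _ := Iff.rfl

/-- The arguments and the formula for a relation of `X^{[m]}`. -/
def powRel : Sym (mpowLang L m) →
    Σ d, (Fin d → Ctr (Fin 2 × Fin m)) × Fm (Ctr (Fin 2 × Fin m)) (Sym L ⊕ Unit)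
  | ⟨_, .unary R i⟩ => ⟨m, fun k => .arr (0, k),
      .look (Sum.inl ⟨_, R⟩) (List.ofFn fun k => (.arr (0, i k), .n))⟩
  | ⟨_, .eq ℓ _ _ i j⟩ => ⟨m + m, Fin.append (fun k => .arr (0, k)) (fun k => .arr (1, k)),
      .all (List.ofFn fun k : Fin ℓ => .eq (.arr (0, i k)) [(.arr (1, j k), .n)])⟩

def powOutput : Output (mpowLang L m) (Ctr (Fin 2 × Fin m)) (Sym L ⊕ Unit) where
  j := Sum.inr ()
  b := .n
  d := m
  a k := .arr (0, k)
  ar s := (powRel m s).1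
  args s := (powRel m s).2.1
  φ s := (powRel m s).2.2

theorem append_arr_injective :
    Function.Injective (Fin.append (fun k => Ctr.arr ((0 : Fin 2), k))
      (fun k => Ctr.arr ((1 : Fin 2), k)) : Fin (m + m) → Ctr (Fin 2 × Fin m)) := by
  intro p q
  refine Fin.addCases (fun p => ?_) (fun p => ?_) p <;>
    refine Fin.addCases (fun q => ?_) (fun q => ?_) q <;>
    simp only [Fin.append_left, Fin.append_right, Ctr.arr.injEq, Prod.mk.injEq] <;> simp

theorem powOutput_ok (X : FinInstance L) :
    (powOutput m).Ok (Ctr.init X.size) (Sum.elim X.bits fun _ => []) where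
  empty := rfl
  a_injective := fun i j h => by cases h; rfl
  a_ne _ := by simp [powOutput]
  a_zero _ := rfl
  avoids s := by
    rcases s with ⟨_, ⟨R, i⟩ | ⟨ℓ, h1, hm, i, j⟩⟩
    · exact fun h => by cases h
    · refine Fm.avoids_all fun φ hφ => ?_
      obtain ⟨k, rfl⟩ := (List.mem_ofFn' _ _).1 hφ
      trivial
  args_injective s := by
    rcases s with ⟨_, ⟨R, i⟩ | ⟨ℓ, h1, hm, i, j⟩⟩
    · exact fun i j h => by cases h; rfl
    · exact append_arr_injective m
  args_ne s := by
    rcases s with ⟨_, ⟨R, i⟩ | ⟨ℓ, h1, hm, i, j⟩⟩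
    · exact fun i h => by cases h
    · intro p
      change Fin (m + m) at p
      refine Fin.addCases (fun p => ?_) (fun p => ?_) p <;>
        simp only [powOutput, powRel, Fin.append_left, Fin.append_right] <;> simp
  args_zero s := by
    rcases s with ⟨_, ⟨R, i⟩ | ⟨ℓ, h1, hm, i, j⟩⟩
    · exact fun i => rfl
    · intro p
      change Fin (m + m) at p
      refine Fin.addCases (fun p => ?_) (fun p => ?_) p <;>
        simp only [powOutput, powRel, Fin.append_left, Fin.append_right] <;> rfl
  fresh s := by
    rcases s with ⟨_, ⟨R, i⟩ | ⟨ℓ, h1, hm, i, j⟩⟩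
    · exact fun _ _ => trivial
    · refine fun y hy => Fm.fresh_all fun φ hφ => ?_
      obtain ⟨k, rfl⟩ := (List.mem_ofFn' _ _).1 hφ
      trivial

/-- An element of the power is a number with `m` digits in base `X.size`, and a pair of elements is
one with `2m` digits. Coordinate `k` of the first entry is digit `k` of the position in the table,
coordinate `k` of the second is digit `m + k`. -/
theorem bits_powInstance (X : FinInstance L) (s : Sym (mpowLang L m)) :
    (powInstance m X).bits s = tableOf (Sum.elim X.bits fun _ : Unit => []) (Ctr.init X.size) .n
      ((powOutput m).args s) ((powOutput m).φ s) := by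
  classical
  rcases s with ⟨_, ⟨R, i⟩ | ⟨ℓ, h1, hm, i, j⟩⟩
  · have hlen : ((powInstance m X).bits ⟨_, .unary R i⟩).length = X.size ^ m := by
      simp [FinInstance.length_bits, powInstance]
    refine List.ext_getElem (hlen.trans (by simp [tableOf, Ctr.init, powOutput, powRel]))
      fun p hp hp' => ?_
    rw [hlen] at hp
    simp only [FinInstance.bits, tableOf, List.getElem_ofFn, List.getElem_map, List.getElem_range]
    rw [decide_eq_decide]
    have hinj := (powOutput_ok m X).args_injective ⟨_, .unary R i⟩
    generalize hx : Function.extend _ _ _ = x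
    have hn : x .n = X.size := by
      rw [← hx]
      exact Function.extend_apply' _ _ _ (fun ⟨k, hk⟩ => (powOutput_ok m X).args_ne _ k hk)
    have hk : ∀ k, x (.arr (0, k)) = p / X.size ^ (k : ℕ) % X.size := by
      intro k
      rw [← hx]
      exact hinj.extend_apply _ _ k
    let u : Fin m → Fin X.size := finFunctionFinEquiv.symm ⟨p, hp⟩
    have e : (finFunctionFinEquiv.symm ⟨p, by simpa [powInstance] using hp⟩ :
        Fin 1 → Fin (X.size ^ m)) 0 = ⟨p, hp⟩ := by
      apply Fin.ext
      change p / (X.size ^ m) ^ 0 % X.size ^ m = p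
      rw [pow_zero, Nat.div_one, Nat.mod_eq_of_lt hp]
    have h := X.getElem?_bits R hn (a := fun k => .arr (0, i k)) (fun k => u (i k))
      (fun k => hk (i k))
    refine Iff.trans (Iff.of_eq ?_) h.symm
    exact congrArg (fun q : Fin (X.size ^ m) => X.str.RelMap R fun k =>
      (finFunctionFinEquiv.symm q : Fin m → Fin X.size) (i k)) e
  · have hlen : ((powInstance m X).bits ⟨_, .eq ℓ h1 hm i j⟩).length = X.size ^ (m + m) := by
      simp [FinInstance.length_bits, powInstance]
      ring
    refine List.ext_getElem (hlen.trans (by simp [tableOf, Ctr.init, powOutput, powRel]))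
      fun p hp hp' => ?_
    rw [hlen] at hp
    simp only [FinInstance.bits, tableOf, List.getElem_ofFn, List.getElem_map, List.getElem_range]
    rw [decide_eq_decide]
    have hinj := (powOutput_ok m X).args_injective ⟨_, .eq ℓ h1 hm i j⟩
    generalize hx : Function.extend _ _ _ = x
    have hk : ∀ k, x (.arr (0, k)) = p / X.size ^ (k : ℕ) % X.size := by
      intro k
      rw [← hx]
      have := hinj.extend_apply (fun i => p / X.size ^ (i : ℕ) % X.size) (Ctr.init X.size)
        (Fin.castAdd m k)
      simp only [powOutput, powRel, Fin.append_left] at this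
      exact this
    have hk' : ∀ k, x (.arr (1, k)) = p / X.size ^ (m + k : ℕ) % X.size := by
      intro k
      rw [← hx]
      have := hinj.extend_apply (fun i => p / X.size ^ (i : ℕ) % X.size) (Ctr.init X.size)
        (Fin.natAdd m k)
      simp only [powOutput, powRel, Fin.append_right] at this
      exact this
    change (∀ k, (finFunctionFinEquiv.symm ((finFunctionFinEquiv.symm _) 0) (i k) : Fin X.size) =
      finFunctionFinEquiv.symm ((finFunctionFinEquiv.symm _) 1) (j k)) ↔ (Fm.all _).Holds _ _
    rw [Fm.holds_all, List.forall_mem_ofFn_iff]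
    refine forall_congr' fun k => ?_
    -- Truncating to `m` digits does not change digit `k < m`.
    have e : ∀ a k : ℕ, k < m → a % X.size ^ m / X.size ^ k % X.size = a / X.size ^ k % X.size := by
      intro a k hk
      obtain ⟨c, rfl⟩ : ∃ c, m = k + (c + 1) := ⟨m - (k + 1), by omega⟩
      rw [pow_add, Nat.mod_mul_right_div_self, pow_succ', Nat.mod_mul_right_mod]
    simp only [Fm.Holds, idx, mul_zero, add_zero, hk, hk', Fin.ext_iff]
    change p / (X.size ^ m) ^ 0 % X.size ^ m / X.size ^ (i k : ℕ) % X.size =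
      p / (X.size ^ m) ^ 1 % X.size ^ m / X.size ^ (j k : ℕ) % X.size ↔ _
    rw [pow_zero, pow_one, e _ _ (i k).2, e _ _ (j k).2, Nat.div_one, Nat.div_div_eq_div_mul,
      ← pow_add]

/-- Every relation of the power is given by a formula over the input tables, so no preprocessing is
needed. The templates are arbitrary, as they affect neither instances nor encodings. -/
theorem isPolyTime_powInstance [FiniteSignature L] {C D C' D' : Type*} [L.Structure C]
    [L.Structure D] [(mpowLang L m).Structure C'] [(mpowLang L m).Structure D'] :
    IsPolyTime (PCSP L C D) (PCSP (mpowLang L m) C' D') (powInstance m) :=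
  isPolyTime_of_output (powOutput m) (.stmt .halt) 1 Polynomial.X (fun X => Ctr.init X.size)
    (fun X => Sum.elim X.bits fun _ => [])
    (fun X v => ⟨v, Steps.mono (Frag.stmt_runs rfl) (by simp)⟩)
    (powOutput_ok m)
    (fun X v => by
      have := X.size_lt_length_encode
      cases v <;> simp [Ctr.init] <;> omega)
    (fun X j => by rcases j with s | _ <;> simp [X.length_bits_le])
    (fun _ => rfl) (bits_powInstance m)

end Power

/-! ### The equivalence closure of a relation, computed by pivoting -/

/-- Add the pairs that are connected via `v`. -/
def pivot (P : ℕ → ℕ → Prop) (v a b : ℕ) : Prop := P a b ∨ P a v ∧ P v b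

/-- The result of pivoting with `N - 1`, ..., `N - t`. -/
def pivots (P : ℕ → ℕ → Prop) (N : ℕ) : ℕ → ℕ → ℕ → Prop
  | 0 => P
  | t + 1 => pivot (pivots P N t) (N - (t + 1))

section Pivots

variable {P : ℕ → ℕ → Prop} {N : ℕ}

theorem pivots_of_rel {t a b : ℕ} (h : P a b) : pivots P N t a b := by
  induction t with
  | zero => exact h
  | succ t ih => exact .inl ih

theorem pivots_symm (hP : ∀ a b, P a b → P b a) {t a b : ℕ} (h : pivots P N t a b) :
    pivots P N t b a := by
  induction t generalizing a b with
  | zero => exact hP _ _ h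
  | succ t ih =>
    rcases h with h | ⟨h, h'⟩
    · exact .inl (ih h)
    · exact .inr ⟨ih h', ih h⟩

theorem pivots_le {R : ℕ → ℕ → Prop} (hR : ∀ a b c, R a b → R b c → R a c)
    (hP : ∀ a b, P a b → R a b) {t a b : ℕ} (h : pivots P N t a b) : R a b := by
  induction t generalizing a b with
  | zero => exact hP _ _ h
  | succ t ih =>
    rcases h with h | ⟨h, h'⟩
    · exact ih h
    · exact hR _ _ _ (ih h) (ih h')

/-- Correctness of Warshall's algorithm: paths may pass through any earlier pivot. Pivoting with `v`
adds no new pair that starts or ends in `v`, so at the newest pivot the two halves were related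
before and the step joins them; for older pivots the connection is made by induction. -/
theorem pivots_trans {t v a b : ℕ} (hv : N - t ≤ v) (hv' : v < N) (h : pivots P N t a v)
    (h' : pivots P N t v b) : pivots P N t a b := by
  induction t generalizing a b v with
  | zero => omega
  | succ t ih =>
    by_cases hvt : v = N - (t + 1)
    · subst hvt
      have h1 : pivots P N t a (N - (t + 1)) := by
        rcases h with h | ⟨h, -⟩ <;> exact h
      have h2 : pivots P N t (N - (t + 1)) b := by
        rcases h' with h | ⟨-, h⟩ <;> exact h
      exact .inr ⟨h1, h2⟩
    · have hv'' : N - t ≤ v := by omega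
      rcases h with h | ⟨h1, h2⟩ <;> rcases h' with h' | ⟨h3, h4⟩
      · exact .inl (ih hv'' hv' h h')
      · exact .inr ⟨ih hv'' hv' h h3, h4⟩
      · exact .inr ⟨h1, ih hv'' hv' h2 h'⟩
      · exact .inr ⟨h1, h4⟩

/-- Reflexivity and symmetry are built into the initial relation and survive pivoting; after `N`
rounds every element has been a pivot, which gives transitivity. -/
theorem pivots_iff_eqvGen {r : Fin N → Fin N → Prop} {P : ℕ → ℕ → Prop}
    (hP : ∀ a b, P a b ↔ ∃ a' b' : Fin N, (a' = b' ∨ r a' b' ∨ r b' a') ∧ a = a' ∧ b = b')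
    (a b : Fin N) : pivots P N N a b ↔ Relation.EqvGen r a b := by
  constructor
  · intro h
    obtain ⟨a', b', h, ha, hb⟩ := pivots_le
      (R := fun a b => ∃ a' b' : Fin N, Relation.EqvGen r a' b' ∧ a = a' ∧ b = b') (by
      rintro _ _ _ ⟨a, b, h, rfl, rfl⟩ ⟨b', c, h', hb, rfl⟩
      cases Fin.ext hb
      exact ⟨a, c, h.trans _ _ _ h', rfl, rfl⟩) (by
      intro a b h₀
      obtain ⟨a', b', h | h | h, rfl, rfl⟩ := (hP _ _).1 h₀
      · exact ⟨a', b', h ▸ .refl _, rfl, rfl⟩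
      · exact ⟨a', b', .rel _ _ h, rfl, rfl⟩
      · exact ⟨a', b', .symm _ _ (.rel _ _ h), rfl, rfl⟩) h
    cases Fin.ext ha
    cases Fin.ext hb
    exact h
  · intro h
    induction h with
    | rel a b h => exact pivots_of_rel ((hP _ _).2 ⟨a, b, .inr (.inl h), rfl, rfl⟩)
    | refl a => exact pivots_of_rel ((hP _ _).2 ⟨a, a, .inl rfl, rfl, rfl⟩)
    | symm a b _ ih =>
      refine pivots_symm (fun a b h₀ => ?_) ih
      obtain ⟨a', b', h | h | h, rfl, rfl⟩ := (hP _ _).1 h₀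
      · exact (hP _ _).2 ⟨b', a', .inl h.symm, rfl, rfl⟩
      · exact (hP _ _).2 ⟨b', a', .inr (.inr h), rfl, rfl⟩
      · exact (hP _ _).2 ⟨b', a', .inr (.inl h), rfl, rfl⟩
    | trans a b c _ _ ih ih' => exact pivots_trans (by simp) b.2 ih ih'

end Pivots

/-! ### Gluing: the left adjoint of `X ↦ X^{[m]}` -/

section Glue

variable {L : FirstOrder.Language.{0, 0}} {m : ℕ}

/-- The coordinates of the elements of `Y`, related as prescribed by the relations `eq`. -/
def Link (Y : FinInstance (mpowLang L m)) (a b : Fin (m * Y.size)) : Prop :=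
  ∃ (ℓ : ℕ) (h1 : 1 ≤ ℓ) (hm : ℓ ≤ m) (i j : Fin ℓ → Fin m) (k : Fin ℓ) (y z : Fin Y.size),
    Y.str.RelMap (MPowRel.eq ℓ h1 hm i j) ![y, z] ∧
      a = finProdFinEquiv (i k, y) ∧ b = finProdFinEquiv (j k, z)

/-- The structure whose homomorphisms to `X` correspond to homomorphisms from `Y` to
`X^{[m]}`, up to homomorphic equivalence. -/
def glue [hL : FiniteSignature L] (Y : FinInstance (mpowLang L m)) : FinInstance L where
  size := m * Y.size
  str :=
    { funMap := fun f => ((hL.isRelational _).false f).elim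
      RelMap := fun {ℓ} R x => ∃ (i : Fin ℓ → Fin m) (y : Fin Y.size),
        Y.str.RelMap (MPowRel.unary R i) ![y] ∧
          ∀ k, Relation.EqvGen (Link Y) (x k) (finProdFinEquiv (i k, y)) }

abbrev GlueArr (L : FirstOrder.Language.{0, 0}) : Type := Fin 2 ⊕ Σ s : Sym L, Fin s.1

abbrev GlueFm (L : FirstOrder.Language.{0, 0}) (m : ℕ) : Type :=
  Fm (Ctr (GlueArr L)) (Sym (mpowLang L m) ⊕ Fin 3)

/-- The digits of the number of the pair `(c, y)`. -/
def coord (y : Ctr (GlueArr L)) (c : ℕ) : List (Ctr (GlueArr L) × Ctr (GlueArr L)) :=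
  (y, .one) :: List.replicate c (.n, .one)

theorem idx_replicate_one {V : Type} (x : V → ℕ) {n o : V} (ho : x o = 1) (c : ℕ) :
    idx x (List.replicate c (n, o)) = x n * c := by
  induction c with
  | zero => simp [idx]
  | succ c ih =>
    rw [List.replicate_succ, idx, ih, ho]
    ring

theorem idx_coord {x : Ctr (GlueArr L) → ℕ} (ho : x .one = 1) (y : Ctr (GlueArr L)) (c : ℕ) :
    idx x (coord y c) = x y + x .n * c := by
  rw [coord, idx, idx_replicate_one x ho, ho, one_mul]

def uVar (i : Fin 2) : Ctr (GlueArr L) := .arr (Sum.inl i)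

theorem uVar_injective : Function.Injective (uVar (L := L)) := fun _ _ h => by cases h; rfl

def linkSym (s : Sym (mpowLang L m)) (c d : ℕ) (a b : Ctr (GlueArr L)) : GlueFm L m :=
  .ex .ex₁ .n (.ex .ex₂ .n (.and (.look (Sum.inl s) [(.ex₁, .n), (.ex₂, .n)])
    (.and (.eq a (coord .ex₁ c)) (.eq b (coord .ex₂ d)))))

/-- Both orientations are listed, since pivoting has to start from a symmetric relation. -/
def linkFms : Sym (mpowLang L m) → List (GlueFm L m)
  | ⟨_, .unary _ _⟩ => []
  | ⟨_, .eq ℓ h1 hm i j⟩ => (List.finRange ℓ).flatMap fun k =>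
      [linkSym ⟨2, .eq ℓ h1 hm i j⟩ (i k) (j k) (uVar 0) (uVar 1),
        linkSym ⟨2, .eq ℓ h1 hm i j⟩ (i k) (j k) (uVar 1) (uVar 0)]

def linkFm [FiniteSignature L] : GlueFm L m :=
  .or (.eq (uVar 0) [(uVar 1, .n)]) (.any ((symbolList (mpowLang L m)).flatMap linkFms))

def pivotFm : GlueFm L m :=
  .or (.look (Sum.inr 0) [(uVar 0, .size), (uVar 1, .size)])
    (.and (.look (Sum.inr 0) [(uVar 0, .size), (.piv, .size)])
      (.look (Sum.inr 0) [(.piv, .size), (uVar 1, .size)]))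

/-- Table `0` is expected to hold the equivalence of coordinates when the output is written; with it
the relations of `glue Y` become formulas with one bounded quantifier, over `y`. The choice of `i`
is a finite disjunction fixed by the signature. -/
def glueOutput (L : FirstOrder.Language.{0, 0}) (m : ℕ) :
    Output L (Ctr (GlueArr L)) (Sym (mpowLang L m) ⊕ Fin 3) where
  j := Sum.inr 2
  b := .size
  d := 1
  a _ := uVar 0
  ar s := s.1
  args s k := .arr (Sum.inr ⟨s, k⟩)
  φ s := .any ((Finset.univ : Finset (Fin s.1 → Fin m)).toList.map fun i =>
    .ex .ex₁ .n (.and (.look (Sum.inl ⟨1, .unary s.2 i⟩) [(.ex₁, .n)])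
      (.all (List.ofFn fun k =>
        .look (Sum.inr 0) ((.arr (Sum.inr ⟨s, k⟩), .size) :: coord .ex₁ (i k))))))

open scoped Classical in
/-- The table of a binary relation. -/
def relTable (N : ℕ) (P : ℕ → ℕ → Prop) : List Bool :=
  (List.range (N ^ 2)).map fun p => decide (P (p % N) (p / N % N))

theorem getElem?_relTable {N : ℕ} (P : ℕ → ℕ → Prop) {a b : ℕ} (ha : a < N) (hb : b < N) :
    (relTable N P)[a + N * b]? = some true ↔ P a b := by
  have h : a + N * b < N ^ 2 := by
    obtain ⟨c, rfl⟩ : ∃ c, N = b + 1 + c := ⟨N - (b + 1), by omega⟩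
    nlinarith
  have h1 : (a + N * b) % N = a := by rw [Nat.add_mul_mod_self_left, Nat.mod_eq_of_lt ha]
  have h2 : (a + N * b) / N % N = b := by
    rw [Nat.add_mul_div_left _ _ (by omega), Nat.div_eq_of_lt ha, Nat.zero_add,
      Nat.mod_eq_of_lt hb]
  simp only [relTable, List.getElem?_map, List.getElem?_range h, Option.map_some, h1, h2,
    Option.some.injEq, decide_eq_true_eq]

theorem tableOf_uVar {J : Type} (T : J → List Bool) (x : Ctr (GlueArr L) → ℕ)
    (φ : Fm (Ctr (GlueArr L)) J) (P : ℕ → ℕ → Prop)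
    (h : ∀ a < x .size, ∀ b < x .size, φ.Holds T (Function.extend uVar ![a, b] x) ↔ P a b) :
    tableOf T x .size uVar φ = relTable (x .size) P := by
  refine List.map_congr_left fun p hp => ?_
  rw [List.mem_range] at hp
  rw [decide_eq_decide, ← h _ (Nat.mod_lt _ ?_) _ (Nat.mod_lt _ ?_)]
  · congr!
    rename_i i
    fin_cases i <;> simp
  all_goals
    rcases Nat.eq_zero_or_pos (x .size) with h0 | h0
    · simp [h0] at hp
    · exact h0

/-- The tables during the computation. -/
def glueTables (Y : FinInstance (mpowLang L m)) (l l' : List Bool) :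
    Sym (mpowLang L m) ⊕ Fin 3 → List Bool :=
  Sum.elim Y.bits ![l, l', [] ]

theorem update_glueTables_zero (Y : FinInstance (mpowLang L m)) (l l' l'' : List Bool) :
    Function.update (glueTables Y l l') (Sum.inr 0) l'' = glueTables Y l'' l' := by
  funext j
  rcases j with s | j
  · simp [glueTables]
  · fin_cases j <;> simp [glueTables]

theorem update_glueTables_one (Y : FinInstance (mpowLang L m)) (l l' l'' : List Bool) :
    Function.update (glueTables Y l l') (Sum.inr 1) l'' = glueTables Y l l'' := by
  funext j
  rcases j with s | j
  · simp [glueTables]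
  · fin_cases j <;> simp [glueTables]

/-- The counters during the computation. -/
def glueCtr (m n : ℕ) : Ctr (GlueArr L) → ℕ := Function.update (Ctr.init n) .size (m * n)

end Glue

/-! ### The formulas for gluing express what they should -/

section GlueMachine

variable {L : FirstOrder.Language.{0, 0}} {m : ℕ}

theorem bits_eq_tableOf {V J : Type} [DecidableEq V] (X : FinInstance L) {T : J → List Bool}
    {x : V → ℕ} {b : V} (hb : x b = X.size) (s : Sym L) {a : Fin s.1 → V} {φ : Fm V J}
    (h : ∀ y : Fin s.1 → Fin X.size,
      φ.Holds T (Function.extend a (fun i => (y i : ℕ)) x) ↔ X.str.RelMap s.2 y) :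
    X.bits s = tableOf T x b a φ := by
  classical
  have hlen := X.length_bits s
  refine List.ext_getElem (hlen.trans (by simp [tableOf, hb])) fun p hp hp' => ?_
  rw [hlen] at hp
  simp only [FinInstance.bits, tableOf, List.getElem_ofFn, List.getElem_map, List.getElem_range]
  rw [decide_eq_decide, ← h, hb]
  rfl

theorem val_finProdFinEquiv {m n : ℕ} (c : Fin m) (a : Fin n) :
    (finProdFinEquiv (c, a) : ℕ) = a + n * c := rfl

/-- The counters have the values needed to evaluate the formulas. -/
structure GlueCtrOk (m k : ℕ) (x : Ctr (GlueArr L) → ℕ) : Prop where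
  n : x .n = k
  one : x .one = 1
  size : x .size = m * k

theorem glueCtr_ok (m n : ℕ) : GlueCtrOk m n (glueCtr (L := L) m n) where
  n := by simp [glueCtr, Ctr.init]
  one := by simp [glueCtr, Ctr.init]
  size := by simp [glueCtr]

theorem GlueCtrOk.extend {n : ℕ} {x : Ctr (GlueArr L) → ℕ} (h : GlueCtrOk m n x) {d : ℕ}
    (a : Fin d → GlueArr L) (y : Fin d → ℕ) :
    GlueCtrOk m n (Function.extend (fun i => Ctr.arr (a i)) y x) where
  n := by rw [Function.extend_apply' _ _ _ (by simp), h.n]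
  one := by rw [Function.extend_apply' _ _ _ (by simp), h.one]
  size := by rw [Function.extend_apply' _ _ _ (by simp), h.size]

theorem holds_linkSym {Y : FinInstance (mpowLang L m)} {x : Ctr (GlueArr L) → ℕ}
    (hx : GlueCtrOk m Y.size x) (l l' : List Bool) (R : (mpowLang L m).Relations 2) (c d : Fin m)
    (a b : GlueArr L) :
    (linkSym ⟨2, R⟩ c d (.arr a) (.arr b)).Holds (glueTables Y l l') x ↔
      ∃ u v : Fin Y.size, Y.str.RelMap R ![u, v] ∧ x (.arr a) = finProdFinEquiv (c, u) ∧
        x (.arr b) = finProdFinEquiv (d, v) := by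
  have key : ∀ u v : Fin Y.size, ((glueTables Y l l' (Sum.inl ⟨2, R⟩))[idx (Function.update
      (Function.update x .ex₁ u) .ex₂ v) [(.ex₁, .n), (.ex₂, .n)] ]? = some true ↔
      Y.str.RelMap R ![u, v]) := by
    intro u v
    have := Y.getElem?_bits R (x := Function.update (Function.update x .ex₁ u) .ex₂ v) (b := .n)
      (by simp [hx.n]) (a := ![.ex₁, .ex₂]) ![u, v] (by intro k; fin_cases k <;> simp)
    rw [show glueTables Y l l' (Sum.inl ⟨2, R⟩) = Y.bits ⟨2, R⟩ from rfl]
    simpa using this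
  simp only [linkSym, Fm.Holds]
  constructor
  · rintro ⟨u, hu, v, hv, h1, h2, h3⟩
    rw [hx.n] at hu
    rw [Function.update_of_ne (by simp), hx.n] at hv
    refine ⟨⟨u, hu⟩, ⟨v, hv⟩, (key ⟨u, hu⟩ ⟨v, hv⟩).1 h1, ?_, ?_⟩
    · simpa [idx_coord, hx.one, hx.n, val_finProdFinEquiv] using h2
    · simpa [idx_coord, hx.one, hx.n, val_finProdFinEquiv] using h3
  · rintro ⟨u, v, h1, h2, h3⟩
    refine ⟨u, by rw [hx.n]; exact u.2, v, by simp [hx.n], (key u v).2 h1, ?_, ?_⟩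
    · simpa [idx_coord, hx.one, hx.n, val_finProdFinEquiv] using h2
    · simpa [idx_coord, hx.one, hx.n, val_finProdFinEquiv] using h3

/-- The relation whose pivots are computed. -/
def LinkNat (Y : FinInstance (mpowLang L m)) (a b : ℕ) : Prop :=
  ∃ a' b' : Fin (m * Y.size), (a' = b' ∨ Link Y a' b' ∨ Link Y b' a') ∧ a = a' ∧ b = b'

theorem holds_linkFm [FiniteSignature L] {Y : FinInstance (mpowLang L m)}
    {x : Ctr (GlueArr L) → ℕ} (hx : GlueCtrOk m Y.size x) (l l' : List Bool) {a b : ℕ}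
    (ha : a < m * Y.size) (hb : b < m * Y.size) (hxa : x (uVar 0) = a) (hxb : x (uVar 1) = b) :
    linkFm.Holds (glueTables Y l l') x ↔ LinkNat Y a b := by
  simp only [linkFm, Fm.Holds, Fm.holds_any, List.mem_flatMap]
  simp only [idx, mul_zero, add_zero, hxa, hxb]
  have hL : ∀ a' b' : Fin (m * Y.size), a' = b' ∨ Link Y a' b' ∨ Link Y b' a' ↔
      LinkNat Y a' b' := by
    intro a' b'
    constructor
    · exact fun h => ⟨a', b', h, rfl, rfl⟩
    · rintro ⟨a'', b'', h, h1, h2⟩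
      cases Fin.ext h1
      cases Fin.ext h2
      exact h
  rw [show LinkNat Y a b ↔ _ from (hL ⟨a, ha⟩ ⟨b, hb⟩).symm]
  refine or_congr (by simp) ?_
  constructor
  · rintro ⟨φ, ⟨⟨_, ⟨R, i⟩ | ⟨ℓ, h1, hm, i, j⟩⟩, -, hφ⟩, h⟩
    · simp [linkFms] at hφ
    · simp only [linkFms, List.mem_flatMap, List.mem_finRange, true_and, List.mem_cons,
        List.not_mem_nil, or_false] at hφ
      obtain ⟨k, rfl | rfl⟩ := hφ
      · obtain ⟨u, v, h2, h3, h4⟩ := (holds_linkSym hx _ _ _ _ _ _ _).1 h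
        exact .inl ⟨ℓ, h1, hm, i, j, k, u, v, h2, Fin.ext (hxa.symm.trans h3),
          Fin.ext (hxb.symm.trans h4)⟩
      · obtain ⟨u, v, h2, h3, h4⟩ := (holds_linkSym hx _ _ _ _ _ _ _).1 h
        exact .inr ⟨ℓ, h1, hm, i, j, k, u, v, h2, Fin.ext (hxb.symm.trans h3),
          Fin.ext (hxa.symm.trans h4)⟩
  · rintro (⟨ℓ, h1, hm, i, j, k, u, v, h2, h3, h4⟩ | ⟨ℓ, h1, hm, i, j, k, u, v, h2, h3, h4⟩)
    · refine ⟨linkSym ⟨2, MPowRel.eq ℓ h1 hm i j⟩ (i k) (j k) (uVar 0) (uVar 1),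
        ⟨_, FinInstance.mem_symbolList ⟨2, MPowRel.eq ℓ h1 hm i j⟩, by
          simp [linkFms]
          exact ⟨k, by simp⟩⟩,
        (holds_linkSym hx _ _ _ _ _ _ _).2 ⟨u, v, h2, ?_, ?_⟩⟩
      · exact hxa.trans (congrArg Fin.val h3)
      · exact hxb.trans (congrArg Fin.val h4)
    · refine ⟨linkSym ⟨2, MPowRel.eq ℓ h1 hm i j⟩ (i k) (j k) (uVar 1) (uVar 0),
        ⟨_, FinInstance.mem_symbolList ⟨2, MPowRel.eq ℓ h1 hm i j⟩, by
          simp [linkFms]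
          exact ⟨k, by simp⟩⟩,
        (holds_linkSym hx _ _ _ _ _ _ _).2 ⟨u, v, h2, ?_, ?_⟩⟩
      · exact hxb.trans (congrArg Fin.val h3)
      · exact hxa.trans (congrArg Fin.val h4)

theorem holds_pivotFm {Y : FinInstance (mpowLang L m)} {x : Ctr (GlueArr L) → ℕ}
    {P : ℕ → ℕ → Prop} {l' : List Bool} {a b v : ℕ} (hx : x .size = m * Y.size)
    (ha : a < m * Y.size) (hb : b < m * Y.size) (hv : v < m * Y.size) (hxa : x (uVar 0) = a)
    (hxb : x (uVar 1) = b) (hxv : x .piv = v) :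
    pivotFm.Holds (glueTables Y (relTable (m * Y.size) P) l') x ↔ pivot P v a b := by
  have h : glueTables Y (relTable (m * Y.size) P) l' (Sum.inr 0) = relTable (m * Y.size) P := rfl
  simp only [pivotFm, Fm.Holds, h, idx, hxa, hxb, hxv, hx, mul_zero, add_zero,
    getElem?_relTable P ha hb, getElem?_relTable P ha hv, getElem?_relTable P hv hb, pivot]

theorem holds_glueOutput [FiniteSignature L] {Y : FinInstance (mpowLang L m)}
    {x : Ctr (GlueArr L) → ℕ} (hx : GlueCtrOk m Y.size x) {P : ℕ → ℕ → Prop} {l' : List Bool}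
    (hP : ∀ a b : Fin (m * Y.size), P a b ↔ Relation.EqvGen (Link Y) a b) (s : Sym L)
    (y : Fin s.1 → Fin (m * Y.size)) (hy : ∀ k, x (.arr (Sum.inr ⟨s, k⟩)) = y k) :
    ((glueOutput L m).φ s).Holds (glueTables Y (relTable (m * Y.size) P) l') x ↔
      (glue Y).str.RelMap s.2 y := by
  have h : glueTables Y (relTable (m * Y.size) P) l' (Sum.inr 0) = relTable (m * Y.size) P := rfl
  have key : ∀ (i : Fin s.1 → Fin m) (u : Fin Y.size),
      ((glueTables Y (relTable (m * Y.size) P) l' (Sum.inl ⟨1, MPowRel.unary s.2 i⟩))[idx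
        (Function.update x .ex₁ u) [(.ex₁, .n)] ]? = some true ↔
          Y.str.RelMap (MPowRel.unary s.2 i) ![u]) := by
    intro i u
    have := Y.getElem?_bits (MPowRel.unary s.2 i) (x := Function.update x .ex₁ u) (b := .n)
      (by simp [hx.n]) (a := ![.ex₁]) ![u] (by intro k; fin_cases k; simp)
    rw [show glueTables Y (relTable (m * Y.size) P) l' (Sum.inl ⟨1, MPowRel.unary s.2 i⟩) =
      Y.bits ⟨1, MPowRel.unary s.2 i⟩ from rfl]
    simpa using this
  have key' : ∀ (i : Fin s.1 → Fin m) (u : Fin Y.size) (k : Fin s.1),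
      ((relTable (m * Y.size) P)[idx (Function.update x .ex₁ u)
        ((.arr (Sum.inr ⟨s, k⟩), .size) :: coord .ex₁ (i k))]? = some true ↔
          Relation.EqvGen (Link Y) (y k) (finProdFinEquiv (i k, u))) := by
    intro i u k
    rw [← hP, ← getElem?_relTable P (y k).2 (finProdFinEquiv (i k, u)).2, idx, idx_coord]
    · simp [hy, hx.size, hx.n]
    · simp [hx.one]
  simp only [glueOutput, Fm.holds_any, List.mem_map, Finset.mem_toList, Finset.mem_univ, true_and,
    exists_exists_eq_and, Fm.Holds, Fm.holds_all, List.forall_mem_ofFn_iff, h]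
  refine exists_congr fun i => ?_
  constructor
  · rintro ⟨u, hu, h1, h2⟩
    rw [hx.n] at hu
    exact ⟨⟨u, hu⟩, (key i ⟨u, hu⟩).1 h1, fun k => (key' i ⟨u, hu⟩ k).1 (h2 k)⟩
  · rintro ⟨u, h1, h2⟩
    exact ⟨u, by rw [hx.n]; exact u.2, (key i u).2 h1, fun k => (key' i u k).2 (h2 k)⟩

end GlueMachine

/-! ### Gluing is computable in polynomial time -/

section GlueMachine

variable {L : FirstOrder.Language.{0, 0}} {m : ℕ}

theorem avoids_linkFm [FiniteSignature L] (j : Fin 3) :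
    (linkFm (L := L) (m := m)).Avoids (Sum.inr j) := by
  refine ⟨trivial, Fm.avoids_any fun φ hφ => ?_⟩
  obtain ⟨⟨_, ⟨R, i⟩ | ⟨ℓ, h1, hm, i, j⟩⟩, -, hφ⟩ := List.mem_flatMap.1 hφ
  · simp [linkFms] at hφ
  · simp only [linkFms, List.mem_flatMap, List.mem_finRange, true_and, List.mem_cons,
      List.not_mem_nil, or_false] at hφ
    obtain ⟨k, rfl | rfl⟩ := hφ <;> exact ⟨Sum.inl_ne_inr, trivial, trivial⟩

theorem fresh_linkSym {x : Ctr (GlueArr L) → ℕ} (h1 : x .ex₁ = 0) (h2 : x .ex₂ = 0)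
    (s : Sym (mpowLang L m)) (c d : ℕ) (a b : Ctr (GlueArr L)) : (linkSym s c d a b).Fresh x :=
  ⟨by simp, h1, fun _ _ => ⟨by simp, by rw [Function.update_of_ne (by simp), h2],
    fun _ _ => ⟨trivial, trivial, trivial⟩⟩⟩

theorem fresh_linkFm [FiniteSignature L] {x : Ctr (GlueArr L) → ℕ} (h1 : x .ex₁ = 0)
    (h2 : x .ex₂ = 0) : (linkFm (L := L) (m := m)).Fresh x := by
  refine ⟨trivial, Fm.fresh_any fun φ hφ => ?_⟩
  obtain ⟨⟨_, ⟨R, i⟩ | ⟨ℓ, _, hm, i, j⟩⟩, -, hφ⟩ := List.mem_flatMap.1 hφ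
  · simp [linkFms] at hφ
  · simp only [linkFms, List.mem_flatMap, List.mem_finRange, true_and, List.mem_cons,
      List.not_mem_nil, or_false] at hφ
    obtain ⟨k, rfl | rfl⟩ := hφ <;> exact fresh_linkSym h1 h2 _ _ _ _ _

theorem glueCtr_of_ne (n : ℕ) {c : Ctr (GlueArr L)} (hc : c ≠ .size) :
    glueCtr m n c = Ctr.init n c := Function.update_of_ne hc _ _

theorem length_relTable (N : ℕ) (P : ℕ → ℕ → Prop) : (relTable N P).length = N ^ 2 := by
  simp [relTable]

abbrev GlueFrag (L : FirstOrder.Language.{0, 0}) (m : ℕ) : Type 1 :=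
  Frag (Stk (Ctr (GlueArr L)) (Sym (mpowLang L m) ⊕ Fin 3))

/-- Replace the table of a relation by the one that results from pivoting. -/
def pivotStep : GlueFrag L m :=
  .seq (.tabulate (Sum.inr 1) .size 2 uVar pivotFm) (.seq (.clear (.tab (Sum.inr 0)))
    (.seq (.move (.tab (Sum.inr 1)) .tmp) (.move .tmp (.tab (Sum.inr 0)))))

def pivotStepCost (L : FirstOrder.Language.{0, 0}) (m : ℕ) : Polynomial ℕ :=
  Frag.tabulateCost (pivotFm (L := L) (m := m)) 2 + (Polynomial.X ^ 2 * 6 + 3)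

/-- All entries must be computed from the old relation, so the new table is built in slot `1` before
slot `0` is overwritten. The transfer passes through `tmp`, since a single `move` would reverse it.
-/
theorem pivotStep_does {Y : FinInstance (mpowLang L m)} {x : Ctr (GlueArr L) → ℕ} {M v : ℕ}
    (hM : ∀ c, x c ≤ M) (hx : x .size = m * Y.size) (h0 : ∀ i, x (uVar i) = 0) (hv : x .piv = v)
    (hv' : v < m * Y.size) (P : ℕ → ℕ → Prop) :
    pivotStep.Does (store x (glueTables Y (relTable (m * Y.size) P) []) [] [])
      (store x (glueTables Y (relTable (m * Y.size) (pivot P v)) []) [] [])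
      ((pivotStepCost L m).eval M) := by
  have h01 : (Sum.inr 0 : Sym (mpowLang L m) ⊕ Fin 3) ≠ Sum.inr 1 := by simp
  have h1 := Frag.tabulate_does (glueTables Y (relTable (m * Y.size) P) []) [] []
    (j := Sum.inr 1) (b := .size) (φ := pivotFm) ⟨h01, h01, h01⟩ uVar_injective
    (by simp [uVar]) hM h0 (fun _ _ => ⟨trivial, trivial, trivial⟩)
  rw [update_glueTables_one, tableOf_uVar _ _ _ (pivot P v) (by
    intro a ha b hb
    rw [hx] at ha hb
    refine holds_pivotFm ?_ ha hb hv' ?_ ?_ ?_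
    · rw [Function.extend_apply' _ _ _ (by simp [uVar]), hx]
    · rw [uVar_injective.extend_apply]; rfl
    · rw [uVar_injective.extend_apply]; rfl
    · rw [Function.extend_apply' _ _ _ (by simp [uVar]), hv])] at h1
  simp only [hx] at h1
  rw [show glueTables Y (relTable (m * Y.size) P) [] (Sum.inr 1) = [] from rfl,
    List.append_nil] at h1
  have h2 := Frag.clear_does (.tab (Sum.inr 0)) (store x (glueTables Y (relTable (m * Y.size) P)
    (relTable (m * Y.size) (pivot P v))) [] [])
  rw [update_store_tab, update_glueTables_zero] at h2
  have h3 := Frag.move_does (a := .tab (Sum.inr 1)) (b := .tmp) (by simp)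
    (store x (glueTables Y [] (relTable (m * Y.size) (pivot P v))) [] [])
  rw [update_store_tab, update_glueTables_one] at h3
  have h4 := Frag.move_does' (a := .tmp) (b := .tab (Sum.inr 0)) (by simp)
    (S := Function.update (store x (glueTables Y [] []) [] []) .tmp
      ((relTable (m * Y.size) (pivot P v)).reverse ++ []))
    (S' := store x (glueTables Y (relTable (m * Y.size) (pivot P v)) []) [] []) rfl (by
      rw [Function.update_self, Function.update_of_ne (by simp)]
      simp [glueTables]) (by
      intro k hk hk'
      rw [Function.update_of_ne hk, ← update_glueTables_zero Y [] [], ← update_store_tab,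
        Function.update_of_ne hk'])
  refine Frag.Does.mono (Frag.seq_does h1 (Frag.seq_does h2 (Frag.seq_does h3 h4))) ?_
  have hN : (m * Y.size) ^ 2 ≤ M ^ 2 := Nat.pow_le_pow_left (hx ▸ hM _) 2
  have e0 : ∀ l l', glueTables Y l l' (Sum.inr 0) = l := fun _ _ => rfl
  have e1 : ∀ l l', glueTables Y l l' (Sum.inr 1) = l' := fun _ _ => rfl
  simp only [store_tab, e0, e1, Function.update_self, List.length_append, List.length_reverse,
    List.length_nil, length_relTable, pivotStepCost, Polynomial.eval_add, Polynomial.eval_mul,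
    Polynomial.eval_pow, Polynomial.eval_X, Polynomial.eval_ofNat]
  omega

/-- Compute the size of the output and the equivalence relation on coordinates. -/
def glueFrag (L : FirstOrder.Language.{0, 0}) [FiniteSignature L] (m : ℕ) : GlueFrag L m :=
  .seq (.setIndex .size (List.replicate m (.n, .one)))
    (.seq (.tabulate (Sum.inr 0) .size 2 uVar linkFm) (.forDown .piv .size pivotStep))

def glueCost (L : FirstOrder.Language.{0, 0}) [FiniteSignature L] (m : ℕ) : Polynomial ℕ :=
  Frag.setIndexCost (List.replicate m ((.n, .one) : Ctr (GlueArr L) × Ctr (GlueArr L))) +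
    (Frag.tabulateCost (linkFm (L := L) (m := m)) 2 + Frag.forCost (pivotStepCost L m))

/-- The tables after the computation. -/
def glueResult (Y : FinInstance (mpowLang L m)) : Sym (mpowLang L m) ⊕ Fin 3 → List Bool :=
  glueTables Y (relTable (m * Y.size) (pivots (LinkNat Y) (m * Y.size) (m * Y.size))) []

theorem glueFrag_does [FiniteSignature L] (Y : FinInstance (mpowLang L m)) {M : ℕ}
    (hM : (m + 1) * (Y.size + 1) ≤ M) :
    (glueFrag L m).Does (store (Ctr.init Y.size) (Sum.elim Y.bits fun _ => []) [] [])
      (store (glueCtr m Y.size) (glueResult Y) [] []) ((glueCost L m).eval M) := by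
  have hn : Y.size ≤ M := by nlinarith
  have h1 : 1 ≤ M := by nlinarith
  have hs : m * Y.size ≤ M := by nlinarith
  have hM' : ∀ c : Ctr (GlueArr L), Ctr.init Y.size c ≤ M := by
    intro c
    cases c <;> simp [Ctr.init] <;> omega
  have hM'' : ∀ c : Ctr (GlueArr L), glueCtr m Y.size c ≤ M := by
    intro c
    cases c <;> simp [glueCtr, Ctr.init] <;> omega
  have eN : glueCtr m Y.size (Ctr.size (A := GlueArr L)) = m * Y.size :=
    (glueCtr_ok m Y.size).size
  have eT : (Sum.elim Y.bits fun _ => [] : Sym (mpowLang L m) ⊕ Fin 3 → List Bool) =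
      glueTables Y [] [] := by
    funext j
    rcases j with s | j
    · rfl
    · fin_cases j <;> rfl
  have s1 := Frag.setIndex_does hM' (glueTables Y [] []) [] [] .size rfl
    (List.replicate m (.n, .one))
  rw [idx_replicate_one (Ctr.init Y.size) rfl,
    show Ctr.init Y.size (Ctr.n (A := GlueArr L)) = Y.size from rfl,
    Nat.mul_comm] at s1
  have s2 := Frag.tabulate_does (glueTables Y [] []) [] [] (j := Sum.inr 0) (b := .size)
    (φ := linkFm) (avoids_linkFm 0) uVar_injective (by simp [uVar]) hM''
    (fun _ => glueCtr_of_ne _ (by simp [uVar]))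
    (fun y hy => by
      refine fresh_linkFm ?_ ?_ <;> rw [Function.extend_apply' _ _ _ (by simp [uVar])] <;>
        exact glueCtr_of_ne _ (by simp))
  rw [update_glueTables_zero, tableOf_uVar _ _ _ (LinkNat Y) (by
    intro a ha b hb
    rw [eN] at ha hb
    refine holds_linkFm ((glueCtr_ok m Y.size).extend _ _) _ _ ha hb ?_ ?_
    · exact (uVar_injective (L := L)).extend_apply _ _ 0
    · exact (uVar_injective (L := L)).extend_apply _ _ 1)] at s2
  rw [eN, show glueTables Y [] [] (Sum.inr 0) = [] from rfl, List.append_nil] at s2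
  -- At loop state `i` the pivots `N - 1, …, i` are done, where `N = m * Y.size`: the descending
  -- counter matches the order in `pivots`.
  have s3 := Frag.forDown_does (v := .piv) (b := .size) (by simp) (F := pivotStep) (M := M)
    (x := glueCtr m Y.size) (hM'' _) (glueCtr_of_ne _ (by simp)) (c := pivotStepCost L m)
    (fun i => glueTables Y (relTable (m * Y.size)
      (pivots (LinkNat Y) (m * Y.size) (m * Y.size - i))) []) (fun _ => []) [] (by
    intro i hi
    rw [eN] at hi
    have e1 : m * Y.size - i = m * Y.size - (i + 1) + 1 := by omega
    have e2 : m * Y.size - (m * Y.size - (i + 1) + 1) = i := by omega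
    simp only [e1, pivots, e2]
    refine pivotStep_does ?_ ?_ ?_ ?_ hi _
    · intro c
      by_cases hc : c = .piv
      · subst hc
        simp
        omega
      · simpa [hc] using hM'' c
    · rw [Function.update_of_ne (by simp), eN]
    · intro i
      rw [Function.update_of_ne (by simp [uVar])]
      exact glueCtr_of_ne _ (by simp [uVar])
    · simp)
  rw [eN] at s3
  simp only [Nat.sub_self, Nat.sub_zero] at s3
  rw [eT]
  exact (Frag.seq_does s1 (Frag.seq_does s2 s3)).mono (by simp [glueCost])

theorem glueOutput_ok (Y : FinInstance (mpowLang L m)) :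
    (glueOutput L m).Ok (glueCtr m Y.size) (glueResult Y) where
  empty := rfl
  a_injective i j _ := Subsingleton.elim (α := Fin 1) i j
  a_ne _ := by simp [glueOutput, uVar]
  a_zero _ := glueCtr_of_ne _ (by simp [glueOutput, uVar])
  avoids s := by
    refine Fm.avoids_any fun φ hφ => ?_
    obtain ⟨i, -, rfl⟩ := List.mem_map.1 hφ
    refine ⟨Sum.inl_ne_inr, Fm.avoids_all fun φ hφ => ?_⟩
    obtain ⟨k, rfl⟩ := (List.mem_ofFn' _ _).1 hφ
    exact fun h => by simp [glueOutput] at h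
  args_injective s i j h := by
    cases h
    rfl
  args_ne s i := by simp [glueOutput]
  args_zero s i := glueCtr_of_ne _ (by simp [glueOutput])
  fresh s y hy := by
    refine Fm.fresh_any fun φ hφ => ?_
    obtain ⟨i, -, rfl⟩ := List.mem_map.1 hφ
    refine ⟨by simp, ?_, fun _ _ => ⟨trivial, Fm.fresh_all fun φ hφ => ?_⟩⟩
    · rw [Function.extend_apply' _ _ _ (by simp [glueOutput])]
      exact glueCtr_of_ne _ (by simp)
    · obtain ⟨k, rfl⟩ := (List.mem_ofFn' _ _).1 hφ
      trivial

theorem bits_glue [FiniteSignature L] (Y : FinInstance (mpowLang L m)) (s : Sym L) :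
    (glue Y).bits s = tableOf (glueResult Y) (glueCtr m Y.size) .size
      ((glueOutput L m).args s) ((glueOutput L m).φ s) := by
  refine bits_eq_tableOf _ (glueCtr_ok m Y.size).size s fun y => ?_
  refine holds_glueOutput ((glueCtr_ok m Y.size).extend _ _)
    (pivots_iff_eqvGen (fun a b => Iff.rfl)) s y fun k => ?_
  exact ((glueOutput_ok Y).args_injective s).extend_apply _ _ k

theorem isPolyTime_glue [FiniteSignature L] {C D C' D' : Type*} [L.Structure C']
    [L.Structure D'] [(mpowLang L m).Structure C] [(mpowLang L m).Structure D] :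
    IsPolyTime (PCSP (mpowLang L m) C D) (PCSP L C' D') glue := by
  -- Since `Y.size + 1` is at most the length of the encoding, `z` bounds all counters; `z ^ 2`
  -- accounts for the table of a binary relation on `m * Y.size` elements.
  let z : Polynomial ℕ := Polynomial.C (m + 1) * Polynomial.X
  have hz : ∀ Y : FinInstance (mpowLang L m),
      (m + 1) * (Y.size + 1) ≤ z.eval Y.encode.length := by
    intro Y
    simp only [z, Polynomial.eval_mul, Polynomial.eval_C, Polynomial.eval_X]
    exact Nat.mul_le_mul_left _ Y.size_lt_length_encode
  refine isPolyTime_of_output (glueOutput L m) (glueFrag L m) ((glueCost L m).comp z) (z + z ^ 2)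
    (fun Y => glueCtr m Y.size) glueResult (fun Y => ?_) glueOutput_ok (fun Y v => ?_)
    (fun Y j => ?_) (fun Y => ?_) bits_glue
  · rw [Polynomial.eval_comp]
    exact glueFrag_does Y (hz Y)
  · have := hz Y
    rw [Polynomial.eval_add]
    cases v <;> simp [glueCtr, Ctr.init] <;> nlinarith
  · have h := hz Y
    rw [Polynomial.eval_add, Polynomial.eval_pow]
    rcases j with s | j
    · have h1 := Y.length_bits_le s
      have h2 : Y.encode.length ≤ z.eval Y.encode.length := by
        simp only [z, Polynomial.eval_mul, Polynomial.eval_C, Polynomial.eval_X]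
        nlinarith
      change (Y.bits s).length ≤ _
      omega
    · fin_cases j
      · change (relTable _ _).length ≤ _
        rw [length_relTable]
        have : m * Y.size ≤ z.eval Y.encode.length := by nlinarith
        have := Nat.pow_le_pow_left this 2
        omega
      · simp [glueResult, glueTables]
      · simp [glueResult, glueTables]
  · rw [show (glueOutput L m).b = Ctr.size from rfl, (glueCtr_ok m Y.size).size]
    exact (pow_one _).symm

end GlueMachine

/-! ### Correctness of the reductions -/

theorem relMap_of_eq {L : FirstOrder.Language.{0, 0}} {M : Type u} [L.Structure M] {ℓ : ℕ}
    {R : L.Relations ℓ} {x y : Fin ℓ → M} (e : x = y) (h : Structure.RelMap R x) :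
    Structure.RelMap R y := e ▸ h

section Reductions

variable {L : FirstOrder.Language.{0, 0}}

/-- In `A^{[m]}` the relations `eq` are honest equalities of coordinates, so `h` is constant on
classes of linked coordinates. -/
theorem eq_of_eqvGen_link {m : ℕ} {Y : FinInstance (mpowLang L m)} {A : Type u} [L.Structure A]
    (h : Y.Carrier →[mpowLang L m] MPow m A) {a b : Fin (m * Y.size)}
    (hab : Relation.EqvGen (Link Y) a b) :
    (h (finProdFinEquiv.symm a).2 : MPow m A) (finProdFinEquiv.symm a).1 =
      (h (finProdFinEquiv.symm b).2 : MPow m A) (finProdFinEquiv.symm b).1 := by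
  induction hab with
  | rel a b hab =>
    obtain ⟨ℓ, h1, hm, i, j, k, y, z, hR, rfl, rfl⟩ := hab
    simp only [Equiv.symm_apply_apply]
    exact h.map_rel _ _ hR k
  | refl a => rfl
  | symm a b _ ih => exact ih.symm
  | trans a b c _ _ ih ih' => exact ih.trans ih'

variable [FiniteSignature L]

/-- The projection to a quotient. -/
def relQuotHom {M : Type u} [L.Structure M] (θ : Setoid M) : M →[L] RelQuot θ where
  toFun := RelQuot.mk θ
  map_fun' f := ((‹FiniteSignature L›.isRelational _).false f).elim
  map_rel' _ x h := ⟨x, h, fun _ => rfl⟩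

theorem isHomomorphicImage_relQuot {M : Type u} [L.Structure M] (θ : Setoid M) :
    IsHomomorphicImage L M (RelQuot θ) :=
  ⟨relQuotHom θ, Quotient.mk_surjective, fun _ _ _ h => h⟩

/-- A homomorphism from `Y` to `A^{[m]}` gives one from the glued structure to `A`. -/
def glueHom {m : ℕ} {Y : FinInstance (mpowLang L m)} {A : Type u} [L.Structure A]
    (h : Y.Carrier →[mpowLang L m] MPow m A) : (glue Y).Carrier →[L] A where
  toFun x := (h (finProdFinEquiv.symm x).2 : MPow m A) (finProdFinEquiv.symm x).1
  map_fun' f := ((‹FiniteSignature L›.isRelational _).false f).elim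
  map_rel' {_} R x := by
    rintro ⟨i, y, hR, hx⟩
    refine relMap_of_eq (funext fun k => ?_) (h.map_rel _ _ hR :)
    have := eq_of_eqvGen_link h (hx k)
    rw [Equiv.symm_apply_apply] at this
    exact this.symm

/-- Equivalent coordinates are distinct elements of `glue Y`, and `g` may separate them. Evaluating
`g` at a chosen representative of each class enforces the relations `eq`; the relations of `L`
survive because they are saturated. -/
theorem nonempty_hom_mpow_of_glue {m : ℕ} {Y : FinInstance (mpowLang L m)} {B : Type u}
    [L.Structure B] (g : (glue Y).Carrier →[L] B) :
    Nonempty (Y.Carrier →[mpowLang L m] MPow m B) := by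
  let θ : Setoid (Fin (m * Y.size)) := Relation.EqvGen.setoid (Link Y)
  let rep : Fin (m * Y.size) → Fin (m * Y.size) := fun x => (Quotient.mk θ x).out
  have hrep : ∀ x, Relation.EqvGen (Link Y) (rep x) x := fun x => Quotient.mk_out (s := θ) x
  have hrep' : ∀ x y, Link Y x y → rep x = rep y := fun x y h =>
    congrArg Quotient.out (Quotient.sound (s := θ) (Relation.EqvGen.rel _ _ h))
  refine ⟨⟨fun y c => g (rep (finProdFinEquiv (c, y))), fun f => Empty.elim f, ?_⟩⟩
  rintro _ (⟨R, i⟩ | ⟨ℓ, h1, hm, i, j⟩) x hx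
  · refine g.map_rel R (fun k => rep (finProdFinEquiv (i k, x 0))) ⟨i, x 0, ?_, fun k => hrep _⟩
    exact relMap_of_eq (M := Y.Carrier) (x := x) (y := ![x 0]) (List.ofFn_inj.1 rfl) hx
  · refine fun k => congrArg g (hrep' _ _ ⟨ℓ, h1, hm, i, j, k, x 0, x 1, ?_, rfl, rfl⟩)
    exact relMap_of_eq (M := Y.Carrier) (x := x) (y := ![x 0, x 1]) (List.ofFn_inj.1 rfl) hx

/-- For no-instances, a homomorphism from `glue Y` to `B` yields one to `B^{[m]}`, and then to the
quotient by projecting. -/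
theorem isPolyReduction_glue {L' : FirstOrder.Language.{0, 0}} {m : ℕ} {A : Type u} {B : Type v}
    [L.Structure A] [L.Structure B] [L'.Structure B] :
    IsPolyReduction (PCSP (mpowLang L m) (MPow m A) (MPowQuot L' m B)) (PCSP L A B) glue :=
  ⟨isPolyTime_glue, fun (Y : FinInstance (mpowLang L m)) ⟨h⟩ => ⟨glueHom (Y := Y) h⟩,
    fun (Y : FinInstance (mpowLang L m)) h => ⟨fun g =>
    let ⟨k⟩ := nonempty_hom_mpow_of_glue (Y := Y) g
    h.false ((relQuotHom _).comp k)⟩⟩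

/-- The operator `X ↦ X^{[m]}` on homomorphisms. -/
def mpowMap {X : Type u} {Y : Type v} [L.Structure X] [L.Structure Y] (m : ℕ) (g : X →[L] Y) :
    MPow m X →[mpowLang L m] MPow m Y where
  toFun a k := g (a k)
  map_fun' f := Empty.elim f
  map_rel' {_} R a h := by
    cases R with
    | unary R i => exact g.map_rel R _ h
    | eq ℓ h1 hm i j => exact fun k => congrArg g (h k)

/-- Surjectivity of `π` matters only for no-instances: a homomorphism to the quotient has a
preimage, which would be a homomorphism to `B`. -/
theorem isPolyReduction_powInstance {L' : FirstOrder.Language.{0, 0}} {m : ℕ} {A : Type u}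
    {B : Type v} [L.Structure A] [L.Structure B] [L'.Structure B]
    (h : ∀ X : FinInstance L, Function.Surjective (mpowPi L L' m X.Carrier B)) :
    IsPolyReduction (PCSP L A B) (PCSP (mpowLang L m) (MPow m A) (MPowQuot L' m B))
      (powInstance m) :=
  ⟨isPolyTime_powInstance m, fun (X : FinInstance L) ⟨g⟩ =>
    ⟨(mpowMap m g).comp (powInstanceEquiv m X).toHom⟩,
    fun (X : FinInstance L) hX => ⟨fun g => by
      obtain ⟨f, -⟩ := h X (g.comp (powInstanceEquiv m X).symm.toHom)
      exact hX.false f⟩⟩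

end Reductions

/-! ### Tuples of the same quantifier-free type -/

section SameType

variable {L : FirstOrder.Language.{0, 0}} {ι κ : Type*} {M N Q : Type*} [L.Structure M]
  [L.Structure N] [L.Structure Q]

/-- The tuples `f` and `g` satisfy the same atomic formulas. -/
structure SameType (L : FirstOrder.Language.{0, 0}) {ι M N : Type*} [L.Structure M]
    [L.Structure N] (f : ι → M) (g : ι → N) : Prop where
  eq_iff : ∀ i j, f i = f j ↔ g i = g j
  rel_iff : ∀ {ℓ} (R : L.Relations ℓ) (i : Fin ℓ → ι),
    Structure.RelMap R (fun k => f (i k)) ↔ Structure.RelMap R (fun k => g (i k))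

namespace SameType

theorem symm {f : ι → M} {g : ι → N} (h : SameType L f g) : SameType L g f :=
  ⟨fun i j => (h.eq_iff i j).symm, fun R i => (h.rel_iff R i).symm⟩

theorem trans {f : ι → M} {g : ι → N} {p : ι → Q} (h : SameType L f g) (h' : SameType L g p) :
    SameType L f p :=
  ⟨fun i j => (h.eq_iff i j).trans (h'.eq_iff i j),
    fun R i => (h.rel_iff R i).trans (h'.rel_iff R i)⟩

theorem comp {f : ι → M} {g : ι → N} (h : SameType L f g) (s : κ → ι) :
    SameType L (fun k => f (s k)) (fun k => g (s k)) :=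
  ⟨fun i j => h.eq_iff (s i) (s j), fun R i => h.rel_iff R fun k => s (i k)⟩

theorem of_embedding (e : M ↪[L] N) (f : ι → M) : SameType L f fun k => e (f k) :=
  ⟨fun _ _ => e.injective.eq_iff.symm, fun R i => (e.map_rel R fun k => f (i k)).symm⟩

theorem nonempty_embedding (hL : L.IsRelational) {f : M → N}
    (h : SameType L (fun x => x) f) : ∃ e : M ↪[L] N, ∀ x, e x = f x :=
  ⟨{ toFun := f
     inj' := fun x y e => (h.eq_iff x y).2 e
     map_fun' := fun F => ((hL _).false F).elim
     map_rel' := fun R x => (h.rel_iff R x).symm }, fun _ => rfl⟩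

end SameType

/-- In a relational language the range of `f` is a finite substructure, and `f i ↦ g i` is an
embedding of it, which homogeneity extends. -/
theorem exists_equiv_of_sameType (hL : L.IsRelational) (hM : L.IsUltrahomogeneous M) [Finite ι]
    {f g : ι → M} (h : SameType L f g) : ∃ α : M ≃[L] M, ∀ i, α (f i) = g i := by
  have hS : (Substructure.closure L (Set.range f) : Set M) = Set.range f :=
    Substructure.closure_eq_of_isRelational L _
  set S := Substructure.closure L (Set.range f) with hS'
  have hfg : S.FG := ⟨(Set.finite_range f).toFinset, by simp [hS']⟩
  have hmem : ∀ s : S, ∃ i, f i = s := fun s => by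
    have : (s : M) ∈ (S : Set M) := s.2
    rwa [hS] at this
  -- The choice of indices is immaterial, because `g` identifies whatever `f` identifies.
  choose c hc using hmem
  obtain ⟨e, he⟩ := SameType.nonempty_embedding (M := S) (N := M) hL (f := fun s => g (c s))
    ⟨fun s t => by rw [← h.eq_iff, hc, hc, Subtype.ext_iff],
      fun R x => by
        rw [← h.rel_iff]
        simp only [hc]
        rfl⟩
  obtain ⟨α, hα⟩ := hM S hfg e
  refine ⟨α, fun i => ?_⟩
  have hi : f i ∈ S := Substructure.subset_closure ⟨i, rfl⟩
  have h1 : e ⟨f i, hi⟩ = α (f i) := by rw [hα]; rfl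
  rw [← h1, he]
  exact (h.eq_iff _ _).1 (hc ⟨f i, hi⟩)

end SameType

/-! ### Embedding countable structures into finitely bounded homogeneous ones -/

section Bounds

variable {L : FirstOrder.Language.{0, 0}} [hL : FiniteSignature L] {M : Type u} {Q : Type v}
  [L.Structure M] [L.Structure Q]

/-- The structure is transported to `Fin n`, because bounds are tested on structures in `Type`. If
it did not embed, some substructure of size at most `k` would not either, contradicting `h`. -/
theorem exists_sameType_of_bounds {k : ℕ} (hb : HasBoundsOfSizeAtMost L M k)
    (h : ∀ (ι : Type) [Finite ι] (x : ι → Q), Nat.card ι ≤ k → ∃ f : ι → M, SameType L x f)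
    {n : ℕ} (x : Fin n → Q) (hx : Function.Injective x) : ∃ f : Fin n → M, SameType L x f := by
  let : L.Structure (Fin n) :=
    { funMap := fun F => ((hL.isRelational _).false F).elim
      RelMap := fun R i => Structure.RelMap R fun k => x (i k) }
  have hid : SameType L (fun i : Fin n => i) x := ⟨fun i j => hx.eq_iff.symm, fun R i => Iff.rfl⟩
  by_contra hne
  obtain ⟨S, hS, hS'⟩ := hb (Fin n)
    ⟨fun e => hne ⟨e, hid.symm.trans (SameType.of_embedding e _)⟩⟩
  obtain ⟨f, hf⟩ := h S (fun s => x s) hS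
  obtain ⟨e, -⟩ := SameType.nonempty_embedding (M := S) (N := M) hL.isRelational
    (f := f) (((SameType.of_embedding S.subtype fun s => s).trans (hid.comp _)).trans hf)
  exact hS'.false e

theorem nonempty_embedding_of_bounds [Countable Q] (hM : L.IsUltrahomogeneous M) {k : ℕ}
    (hb : HasBoundsOfSizeAtMost L M k)
    (h : ∀ (ι : Type) [Finite ι] (x : ι → Q), Nat.card ι ≤ k → ∃ f : ι → M, SameType L x f) :
    Nonempty (Q ↪[L] M) := by
  have : L.IsRelational := hL.isRelational
  have : IsEmpty (L.Relations 0) := hL.no_nullary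
  have hT : ∀ T : L.Substructure Q, Finite T → Nonempty (T ↪[L] M) := by
    intro T hT
    obtain ⟨n, ⟨e⟩⟩ := Finite.exists_equiv_fin T
    obtain ⟨f, hf⟩ := exists_sameType_of_bounds hb h (fun i => (e.symm i : Q))
      (Subtype.val_injective.comp e.symm.injective)
    have hf' := hf.comp e
    simp only [Equiv.symm_apply_apply] at hf'
    obtain ⟨g, -⟩ := SameType.nonempty_embedding hL.isRelational
      ((SameType.of_embedding T.subtype fun t => t).trans hf')
    exact ⟨g⟩
  -- The finite substructure generated by `S` and `x` has some embedding into `M`; homogeneity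
  -- corrects it so that it extends `f`.
  have hext : L.IsExtensionPair Q M := by
    rw [isExtensionPair_iff_exists_embedding_closure_singleton_sup]
    intro S hS f x
    have : Nonempty (↥(Substructure.closure L {x} ⊔ S) ↪[L] M) :=
      hT _ ((Substructure.fg_closure_singleton x).sup hS).finite
    exact hM.extend_embedding (S.fg_iff_structure_fg.1 hS) f
      (Substructure.inclusion le_sup_right)
  -- The construction starts with `default`, the empty partial isomorphism, which exists because
  -- there are no constants and no nullary relations.
  obtain ⟨f, -⟩ := embedding_from_cg Structure.cg_of_countable default hext
  exact ⟨f⟩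

end Bounds

/-! ### Gluing consistent local types -/

section Realizes

variable {L : FirstOrder.Language.{0, 0}} {M : Type u} {Z : Type v} {ι κ : Type*} [L.Structure M]
  {E : Z → Z → Prop} {Rel : ∀ ⦃ℓ⦄, L.Relations ℓ → (Fin ℓ → Z) → Prop}

/-- The atomic formulas that hold for `f` are those prescribed for `z` by `E` and `Rel`. -/
structure Realizes (E : Z → Z → Prop) (Rel : ∀ ⦃ℓ⦄, L.Relations ℓ → (Fin ℓ → Z) → Prop)
    (f : ι → M) (z : ι → Z) : Prop where
  eq_iff : ∀ i j, f i = f j ↔ E (z i) (z j)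
  rel_iff : ∀ {ℓ} (R : L.Relations ℓ) (i : Fin ℓ → ι),
    Structure.RelMap R (fun k => f (i k)) ↔ Rel R (fun k => z (i k))

theorem Realizes.comp {f : ι → M} {z : ι → Z} (h : Realizes E Rel f z) (s : κ → ι) :
    Realizes E Rel (fun k => f (s k)) (fun k => z (s k)) :=
  ⟨fun i j => h.eq_iff (s i) (s j), fun R i => h.rel_iff R fun k => s (i k)⟩

theorem Realizes.sameType {f : ι → M} {g : κ → M} {z : ι → Z} {z' : κ → Z} {τ : Type*}
    (h : Realizes E Rel f z) (h' : Realizes E Rel g z') {s : τ → ι} {s' : τ → κ}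
    (e : ∀ t, z (s t) = z' (s' t)) : SameType L (fun t => f (s t)) (fun t => g (s' t)) := by
  have h1 := h.comp s
  simp only [e] at h1
  exact ⟨fun i j => (h1.eq_iff i j).trans (h'.comp s' |>.eq_iff i j).symm,
    fun R i => (h1.rel_iff R i).trans ((h'.comp s').rel_iff R i).symm⟩

variable [hL : FiniteSignature L]

/-- A shorter tuple is padded to length `K` by repeating entries. With no entry to repeat there is
nothing to check, as nullary relations are excluded. -/
theorem exists_realizes_of_card_le {K : ℕ}
    (h : ∀ z : Fin K → Z, ∃ f : Fin K → M, Realizes E Rel f z) {ι : Type*} [Finite ι]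
    (hι : Nat.card ι ≤ K) (z : ι → Z) : ∃ f : ι → M, Realizes E Rel f z := by
  cases isEmpty_or_nonempty ι with
  | inl _ =>
    refine ⟨isEmptyElim, isEmptyElim, fun {ℓ} R i => ?_⟩
    rcases ℓ with _ | ℓ
    · exact (hL.no_nullary.false R).elim
    · exact isEmptyElim (i 0)
  | inr _ =>
    let e := Finite.equivFin ι
    let a : ι → Fin K := fun i => Fin.castLE hι (e i)
    have ha : Function.Injective a := (Fin.castLE_injective hι).comp e.injective
    obtain ⟨f, hf⟩ := h fun k => z (Function.invFun a k)
    refine ⟨fun i => f (a i), ?_⟩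
    simpa only [Function.leftInverse_invFun ha _] using hf.comp a

/-- The compactness-like core of the proof: `K ≥ 3` makes `E` transitive, arity at most `K - 1`
makes it a congruence for `Rel`, and `K ≥ k` makes the quotient satisfy the bounds, so it embeds
into `M`. -/
theorem exists_realizes [Countable Z] (hM : L.IsUltrahomogeneous M) {k K : ℕ}
    (hb : HasBoundsOfSizeAtMost L M k) (hK : 3 ≤ K) (hk : k ≤ K) (har : ArityAtMost L (K - 1))
    (h : ∀ z : Fin K → Z, ∃ f : Fin K → M, Realizes E Rel f z) :
    ∃ g : Z → M, Realizes E Rel g fun z => z := by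
  classical
  have loc := fun (n : ℕ) (hn : n ≤ K) (z : Fin n → Z) =>
    exists_realizes_of_card_le h (by simpa using hn) z
  let θ : Setoid Z :=
    { r := E
      iseqv :=
        { refl := fun a => by
            obtain ⟨f, hf⟩ := loc 1 (by omega) ![a]
            exact (hf.eq_iff 0 0).1 rfl
          symm := fun {a b} hab => by
            obtain ⟨f, hf⟩ := loc 2 (by omega) ![a, b]
            exact (hf.eq_iff 1 0).1 ((hf.eq_iff 0 1).2 hab).symm
          trans := fun {a b c} hab hbc => by
            obtain ⟨f, hf⟩ := loc 3 hK ![a, b, c]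
            exact (hf.eq_iff 0 2).1 (((hf.eq_iff 0 1).2 hab).trans ((hf.eq_iff 1 2).2 hbc)) } }
  -- The entries of `z` together with `w` are at most `ℓ + 1 ≤ K` elements, hence realized
  -- simultaneously, and there `w` and `z j` have the same value.
  have hupd : ∀ {ℓ} (R : L.Relations ℓ) (z : Fin ℓ → Z) (j : Fin ℓ) (w : Z), E (z j) w →
      (Rel R (Function.update z j w) ↔ Rel R z) := by
    intro ℓ R z j w hw
    have hℓ := har ℓ ⟨R⟩
    obtain ⟨f, hf⟩ := exists_realizes_of_card_le h (ι := Option (Fin ℓ))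
      (by simp; omega) (fun o => o.elim w z)
    have e : f none = f (some j) := ((hf.eq_iff (some j) none).2 hw).symm
    have e1 : (fun k => f (Function.update some j none k)) = fun k => f (some k) := by
      funext k
      by_cases hk : k = j
      · subst hk
        simpa using e
      · simp [hk]
    have e2 : (fun k => (Function.update some j none k : Option (Fin ℓ)).elim w z) =
        Function.update z j w := by
      funext k
      by_cases hk : k = j
      · subst hk
        simp
      · simp [hk]
    have h1 := hf.rel_iff R (Function.update some j none)
    rw [e1, e2] at h1
    exact h1.symm.trans (hf.rel_iff R some)
  have hcongr : ∀ {ℓ} (R : L.Relations ℓ) (z z' : Fin ℓ → Z), (∀ j, E (z j) (z' j)) →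
      (Rel R z' ↔ Rel R z) := by
    intro ℓ R z z' hz
    -- The entries are exchanged one at a time, since `z` and `z'` together may be too many elements
    -- to be realized at once.
    have : ∀ s : Finset (Fin ℓ), Rel R (s.piecewise z' z) ↔ Rel R z := by
      intro s
      induction s using Finset.induction with
      | empty => simp
      | insert j s hj ih =>
        rw [Finset.piecewise_insert, hupd R _ j _ (by simpa [hj] using hz j), ih]
    simpa using this Finset.univ
  let : L.Structure (Quotient θ) :=
    { funMap := fun F => ((hL.isRelational _).false F).elim
      RelMap := fun R q => Rel R fun k => (q k).out }
  have hout : ∀ {ℓ} (R : L.Relations ℓ) (z : Fin ℓ → Z),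
      Structure.RelMap R (fun k => Quotient.mk θ (z k)) ↔ Rel R z := fun R z =>
    hcongr R z _ fun j => θ.symm (Quotient.mk_out (z j))
  obtain ⟨e⟩ := nonempty_embedding_of_bounds (Q := Quotient θ) hM hb (fun ι _ x hι => by
    obtain ⟨f, hf⟩ := exists_realizes_of_card_le h (hι.trans hk) fun i => (x i).out
    refine ⟨f, fun i j => ?_, fun R i => (hf.rel_iff R i).symm⟩
    rw [hf.eq_iff]
    exact Quotient.out_equiv_out.symm)
  refine ⟨fun z => e (Quotient.mk θ z), fun a b => ?_, fun R i => ?_⟩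
  · rw [e.injective.eq_iff]
    exact Quotient.eq
  · rw [← hout]
    exact e.map_rel R _

end Realizes

/-! ### Fullness -/

section Full

variable {L L' : FirstOrder.Language.{0, 0}} {m : ℕ} {B : Type v} [L.Structure B] [L'.Structure B]

theorem relMap_equiv_iff (hred : IsFirstOrderReduct L L' B) (α : B ≃[L'] B) {ℓ : ℕ}
    (R : L.Relations ℓ) (x : Fin ℓ → B) :
    Structure.RelMap R (fun k => α (x k)) ↔ Structure.RelMap R x := by
  obtain ⟨φ, hφ⟩ := hred ℓ R
  rw [hφ, hφ]
  exact StrongHomClass.realize_formula α φ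

theorem mk_eq_mk_iff {a b : MPow m B} :
    RelQuot.mk (orbitSetoid L' m B) a = RelQuot.mk (orbitSetoid L' m B) b ↔
      ∃ α : B ≃[L'] B, ∀ k, α (a k) = b k := Quotient.eq

/-- Homogeneity: orbits of tuples are exactly quantifier-free types. -/
theorem mk_eq_mk_iff_sameType (hL' : L'.IsRelational) (hB : L'.IsUltrahomogeneous B)
    {a b : MPow m B} : RelQuot.mk (orbitSetoid L' m B) a = RelQuot.mk (orbitSetoid L' m B) b ↔
      SameType L' a b := by
  rw [mk_eq_mk_iff]
  refine ⟨?_, exists_equiv_of_sameType hL' hB⟩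
  rintro ⟨α, hα⟩
  rw [← show (fun k => α (a k)) = b from funext hα]
  exact SameType.of_embedding α.toEmbedding a

/-- A finite relational signature has only finitely many quantifier-free types of `m`-tuples. -/
theorem finite_mPowQuot [hL' : FiniteSignature L'] (hB : L'.IsUltrahomogeneous B) :
    Finite (MPowQuot L' m B) := by
  let code : MPow m B → (Fin m → Fin m → Prop) × (∀ s : Sym L', (Fin s.1 → Fin m) → Prop) :=
    fun a => (fun i j => a i = a j, fun s i => Structure.RelMap s.2 fun k => a (i k))
  refine Finite.of_injective (fun q : MPowQuot L' m B => code (Quotient.out q)) fun p q h => ?_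
  rw [← Quotient.out_eq p, ← Quotient.out_eq q]
  refine (mk_eq_mk_iff_sameType hL'.isRelational hB).2 ⟨fun i j => ?_, fun {ℓ} R i => ?_⟩
  · exact Iff.of_eq (congrFun (congrFun (congrArg Prod.fst h) i) j)
  · exact Iff.of_eq (congrFun (congrFun (congrArg Prod.snd h) ⟨ℓ, R⟩) i)

variable [hL : FiniteSignature L] {X : Type u} [L.Structure X]

/-- Representatives of the orbits that are the values of `h`. -/
def orbitRep (h : MPow m X →[mpowLang L m] MPowQuot L' m B) (a : MPow m X) : MPow m B :=
  Quotient.out (h a)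

theorem mk_orbitRep (h : MPow m X →[mpowLang L m] MPowQuot L' m B) (a : MPow m X) :
    RelQuot.mk _ (orbitRep h a) = h a := Quotient.out_eq (h a)

/-- Relations of the quotient are images, so `eq` between two orbits only says that some members of
them agree on the shared entries. Automorphisms carrying these members to the chosen representatives
turn agreement into equality up to an automorphism. -/
theorem exists_equiv_orbitRep (h : MPow m X →[mpowLang L m] MPowQuot L' m B) {ℓ : ℕ}
    (h1 : 1 ≤ ℓ) (hm : ℓ ≤ m) (a a' : MPow m X) (i j : Fin ℓ → Fin m)
    (e : ∀ k, a (i k) = a' (j k)) :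
    ∃ α : B ≃[L'] B, ∀ k, α (orbitRep h a (i k)) = orbitRep h a' (j k) := by
  obtain ⟨x, hx, hx'⟩ := h.map_rel (MPowRel.eq ℓ h1 hm i j) ![a, a'] e
  obtain ⟨β, hβ⟩ := mk_eq_mk_iff.1 ((hx' 0).trans (mk_orbitRep h a).symm)
  obtain ⟨β', hβ'⟩ := mk_eq_mk_iff.1 ((hx' 1).trans (mk_orbitRep h a').symm)
  refine ⟨β'.comp β.symm, fun k => ?_⟩
  rw [Equiv.comp_apply, ← hβ, β.symm_apply_apply, ← hβ']
  exact congrArg β' (hx k)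

theorem relMap_orbitRep (hred : IsFirstOrderReduct L L' B)
    (h : MPow m X →[mpowLang L m] MPowQuot L' m B) {ℓ : ℕ} (R : L.Relations ℓ) (a : MPow m X)
    (i : Fin ℓ → Fin m) (hR : Structure.RelMap R fun k => a (i k)) :
    Structure.RelMap R fun k => orbitRep h a (i k) := by
  obtain ⟨x, hx, hx'⟩ := h.map_rel (MPowRel.unary R i) ![a] hR
  obtain ⟨β, hβ⟩ := mk_eq_mk_iff.1 ((hx' 0).trans (mk_orbitRep h a).symm)
  simp only [← hβ]
  exact (relMap_equiv_iff hred β R _).2 hx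

/-- The orbits chosen by `h` prescribe types for all `m`-tuples of `X`; a map `g` that realizes them
all at once is the required preimage. -/
theorem surjective_mpowPi [hL' : FiniteSignature L'] [Countable X] (hm : 3 ≤ m)
    (hred : IsFirstOrderReduct L L' B)
    (hB : L'.IsUltrahomogeneous B) (hb : HasBoundsOfSizeAtMost L' B m)
    (har' : ArityAtMost L' (m - 1)) (har : ArityAtMost L m) :
    Function.Surjective (mpowPi L L' m X B) := by
  intro h
  -- Both prescriptions ask for one `m`-tuple containing the given elements; `loc` shows that every
  -- such tuple gives the same answer.
  let E : X → X → Prop := fun x y =>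
    ∃ (a : MPow m X) (i : Fin 2 → Fin m), a (i 0) = x ∧ a (i 1) = y ∧
      orbitRep h a (i 0) = orbitRep h a (i 1)
  let Rel : ∀ ⦃ℓ⦄, L'.Relations ℓ → (Fin ℓ → X) → Prop := fun ℓ R z =>
    ∃ (a : MPow m X) (i : Fin ℓ → Fin m), (∀ k, a (i k) = z k) ∧
      Structure.RelMap R fun k => orbitRep h a (i k)
  have loc : ∀ a : MPow m X, Realizes E Rel (orbitRep h a) a := by
    intro a
    refine ⟨fun i j => ⟨fun e => ⟨a, ![i, j], rfl, rfl, e⟩, ?_⟩,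
      fun {ℓ} R i => ⟨fun e => ⟨a, i, fun _ => rfl, e⟩, ?_⟩⟩
    · rintro ⟨a', i', h0, h1, e⟩
      obtain ⟨α, hα⟩ := exists_equiv_orbitRep h (by omega) (by omega) a' a i' ![i, j] (by
        intro k
        fin_cases k
        · exact h0
        · exact h1)
      exact (hα 0).symm.trans ((congrArg α e).trans (hα 1))
    · rintro ⟨a', i', h0, e⟩
      have hℓ : 1 ≤ ℓ := Nat.one_le_iff_ne_zero.2 (by
        rintro rfl
        exact hL'.no_nullary.false R)
      have := har' ℓ ⟨R⟩
      obtain ⟨α, hα⟩ := exists_equiv_orbitRep h hℓ (by omega) a' a i' i h0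
      simp only [← hα]
      exact (α.map_rel R _).2 e
  obtain ⟨g, hg⟩ := exists_realizes hB hb hm le_rfl har' fun z => ⟨_, loc z⟩
  refine ⟨⟨g, fun F => ((hL.isRelational _).false F).elim, fun {ℓ} R x hx => ?_⟩, ?_⟩
  · have hℓ : 0 < ℓ := Nat.pos_of_ne_zero (by
      rintro rfl
      exact hL.no_nullary.false R)
    have hℓm := har ℓ ⟨R⟩
    -- The `ℓ`-tuple `x` is extended to length `m` by repeating its last entry.
    let a : MPow m X := fun k => x ⟨min k (ℓ - 1), by omega⟩
    have ha : ∀ k, a (Fin.castLE hℓm k) = x k := fun k =>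
      congrArg x (Fin.ext (by simp; omega))
    obtain ⟨α, hα⟩ := exists_equiv_of_sameType hL'.isRelational hB
      ((loc a).sameType hg (s := Fin.castLE hℓm) (s' := x) ha)
    have h1 := relMap_orbitRep hred h R a (Fin.castLE hℓm) (by simpa only [ha] using hx)
    have h2 := (relMap_equiv_iff hred α R _).2 h1
    simp only [hα] at h2
    exact h2
  · refine Hom.ext fun a => ?_
    refine Eq.trans ?_ (mk_orbitRep h a)
    exact (mk_eq_mk_iff_sameType hL'.isRelational hB).2
      (hg.sameType (loc a) (s := a) (s' := fun k => k) fun _ => rfl)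

end Full

/-! ### Definability -/

section Definable

variable {L : FirstOrder.Language.{0, 0}} {M : Type u} [L.Structure M]

/-- There are finitely many atomic formulas in `ℓ` variables, so `S` is a finite union of sets
defined by conjunctions of literals. -/
theorem exists_formula_of_sameType [FiniteSignature L] {ℓ : ℕ} (S : (Fin ℓ → M) → Prop)
    (hS : ∀ x y, SameType L x y → S x → S y) :
    ∃ φ : L.Formula (Fin ℓ), ∀ x, S x ↔ φ.Realize x := by
  classical
  let atom : (Fin ℓ × Fin ℓ) ⊕ (Σ s : Sym L, Fin s.1 → Fin ℓ) → L.Formula (Fin ℓ) :=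
    Sum.elim (fun p => Term.equal (Term.var p.1) (Term.var p.2))
      (fun p => Relations.formula p.1.2 fun k => Term.var (p.2 k))
  have hatom : ∀ x y : Fin ℓ → M, (∀ p, (atom p).Realize x ↔ (atom p).Realize y) →
      SameType L x y := by
    refine fun x y h => ⟨fun i j => ?_, fun {r} R i => ?_⟩
    · simpa [atom, Formula.realize_equal] using h (Sum.inl (i, j))
    · simpa [atom, Formula.realize_rel] using h (Sum.inr ⟨⟨r, R⟩, i⟩)
  let type : (Fin ℓ → M) → (Fin ℓ × Fin ℓ) ⊕ (Σ s : Sym L, Fin s.1 → Fin ℓ) → Prop :=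
    fun x p => (atom p).Realize x
  refine ⟨.iSup fun t : {t // ∃ x, S x ∧ type x = t} =>
    .iInf fun p => if t.1 p then atom p else ∼(atom p), fun x => ?_⟩
  rw [Formula.realize_iSup]
  simp only [Formula.realize_iInf]
  constructor
  · refine fun hx => ⟨⟨type x, x, hx, rfl⟩, fun p => ?_⟩
    split_ifs with hp
    · exact hp
    · exact Formula.realize_not.2 hp
  · rintro ⟨⟨_, y, hy, rfl⟩, h⟩
    refine hS y x (hatom y x fun p => ?_) hy
    have hp := h p
    split_ifs at hp with hyp
    · exact iff_of_true hyp hp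
    · exact iff_of_false hyp (Formula.realize_not.1 hp)

end Definable

/-! ### Powers of finitely bounded homogeneous structures -/

/-- The relation symbols of the structure of coordinates on `m`-tuples. -/
inductive CoordRel (L : FirstOrder.Language.{0, 0}) (m : ℕ) : ℕ → Type
  | eq (i j : Fin m) : CoordRel L m 2
  | rel {ℓ : ℕ} (R : L.Relations ℓ) (i : Fin ℓ → Fin m) : CoordRel L m ℓ

def coordLang (L : FirstOrder.Language.{0, 0}) (m : ℕ) : FirstOrder.Language.{0, 0} :=
  ⟨fun _ => Empty, CoordRel L m⟩

instance (L : FirstOrder.Language.{0, 0}) [hL : FiniteSignature L] (m : ℕ) :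
    FiniteSignature (coordLang L m) where
  isRelational _ := inferInstanceAs (IsEmpty Empty)
  no_nullary := ⟨fun R => by
    cases R with
    | rel R i => exact hL.no_nullary.false R⟩
  finite_relations := by
    let g : (Fin m × Fin m) ⊕ (Σ s : Sym L, Fin s.1 → Fin m) →
        (Σ ℓ, (coordLang L m).Relations ℓ) :=
      Sum.elim (fun p => ⟨2, CoordRel.eq p.1 p.2⟩) (fun p => ⟨p.1.1, CoordRel.rel p.1.2 p.2⟩)
    refine Finite.of_surjective g ?_
    rintro ⟨_, ⟨i, j⟩ | ⟨R, i⟩⟩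
    · exact ⟨Sum.inl (i, j), rfl⟩
    · exact ⟨Sum.inr ⟨⟨_, R⟩, i⟩, rfl⟩

/-- Two coordinates are equal, or a tuple of coordinates is in a relation. -/
instance coordStructure (L : FirstOrder.Language.{0, 0}) (m : ℕ) (X : Type u) [L.Structure X] :
    (coordLang L m).Structure (MPow m X) where
  funMap f := Empty.elim f
  RelMap {_} R := match R with
    | CoordRel.eq i j => fun a => a 0 i = a 1 j
    | CoordRel.rel R i => fun a => Structure.RelMap R fun k => a k (i k)

section Coord

variable {L : FirstOrder.Language.{0, 0}} {m : ℕ} {M : Type u} [L.Structure M]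

/-- The coordinate language was chosen so that a type of `m`-tuples determines the type of all their
coordinates taken together. -/
theorem SameType.uncurry {ι : Type*} {f g : ι → MPow m M} (h : SameType (coordLang L m) f g) :
    SameType L (fun p : ι × Fin m => f p.1 p.2) (fun p => g p.1 p.2) :=
  ⟨fun p q => h.rel_iff (CoordRel.eq p.2 q.2) ![p.1, q.1],
    fun R i => h.rel_iff (CoordRel.rel R fun k => (i k).2) fun k => (i k).1⟩

/-- Automorphisms act on tuples. -/
def mpowEquiv (m : ℕ) (α : M ≃[L] M) : MPow m M ≃[coordLang L m] MPow m M where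
  toEquiv := Equiv.piCongrRight fun _ => α.toEquiv
  map_fun' f := Empty.elim f
  map_rel' {_} R a := by
    cases R with
    | eq i j => exact α.injective.eq_iff
    | rel R i => exact α.map_rel R _

/-- A finite partial isomorphism preserves the joint type of all coordinates; an automorphism of `M`
realizing it on coordinates acts on tuples and extends it. -/
theorem isUltrahomogeneous_mpow (hL : L.IsRelational) (hM : L.IsUltrahomogeneous M) :
    (coordLang L m).IsUltrahomogeneous (MPow m M) := by
  intro S hS f
  have hP : (coordLang L m).IsRelational := fun _ => inferInstanceAs (IsEmpty Empty)
  have : Finite S := hS.finite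
  obtain ⟨α, hα⟩ := exists_equiv_of_sameType hL hM
    ((SameType.of_embedding S.subtype fun s => s).symm.trans
      (SameType.of_embedding f fun s => s)).uncurry
  refine ⟨mpowEquiv m α, Embedding.ext fun s => funext fun i => (hα (s, i)).symm⟩

/-- The structure on `N` prescribes equalities and relations among the points of `N × Fin m`. Any
`m` of these points involve at most `m` elements of `N`, so if all substructures of that size embed,
the local types are realized and glue to a map `N × Fin m → M`. -/
theorem hasBounds_mpow [hL : FiniteSignature L] [Countable M] (hM : L.IsUltrahomogeneous M)
    {k : ℕ} (hb : HasBoundsOfSizeAtMost L M k) (hm : 3 ≤ m) (hk : k ≤ m)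
    (har : ArityAtMost L (m - 1)) : HasBoundsOfSizeAtMost (coordLang L m) (MPow m M) m := by
  intro N _ _ hN
  by_contra! hS
  have hP : (coordLang L m).IsRelational := fun _ => inferInstanceAs (IsEmpty Empty)
  have loc : ∀ {ι : Type} [Finite ι] (x : ι → N), Nat.card ι ≤ m →
      ∃ f : ι → MPow m M, SameType (coordLang L m) x f := by
    intro ι _ x hx
    let S := Substructure.closure (coordLang L m) (Set.range x)
    have hS' : (S : Set N) = Set.range x := Substructure.closure_eq_of_isRelational _ _
    have hc : Nat.card S ≤ m := by
      have : Nat.card S = Nat.card (Set.range x) := by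
        change Nat.card (S : Set N) = _
        rw [hS']
      rw [this]
      exact (Finite.card_range_le x).trans hx
    obtain ⟨e⟩ := hS S hc
    have hx' : ∀ i, x i ∈ S := fun i => Substructure.subset_closure ⟨i, rfl⟩
    let y : ι → S := fun i => ⟨x i, hx' i⟩
    exact ⟨fun i => e (y i),
      (SameType.of_embedding S.subtype y).symm.trans (SameType.of_embedding e y)⟩
  let E : N × Fin m → N × Fin m → Prop := fun p q =>
    Structure.RelMap (L := coordLang L m) (CoordRel.eq p.2 q.2) ![p.1, q.1]
  let Rel : ∀ ⦃ℓ⦄, L.Relations ℓ → (Fin ℓ → N × Fin m) → Prop := fun _ R z =>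
    Structure.RelMap (L := coordLang L m) (CoordRel.rel R fun k => (z k).2) fun k => (z k).1
  have hvec : ∀ {ι κ : Type} (x : ι → κ) (i j : ι), (fun k => x (![i, j] k)) = ![x i, x j] := by
    intro ι κ x i j
    funext k
    fin_cases k <;> rfl
  have hloc : ∀ z : Fin m → N × Fin m, ∃ f : Fin m → M, Realizes E Rel f z := by
    intro z
    obtain ⟨f, hf⟩ := loc (fun i => (z i).1) (by simp)
    refine ⟨fun i => f i (z i).2, fun i j => ?_, fun R i => ?_⟩
    · have := hf.rel_iff (CoordRel.eq (z i).2 (z j).2) ![i, j]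
      rw [hvec fun i => (z i).1] at this
      exact this.symm
    · exact (hf.rel_iff (CoordRel.rel R fun k => (z (i k)).2) i).symm
  obtain ⟨g, hg⟩ := exists_realizes hM hb hm hk har hloc
  obtain ⟨e, -⟩ := SameType.nonempty_embedding (M := N) (N := MPow m M) hP
    (f := fun x i => g (x, i)) (by
      refine ⟨fun x y => ⟨fun h => by rw [h], fun h => ?_⟩, fun {ℓ} R x => ?_⟩
      -- Two distinct elements of `N` cannot agree in all coordinates, because the substructure on
      -- these two embeds.
      · obtain ⟨f, hf⟩ := loc ![x, y] (by simp; omega)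
        refine (hf.eq_iff 0 1).2 (funext fun i => ?_)
        have h1 := (hg.eq_iff (x, i) (y, i)).1 (congrFun h i)
        have h2 := hf.rel_iff (CoordRel.eq i i) ![0, 1]
        rw [hvec] at h2
        exact h2.1 h1
      · cases R with
        | eq i j =>
          refine Iff.trans ?_ (hg.eq_iff (x 0, i) (x 1, j)).symm
          exact Iff.of_eq (congrArg _ (funext fun k => by fin_cases k <;> rfl))
        | rel R i => exact (hg.rel_iff R fun k => (x k, i k)).symm)
  exact hN.false e

/-- No defining formula has to be written down: invariance under equality of types suffices, and it
follows by applying an automorphism to the coordinates. -/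
theorem isFirstOrderReduct_mpow {L L' : FirstOrder.Language.{0, 0}} [FiniteSignature L']
    {C : Type u} [L.Structure C] [L'.Structure C] (hC : L'.IsUltrahomogeneous C)
    (hred : IsFirstOrderReduct L L' C) :
    IsFirstOrderReduct (mpowLang L m) (coordLang L' m) (MPow m C) := by
  intro ℓ R
  refine exists_formula_of_sameType _ fun x y hxy hx => ?_
  cases R with
  | unary R i =>
    obtain ⟨α, hα⟩ := exists_equiv_of_sameType ‹FiniteSignature L'›.isRelational hC hxy.uncurry
    have h := (relMap_equiv_iff hred α R fun k => x 0 (i k)).2 hx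
    simp only [hα (0, _)] at h
    exact h
  | eq ℓ h1 hm i j => exact fun k => (hxy.uncurry.eq_iff (0, i k) (1, j k)).1 (hx k)

end Coord

theorem exists_arityAtMost (L : FirstOrder.Language.{0, 0}) [hL : FiniteSignature L] :
    ∃ k, ArityAtMost L k := by
  have := hL.finite_relations
  obtain ⟨k, hk⟩ := (Set.finite_range fun s : Sym L => s.1).bddAbove
  exact ⟨k, fun ℓ ⟨R⟩ => hk ⟨⟨ℓ, R⟩, rfl⟩⟩

theorem HasBoundsOfSizeAtMost.mono {L : FirstOrder.Language.{0, 0}} {M : Type u} [L.Structure M]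
    {k n : ℕ} (h : HasBoundsOfSizeAtMost L M k) (hkn : k ≤ n) : HasBoundsOfSizeAtMost L M n :=
  fun N _ _ hN =>
    let ⟨S, hS, hS'⟩ := h N hN
    ⟨S, hS.trans hkn, hS'⟩

/-! ### Assembling the theorem -/

section Main

variable {L L' : FirstOrder.Language.{0, 0}} [FiniteSignature L] [FiniteSignature L'] {m : ℕ}
  {B : Type v} [L.Structure B] [L'.Structure B]

theorem isFullReduction (hm : 3 ≤ m) (hred : IsFirstOrderReduct L L' B)
    (hB : L'.IsUltrahomogeneous B) (hb : HasBoundsOfSizeAtMost L' B m)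
    (har' : ArityAtMost L' (m - 1)) (har : ArityAtMost L m) (A : Type u) [L.Structure A] :
    IsFullReduction.{u, v, w} L L' m A B where
  reduction := ⟨powInstance m, fun X => ⟨powInstanceEquiv m X⟩,
    isPolyReduction_powInstance fun X =>
      haveI : Countable X.Carrier := inferInstanceAs (Countable (Fin X.size))
      surjective_mpowPi hm hred hB hb har' har⟩
  full _ _ _ := surjective_mpowPi hm hred hB hb har' har

theorem polyEquivalent_mpow (hm : 3 ≤ m) (hred : IsFirstOrderReduct L L' B)
    (hB : L'.IsUltrahomogeneous B) (hb : HasBoundsOfSizeAtMost L' B m)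
    (har' : ArityAtMost L' (m - 1)) (har : ArityAtMost L m) (A : Type u) [L.Structure A] :
    PolyEquivalent (PCSP L A B) (PCSP (mpowLang L m) (MPow m A) (MPowQuot L' m B)) :=
  ⟨(isFullReduction.{u, v, 0} hm hred hB hb har' har A).reduction.imp fun _ h => h.2,
    glue, isPolyReduction_glue⟩

end Main

end PromiseCSP

end

theorem mainTheorem3 :
    (∀ (m : ℕ) (_ : 3 ≤ m)
      (L L' : FirstOrder.Language.{0, 0}) [PromiseCSP.FiniteSignature L]
      [PromiseCSP.FiniteSignature L']
      (A : Type u) (B : Type v) [Countable A] [Countable B]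
      [L.Structure A] [L.Structure B] [L'.Structure B]
      (_ : Nonempty (A →[L] B))
      (_ : PromiseCSP.IsFirstOrderReduct L L' B)
      (_ : L'.IsUltrahomogeneous B)
      (_ : PromiseCSP.HasBoundsOfSizeAtMost L' B m)
      (_ : PromiseCSP.ArityAtMost L' (m - 1))
      (_ : PromiseCSP.ArityAtMost L m),
      Finite (PromiseCSP.MPowQuot L' m B) ∧
      PromiseCSP.IsHomomorphicImage (PromiseCSP.mpowLang L m)
        (PromiseCSP.MPow m B) (PromiseCSP.MPowQuot L' m B) ∧
      Nonempty (PromiseCSP.MPow m A →[PromiseCSP.mpowLang L m] PromiseCSP.MPowQuot L' m B) ∧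
      PromiseCSP.IsFullReduction.{u, v, w} L L' m A B ∧
      PromiseCSP.PolyEquivalent (PromiseCSP.PCSP L A B)
        (PromiseCSP.PCSP (PromiseCSP.mpowLang L m)
          (PromiseCSP.MPow m A) (PromiseCSP.MPowQuot L' m B))) ∧
    (∀ (L : FirstOrder.Language.{0, 0}) [PromiseCSP.FiniteSignature L]
      (C : Type u) [L.Structure C],
      PromiseCSP.InBodirskyPinskerScope L C →
      ∃ (K : FirstOrder.Language.{0, 0}) (_ : PromiseCSP.FiniteSignature K)
        (A B : Type u) (_ : K.Structure A) (_ : K.Structure B),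
        PromiseCSP.InBodirskyPinskerScope K A ∧ Finite B ∧
        PromiseCSP.IsHomomorphicImage K A B ∧
        PromiseCSP.PolyEquivalent (PromiseCSP.CSP L C) (PromiseCSP.PCSP K A B)) := by
  refine ⟨?_, ?_⟩
  · intro m hm L L' _ hL' A B _ _ _ _ _ ⟨f⟩ hred hB hb har' har
    exact ⟨PromiseCSP.finite_mPowQuot hB, PromiseCSP.isHomomorphicImage_relQuot _,
      ⟨PromiseCSP.mpowPi L L' m A B f⟩, PromiseCSP.isFullReduction hm hred hB hb har' har A,
      PromiseCSP.polyEquivalent_mpow hm hred hB hb har' har A⟩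
  · intro L _ C _ ⟨_, hcount, L', _, hL', hC, ⟨k, hb⟩, hred⟩
    obtain ⟨r, hr⟩ := PromiseCSP.exists_arityAtMost L
    obtain ⟨r', hr'⟩ := PromiseCSP.exists_arityAtMost L'
    obtain ⟨m, hm, hk, hrm, hrm'⟩ : ∃ m, 3 ≤ m ∧ k ≤ m ∧ r ≤ m ∧ r' ≤ m - 1 :=
      -- Any `m` above `3`, the size of the bounds and the arities will do; part (1) is then used
      -- with `A = B = C`.
      ⟨3 + k + r + r', by omega, by omega, by omega, by omega⟩
    have har : PromiseCSP.ArityAtMost L m := fun ℓ h => (hr ℓ h).trans hrm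
    have har' : PromiseCSP.ArityAtMost L' (m - 1) := fun ℓ h => (hr' ℓ h).trans hrm'
    refine ⟨PromiseCSP.mpowLang L m, inferInstance, PromiseCSP.MPow m C,
      PromiseCSP.MPowQuot L' m C, inferInstance, inferInstance,
      ⟨inferInstance, inferInstanceAs (Countable (Fin m → C)), PromiseCSP.coordLang L' m,
        inferInstance, inferInstance, PromiseCSP.isUltrahomogeneous_mpow hL'.isRelational hC,
        ⟨m, PromiseCSP.hasBounds_mpow hC hb hm hk har'⟩,
        PromiseCSP.isFirstOrderReduct_mpow hC hred⟩,
      PromiseCSP.finite_mPowQuot hC, PromiseCSP.isHomomorphicImage_relQuot _,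
      PromiseCSP.polyEquivalent_mpow hm hred hC (hb.mono hk) har' har C⟩
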